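/- **Setting.** A height profile is a non-decreasing function $h$ with $1\le h(t)\le t$ for $t\ge 1$. For $N\ge1$ put $h_N=\lfloor h(N)\rfloor$ and $\mathbb S_N=\mathbb Z^2\times(\mathbb Z/h_N\mathbb Z)$. Give each of the six unit steps $x\to x\pm e_i$ ($i=1,2,3$, the third coordinate modulo $h_N$) weight $\frac16$, so that $\lambda_{x,x'}$ is $\frac16$ times the number of unit steps from $x$ to $x'$ (for $h_N=2$ the two vertical steps form a double edge, for $h_N=1$ they are self-loops), and let $\kappa_x=N^{-2}$ be a killing rate; thus $\lambda_x=\sum_{x'}\lambda_{x,x'}+\kappa_x=1+N^{-2}$. Let $P_x$ be the law of the walk started at $x$ which jumps to $x'$ at rate $\lambda_{x,x'}$ and is killed (sent to an absorbing cemetery) at rate $\kappa_x$. For finite $A\subset\mathbb S_N$ let $$\mathrm{cap}_N(A)=\sum_{x\in A}\lambda_x\,P_x(\text{the walk is never in } A \text{ from its first jump on}),$$ where steps along self-loops count as jumps. For $x=(y,z)\in\mathbb S_N$ let $\hat z\in\mathbb Z$ be a representative of $z$ of least absolute value, $\|x\|=|(y,\hat z)|$ (Euclidean norm), and $$B_R=\{x:\|x\|<R\},\qquad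 D_R=\{x=(y,z): |y|<R,\ |\hat z|<R\}.$$ Let $K_0(t)=\int_0^\infty e^{-t\cosh r}\,dr$ for $t>0$ and $F_N^h(R)=R\wedge \dfrac{h_N}{K_0\left(\frac{R\vee h_N}{N}\right)}$. **Proposition (capacity of a ball).** (i) For every $C_0>0$ there are constants $c,C\in(0,\infty)$, depending only on $C_0$, such that for all height profiles $h$, all $N\ge1$ and all $R$ with $1\le R\le C_0N$, $$c\,F_N^h(R)\le \mathrm{cap}_N(B_R)\le\mathrm{cap}_N(D_R)\le C\,F_N^h(R),$$ and in particular, for $R=N$, $\;c\,h_N\le \mathrm{cap}_N(B_N)\le\mathrm{cap}_N(D_N)\le C\,h_N$. (ii) For every $\varepsilon\in(0,1)$ there are constants $C_1,C_2,C_3\in(0,\infty)$, depending only on $\varepsilon$, such that for all height profiles $h$, all $N\ge1$ and all $R$ with $C_1\le R\le \frac1{C_2}N$ and $h_N\le\frac1{C_3}N$: * if $\frac1{\varepsilon R}\le \frac1{h_N}K_0\left(\frac{R\vee h_N}{N}\right)$, then $$\frac{\pi(1-\varepsilon)}3\,\frac{h_N}{K_0\left(\frac{R\vee h_N}{N}\right)}\le\mathrm{cap}_N(D_R)\le\frac{\pi(1+\varepsilon)}3\,\frac{h_N}{K_0\left(\frac{R\vee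 h_N}{N}\right)};$$ * if $\frac1{\varepsilon R}> \frac1{h_N}K_0\left(\frac{R\vee h_N}{N}\right)$, then $$\frac{2\pi(1-\varepsilon)}3\left(\frac1R+\frac{2K_0\left(\frac{h_N}{N}\right)}{h_N}\right)^{-1}\le\mathrm{cap}_N(B_R)\le\frac{2\pi(1+\varepsilon)}3\left(\frac1R+\frac{2K_0\left(\frac{h_N}{N}\right)}{h_N}\right)^{-1}.$$ -/

import Mathlib

open MeasureTheory ProbabilityTheory

noncomputable section

/-! ## Height profile, Bessel function, order of magnitude -/

/-- A height profile: a non-decreasing function with `1 ≤ h t ≤ t`. -/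
structure IsHeightProfile (h : ℝ → ℝ) : Prop where
  monotoneOn : MonotoneOn h (Set.Ici 1)
  one_le : ∀ t, 1 ≤ t → 1 ≤ h t
  le_self : ∀ t, 1 ≤ t → h t ≤ t

/-- The height `h_N = ⌊h(N)⌋` of the slab. -/
def slabHeight (h : ℝ → ℝ) (N : ℝ) : ℕ := ⌊h N⌋₊

/-- The zeroth order modified Bessel function of the second kind,
`K₀(t) = ∫₀^∞ exp (-t cosh r) dr` for `t > 0`. -/
def besselKZero (t : ℝ) : ℝ := ∫ r in Set.Ioi (0 : ℝ), Real.exp (-t * Real.cosh r)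

/-- `F_N^h(R) = R ∧ (m / K₀((R ∨ m) / N))`, where `m = h_N`. -/
def slabF (N : ℝ) (m : ℕ) (R : ℝ) : ℝ :=
  min R ((m : ℝ) / besselKZero (max R (m : ℝ) / N))

/-! ## The slab as a weighted graph -/

/-- The slab `ℤ² × (ℤ / mℤ)` of height `m`. -/
abbrev Slab (m : ℕ) : Type := (ℤ × ℤ) × ZMod m

/-- The six signed unit steps: four horizontal ones and two vertical ones. -/
def unitStep (m : ℕ) : Fin 6 → Slab m :=
  ![((1, 0), 0), ((-1, 0), 0), ((0, 1), 0), ((0, -1), 0), ((0, 0), 1), ((0, 0), -1)]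

/-- The edge weight `λ_{x,x'}`: each of the six unit steps from `x` to `x'` contributes `1/6`.
For `m ≥ 3` the weight is `1/6` on nearest neighbours and `0` otherwise; for `m = 2` the two
vertical steps form a double edge, and for `m = 1` they are self-loops, so that the total weight
below is `1 + N⁻²` for every height. -/
def edgeWeight {m : ℕ} (x x' : Slab m) : ℝ :=
  (1 / 6 : ℝ) * ((Finset.univ.filter fun i : Fin 6 => x + unitStep m i = x').card : ℝ)

/-- The killing measure `κ_x = N⁻²` (the same at every vertex). -/
def killRate (N : ℝ) : ℝ := (N ^ 2)⁻¹

/-- The total weight `λ_x = ∑_{x'} λ_{x,x'} + κ_x`. -/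
def totalWeight {m : ℕ} (N : ℝ) (x : Slab m) : ℝ := (∑' x' : Slab m, edgeWeight x x') + killRate N

lemma edgeWeight_nonneg {m : ℕ} (x x' : Slab m) : 0 ≤ edgeWeight x x' := by
  unfold edgeWeight; positivity

lemma killRate_nonneg (N : ℝ) : 0 ≤ killRate N := by
  unfold killRate; positivity

lemma hasSum_edgeWeight {m : ℕ} (x : Slab m) : HasSum (edgeWeight x) 1 := by
  have h1 : ∀ i : Fin 6,
      HasSum (fun x' : Slab m => if x' = x + unitStep m i then (1 / 6 : ℝ) else 0) (1 / 6) :=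
    fun i => hasSum_ite_eq _ _
  have h2 := hasSum_sum (s := Finset.univ) fun i _ => h1 i
  have h3 : (∑ _i : Fin 6, (1 / 6 : ℝ)) = 1 := by norm_num
  rw [h3] at h2
  convert h2 using 2 with x'
  rw [edgeWeight, Finset.card_filter]
  push_cast
  rw [Finset.mul_sum]
  refine Finset.sum_congr rfl fun i _ => ?_
  by_cases hi : x' = x + unitStep m i
  · simp [hi]
  · simp [hi, Ne.symm hi]

lemma totalWeight_eq {m : ℕ} (N : ℝ) (x : Slab m) : totalWeight N x = 1 + killRate N := by
  rw [totalWeight, (hasSum_edgeWeight x).tsum_eq]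

/-! ## The random walk killed at rate `N⁻²` -/

/-- The state space of the walk: the vertices of the slab and a cemetery state. -/
inductive SlabState (m : ℕ) : Type
  | vertex (x : Slab m)
  | cemetery

instance instMeasurableSpaceSlabState (m : ℕ) : MeasurableSpace (SlabState m) := ⊤

instance instDiscreteMeasurableSpaceSlabState (m : ℕ) : DiscreteMeasurableSpace (SlabState m) :=
  ⟨fun _ => trivial⟩

/-- The law of one jump: from `x` to `x'` with probability `λ_{x,x'} / λ_x`, and to the
absorbing cemetery with probability `κ_x / λ_x`. -/
def jumpLaw (N : ℝ) (m : ℕ) : SlabState m → Measure (SlabState m)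
  | .vertex x =>
      Measure.sum (fun x' : Slab m =>
        ENNReal.ofReal (edgeWeight x x' / totalWeight N x) • Measure.dirac (SlabState.vertex x'))
      + ENNReal.ofReal (killRate N / totalWeight N x) • Measure.dirac SlabState.cemetery
  | .cemetery => Measure.dirac SlabState.cemetery

/-- The law of one jump, as a Markov kernel. -/
def jumpKernel (N : ℝ) (m : ℕ) : Kernel (SlabState m) (SlabState m) :=
  ⟨jumpLaw N m, measurable_from_top⟩

instance instIsMarkovKernelJumpKernel (N : ℝ) (m : ℕ) : IsMarkovKernel (jumpKernel N m) := by
  refine ⟨fun s => ⟨?_⟩⟩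
  change jumpLaw N m s Set.univ = 1
  cases s with
  | cemetery => simp [jumpLaw]
  | vertex x =>
    have hk := killRate_nonneg N
    have hw : 0 < totalWeight N x := by rw [totalWeight_eq]; linarith
    have hs : HasSum (fun x' => edgeWeight x x' / totalWeight N x) (1 / totalWeight N x) :=
      (hasSum_edgeWeight x).div_const _
    have h0 : ∀ x', 0 ≤ edgeWeight x x' / totalWeight N x :=
      fun x' => div_nonneg (edgeWeight_nonneg x x') hw.le
    simp only [jumpLaw, Measure.add_apply, Measure.sum_apply _ MeasurableSet.univ,
      Measure.smul_apply, measure_univ, smul_eq_mul, mul_one]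
    rw [← ENNReal.ofReal_tsum_of_nonneg h0 hs.summable, hs.tsum_eq,
      ← ENNReal.ofReal_add (by positivity) (by positivity), ← add_div, ← totalWeight_eq N x,
      div_self hw.ne', ENNReal.ofReal_one]

/-- The transition kernel at time `n` as a function of the whole past, which it uses only through
the state at time `n`. -/
def pathKernel (N : ℝ) (m : ℕ) (n : ℕ) :
    Kernel (Π _ : Finset.Iic n, SlabState m) (SlabState m) :=
  (jumpKernel N m).comap (fun p => p ⟨n, Finset.mem_Iic.2 le_rfl⟩) (measurable_pi_apply _)

instance instIsMarkovKernelPathKernel (N : ℝ) (m : ℕ) (n : ℕ) :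
    IsMarkovKernel (pathKernel N m n) := by
  unfold pathKernel; infer_instance

/-- The law `P_x`, on trajectories, of the discrete-time skeleton started from `x` of the
continuous-time walk which jumps from `x` to `x'` at rate `λ_{x,x'}` and is killed at rate `κ_x`. -/
def walkLaw (N : ℝ) {m : ℕ} (x : Slab m) : Measure (ℕ → SlabState m) :=
  Kernel.trajMeasure (X := fun _ => SlabState m) (Measure.dirac (SlabState.vertex x))
    (pathKernel N m)

/-! ## Equilibrium measure and capacity -/

/-- The equilibrium measure `e_A(x) = λ_x P_x(H̃_A = ∞) 1_{x ∈ A}`. The event `H̃_A = ∞` that the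
walk is never in `A` from its first jump on only depends on the skeleton. -/
def equilibriumMeasure (N : ℝ) {m : ℕ} (A : Set (Slab m)) (x : Slab m) : ℝ :=
  A.indicator
    (fun x => totalWeight N x *
      (walkLaw N x).real {ω | ∀ n : ℕ, 1 ≤ n → ω n ∉ SlabState.vertex '' A}) x

/-- The capacity of a (finite) set: the total mass of its equilibrium measure. -/
def slabCap (N : ℝ) {m : ℕ} (A : Set (Slab m)) : ℝ :=
  ∑' x : Slab m, equilibriumMeasure N A x

/-! ## Balls and thickened disks -/

/-- The Euclidean norm of the horizontal component. -/
def horNorm {m : ℕ} (x : Slab m) : ℝ := √((x.1.1 : ℝ) ^ 2 + (x.1.2 : ℝ) ^ 2)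

/-- The representative `ẑ ∈ ℤ` of the vertical component of least absolute value; `|ẑ|` is the
graph distance from `0` in the cycle `ℤ / mℤ`. -/
def vertRep {m : ℕ} (x : Slab m) : ℤ := x.2.valMinAbs

/-- `‖x‖ = |(y, ẑ)|`, a Euclidean norm in `ℝ³`. -/
def slabNorm {m : ℕ} (x : Slab m) : ℝ :=
  √((x.1.1 : ℝ) ^ 2 + (x.1.2 : ℝ) ^ 2 + (vertRep x : ℝ) ^ 2)

/-- The ball `B_R = {x : ‖x‖ < R}`. -/
def slabBall (m : ℕ) (R : ℝ) : Set (Slab m) := {x | slabNorm x < R}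

/-- The thickened disk `D_R`: the points with `|y| < R` and `|ẑ| < R`. -/
def slabDisk (m : ℕ) (R : ℝ) : Set (Slab m) := {x | horNorm x < R ∧ |(vertRep x : ℝ)| < R}

end

/-! The capacity is computed by testing the equilibrium measure against an explicit function,
without asymptotics of the Green function. Let `L v = (1 + κ) v - (1/6) ∑ v(· + sᵢ)`. The first-step
equation says `L (hitProb A) = e_A` (`stepOp_hitProb`). On `ℤ³` take `φ = e^{-kρ}/ρ` with `ρ =
√(|x|² + 1)` and `k = √6/N`. Since `k² = 6κ`, the continuum part of `L φ` cancels and `|L φ| ≤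
25000/ρ⁵`, uniformly in `N` (`abs_stepOp_yukawa_le`). Moreover `∑ L φ = κ ∑ φ = (k²/6) ∑ φ`, a
Riemann sum tending to `4π/6 = 2π/3`.

Lift the hitting probability to `ℤ³`, periodically in the third coordinate, and sum by parts: `∑_{a
∈ A} e_A(a) G(a) = ∑ₓ L φ(x) · hitProb A (x)`, where `G(a)` is the sum of `φ` over the fibre of `a`.
The right side is always bounded. It is close to `2π/3` as soon as `A` contains a large ball,
because `hitProb A = 1` there and the tail of `∑ ρ⁻⁵` is small
(`exists_abs_equilibriumPotential_sub_le`).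

It remains to evaluate `G`. The nearest copy contributes about `1/R`. The other copies form a sum
along a line, comparable with `∫ e^{-k√(s²+ζ²)}/√(s²+ζ²) dζ = K₀(ks)` (substitute `ζ = s sinh r`).
So near the boundary of `A` one has `G ≈ 1/R + 2 K₀((R ∨ m)/N)/m`, with errors `O(1/m)` that are
negligible when `K₀` is large. Interior points of `A` carry only the mass `κ`, and their total
contribution is small when `R ≤ δN`. Dividing `2π/3` by `G` gives the sharp asymptotics. Part (i)
uses the same bounds with crude constants, and reaches the remaining ranges of `R` and `N` by
monotonicity, subadditivity and the trivial bound `cap ≥ κ`. -/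

noncomputable section

/-! ## The first-step equation for the escape probability -/

/-- The transition operator of the walk killed outside a set `B` of states. -/
def restrictedStep (N : ℝ) (m : ℕ) (B : Set (SlabState m)) (F : SlabState m → ENNReal) :
    SlabState m → ENNReal :=
  fun s => ∫⁻ s', B.indicator F s' ∂(jumpKernel N m s)

instance instIsProbabilityMeasureWalkLaw (N : ℝ) {m : ℕ} (x : Slab m) :
    IsProbabilityMeasure (walkLaw N x) := by
  unfold walkLaw; infer_instance

lemma lintegral_walkLaw_zero (N : ℝ) {m : ℕ} (x : Slab m) (F : SlabState m → ENNReal) :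
    ∫⁻ ω, F (ω 0) ∂(walkLaw N x) = F (.vertex x) := by
  have hF : Measurable F := measurable_from_top
  have hG : Measurable fun p : (Π _ : Finset.Iic 0, SlabState m) =>
      F (p ⟨0, Finset.mem_Iic.2 le_rfl⟩) :=
    hF.comp (measurable_pi_apply (⟨0, Finset.mem_Iic.2 le_rfl⟩ : Finset.Iic 0))
  have hm : (walkLaw N x).map (Preorder.frestrictLe (π := fun _ => SlabState m) 0) =
      (Measure.dirac (SlabState.vertex x)).map
        (MeasurableEquiv.piUnique (fun _ : Finset.Iic 0 => SlabState m)).symm := by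
    unfold walkLaw Kernel.trajMeasure
    rw [Measure.map_comp _ _ (by fun_prop), Kernel.traj_map_frestrictLe,
      Kernel.partialTraj_self, Measure.id_comp]
  have h1 : ∫⁻ ω, F (ω 0) ∂(walkLaw N x) =
      ∫⁻ p, F (p ⟨0, Finset.mem_Iic.2 le_rfl⟩) ∂((walkLaw N x).map
        (Preorder.frestrictLe (π := fun _ => SlabState m) 0)) := by
    rw [lintegral_map hG (by fun_prop)]
    rfl
  rw [h1, hm, lintegral_map hG (by fun_prop), lintegral_dirac' _ measurable_from_top]
  rfl

/-- Markov property at time `n`: given the path up to `n`, the next state has law `pathKernel`,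
which sees only the state at `n`. Integrating it out replaces `F` by `restrictedStep F` and removes
the constraint at time `n + 1`. -/
lemma lintegral_walkLaw_succ (N : ℝ) {m : ℕ} (x : Slab m) (B : Set (SlabState m)) (n : ℕ)
    (F : SlabState m → ENNReal) :
    ∫⁻ ω, {ω : ℕ → SlabState m | ∀ i, 1 ≤ i → i ≤ n + 1 → ω i ∈ B}.indicator
        (fun ω => F (ω (n + 1))) ω ∂(walkLaw N x) =
      ∫⁻ ω, {ω : ℕ → SlabState m | ∀ i, 1 ≤ i → i ≤ n → ω i ∈ B}.indicator
        (fun ω => restrictedStep N m B F (ω n)) ω ∂(walkLaw N x) := by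
  have hF : ∀ F : SlabState m → ENNReal, Measurable F := fun _ => measurable_from_top
  set P := (Π _ : Finset.Iic n, SlabState m)
  let S : Set P := {p | ∀ i : Finset.Iic n, 1 ≤ (i : ℕ) → p i ∈ B}
  have hS : MeasurableSet S := by
    have : S = ⋂ i : Finset.Iic n, {p : P | 1 ≤ (i : ℕ) → p i ∈ B} := by ext; simp [S]
    rw [this]
    refine MeasurableSet.iInter fun i => ?_
    by_cases hi : 1 ≤ (i : ℕ)
    · have : {p : P | 1 ≤ (i : ℕ) → p i ∈ B} = (fun p : P => p i) ⁻¹' B := by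
        ext; simp only [Set.mem_ofPred_eq, Set.mem_preimage, hi, true_imp_iff]
      rw [this]
      exact measurable_pi_apply i (MeasurableSpace.measurableSet_top)
    · have : {p : P | 1 ≤ (i : ℕ) → p i ∈ B} = Set.univ := by
        ext; simp only [Set.mem_ofPred_eq, hi, false_imp_iff, Set.mem_univ]
      rw [this]; exact MeasurableSet.univ
  have hcomp := Kernel.map_frestrictLe_trajMeasure_compProd_eq_map_trajMeasure
    (X := fun _ => SlabState m) (μ₀ := Measure.dirac (SlabState.vertex x))
    (κ := pathKernel N m) (a := n)
  -- The integrand factors into the constraint on the past and a function of the last state, so that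
  -- the inner integral of the composition product is `restrictedStep`.
  let Φ : P × SlabState m → ENNReal := fun r => S.indicator (fun _ => 1) r.1 * B.indicator F r.2
  have hΦ : Measurable Φ :=
    ((measurable_const.indicator hS).comp measurable_fst).mul
      ((hF (B.indicator F)).comp measurable_snd)
  have h1 := congrArg (fun μ => ∫⁻ r, Φ r ∂μ) hcomp
  rw [Measure.lintegral_compProd hΦ, lintegral_map hΦ (by fun_prop),
    lintegral_map (by exact hΦ.lintegral_kernel_prod_right') (by fun_prop)] at h1
  change ∫⁻ ω, _ ∂(walkLaw N x) = ∫⁻ ω, _ ∂(walkLaw N x) at h1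
  have hmem : ∀ ω : ℕ → SlabState m,
      (Preorder.frestrictLe (π := fun _ => SlabState m) n ω ∈ S ↔
        ∀ i, 1 ≤ i → i ≤ n → ω i ∈ B) := by
    intro ω
    constructor
    · intro h i h1 h2; exact h ⟨i, Finset.mem_Iic.2 h2⟩ h1
    · intro h i h1; exact h i h1 (Finset.mem_Iic.1 i.2)
  refine Eq.trans ?_ (h1.symm.trans ?_)
  · refine lintegral_congr fun ω => ?_
    simp only [Φ]
    by_cases ha : ∀ i, 1 ≤ i → i ≤ n → ω i ∈ B
    · by_cases hb : ω (n + 1) ∈ B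
      · rw [Set.indicator_of_mem, Set.indicator_of_mem ((hmem ω).2 ha), Set.indicator_of_mem hb,
          one_mul]
        intro i h1 h2
        rcases Nat.le_succ_iff.1 h2 with h2 | h2
        · exact ha i h1 h2
        · rw [h2]; exact hb
      · rw [Set.indicator_of_notMem, Set.indicator_of_notMem hb, mul_zero]
        intro h; exact hb (h (n + 1) (by omega) le_rfl)
    · rw [Set.indicator_of_notMem, Set.indicator_of_notMem (fun h => ha ((hmem ω).1 h)), zero_mul]
      intro h; exact ha fun i h1 h2 => h i h1 (by omega)
  · refine lintegral_congr fun ω => ?_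
    simp only [Φ]
    rw [lintegral_const_mul _ (hF _)]
    by_cases ha : ∀ i, 1 ≤ i → i ≤ n → ω i ∈ B
    · rw [Set.indicator_of_mem ((hmem ω).2 ha), Set.indicator_of_mem (by exact ha), one_mul]
      rfl
    · rw [Set.indicator_of_notMem (fun h => ha ((hmem ω).1 h)),
        Set.indicator_of_notMem (by exact ha), zero_mul]

lemma lintegral_walkLaw_iterate (N : ℝ) {m : ℕ} (x : Slab m) (B : Set (SlabState m)) (n : ℕ) :
    ∀ F : SlabState m → ENNReal,
    ∫⁻ ω, {ω : ℕ → SlabState m | ∀ i, 1 ≤ i → i ≤ n → ω i ∈ B}.indicator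
        (fun ω => F (ω n)) ω ∂(walkLaw N x) = (restrictedStep N m B)^[n] F (.vertex x) := by
  induction n with
  | zero =>
    intro F
    rw [Function.iterate_zero, id, ← lintegral_walkLaw_zero N x F]
    refine lintegral_congr fun ω => Set.indicator_of_mem ?_ _
    intro i h1 h2; omega
  | succ n ih =>
    intro F
    rw [lintegral_walkLaw_succ, ih, Function.iterate_succ_apply]

lemma measurableSet_forall_mem {m : ℕ} (B : Set (SlabState m)) (p : ℕ → Prop) :
    MeasurableSet {ω : ℕ → SlabState m | ∀ i, p i → ω i ∈ B} := by
  have : {ω : ℕ → SlabState m | ∀ i, p i → ω i ∈ B} =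
      ⋂ i, ⋂ (_ : p i), (fun ω : ℕ → SlabState m => ω i) ⁻¹' B := by ext; simp
  rw [this]
  exact MeasurableSet.iInter fun i => MeasurableSet.iInter fun _ =>
    measurable_pi_apply i MeasurableSpace.measurableSet_top

/-- The probability, started from `s`, of staying in `B` at times `1, …, n`. -/
def stayProb (N : ℝ) (m : ℕ) (B : Set (SlabState m)) (n : ℕ) : SlabState m → ENNReal :=
  (restrictedStep N m B)^[n] (fun _ => 1)

lemma walkLaw_forall_le_mem (N : ℝ) {m : ℕ} (x : Slab m) (B : Set (SlabState m)) (n : ℕ) :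
    walkLaw N x {ω | ∀ i, 1 ≤ i → i ≤ n → ω i ∈ B} = stayProb N m B n (.vertex x) := by
  have hm : MeasurableSet {ω : ℕ → SlabState m | ∀ i, 1 ≤ i → i ≤ n → ω i ∈ B} := by
    have := measurableSet_forall_mem B (fun i => 1 ≤ i ∧ i ≤ n)
    simpa only [and_imp] using this
  rw [stayProb, ← lintegral_walkLaw_iterate, lintegral_indicator hm, setLIntegral_one]

/-- Continuity of the measure along the decreasing events of staying in `B` up to time `n`. -/
lemma tendsto_stayProb (N : ℝ) {m : ℕ} (x : Slab m) (B : Set (SlabState m)) :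
    Filter.Tendsto (fun n => stayProb N m B n (.vertex x)) Filter.atTop
      (nhds (walkLaw N x {ω | ∀ i, 1 ≤ i → ω i ∈ B})) := by
  have h : {ω : ℕ → SlabState m | ∀ i, 1 ≤ i → ω i ∈ B} =
      ⋂ n : ℕ, {ω : ℕ → SlabState m | ∀ i, 1 ≤ i → i ≤ n → ω i ∈ B} := by
    ext ω
    simp only [Set.mem_ofPred_eq, Set.mem_iInter]
    exact ⟨fun h n i h1 _ => h i h1, fun h i h1 => h i i h1 le_rfl⟩
  rw [h]
  simp only [← walkLaw_forall_le_mem]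
  refine tendsto_measure_iInter_atTop (fun n => ?_) ?_ ⟨0, measure_ne_top _ _⟩
  · have := measurableSet_forall_mem B (fun i => 1 ≤ i ∧ i ≤ n)
    simp only [and_imp] at this
    exact this.nullMeasurableSet
  · intro a b hab ω h i h1 h2
    exact h i h1 (h2.trans hab)

/-- Summing over steps instead of target vertices counts coinciding steps with multiplicity, so the
heights 1 and 2 need no separate treatment from here on. -/
lemma edgeWeight_tsum_ofReal {m : ℕ} (x : Slab m) (c : ℝ) (hc : 0 ≤ c)
    (F : Slab m → ENNReal) :
    ∑' x', ENNReal.ofReal (edgeWeight x x' / c) * F x' =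
      ∑ i : Fin 6, ENNReal.ofReal (1 / 6 / c) * F (x + unitStep m i) := by
  have h : ∀ x', ENNReal.ofReal (edgeWeight x x' / c) * F x' =
      ∑ i : Fin 6, if x' = x + unitStep m i then ENNReal.ofReal (1 / 6 / c) * F x' else 0 := by
    intro x'
    have : edgeWeight x x' / c = ∑ i : Fin 6, if x' = x + unitStep m i then 1 / 6 / c else 0 := by
      rw [edgeWeight, Finset.card_filter]
      push_cast
      rw [Finset.mul_sum, Finset.sum_div]
      refine Finset.sum_congr rfl fun i _ => ?_
      by_cases hi : x' = x + unitStep m i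
      · simp [hi]
      · simp [hi, Ne.symm hi]
    rw [this, ENNReal.ofReal_sum_of_nonneg, Finset.sum_mul]
    · refine Finset.sum_congr rfl fun i _ => ?_
      split_ifs <;> simp
    · intro i _; split_ifs <;> positivity
  simp_rw [h]
  rw [Summable.tsum_finsetSum (fun _ _ => ENNReal.summable)]
  refine Finset.sum_congr rfl fun i _ => ?_
  rw [tsum_ite_eq]

lemma restrictedStep_vertex (N : ℝ) {m : ℕ} (B : Set (SlabState m)) (F : SlabState m → ENNReal)
    (x : Slab m) :
    restrictedStep N m B F (.vertex x) =
      (∑ i : Fin 6, ENNReal.ofReal (1 / 6 / (1 + killRate N)) *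
        B.indicator F (.vertex (x + unitStep m i))) +
      ENNReal.ofReal (killRate N / (1 + killRate N)) * B.indicator F .cemetery := by
  have hF : Measurable (B.indicator F) := measurable_from_top
  have hk := killRate_nonneg N
  change ∫⁻ s', B.indicator F s' ∂(jumpLaw N m (.vertex x)) = _
  simp only [jumpLaw]
  rw [lintegral_add_measure, lintegral_sum_measure, lintegral_smul_measure, lintegral_dirac]
  simp only [lintegral_smul_measure, lintegral_dirac, smul_eq_mul, totalWeight_eq]
  rw [edgeWeight_tsum_ofReal x _ (by positivity) (fun x' => B.indicator F (.vertex x'))]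

lemma restrictedStep_cemetery (N : ℝ) {m : ℕ} (B : Set (SlabState m))
    (F : SlabState m → ENNReal) :
    restrictedStep N m B F .cemetery = B.indicator F .cemetery := by
  change ∫⁻ s', B.indicator F s' ∂(jumpLaw N m .cemetery) = _
  rw [jumpLaw, lintegral_dirac]

/-- The states that are not in `A`. -/
def offStates {m : ℕ} (A : Set (Slab m)) : Set (SlabState m) := (SlabState.vertex '' A)ᶜ

lemma stayProb_cemetery (N : ℝ) {m : ℕ} (A : Set (Slab m)) (n : ℕ) :
    stayProb N m (offStates A) n .cemetery = 1 := by
  induction n with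
  | zero => rfl
  | succ n ih =>
    rw [stayProb, Function.iterate_succ_apply', restrictedStep_cemetery,
      Set.indicator_of_mem (by simp [offStates])]
    exact ih

/-- The probability that the walk started at `x` is never in `A` from its first jump on. -/
def escapeProb (N : ℝ) {m : ℕ} (A : Set (Slab m)) (x : Slab m) : ℝ :=
  (walkLaw N x).real {ω | ∀ n : ℕ, 1 ≤ n → ω n ∉ SlabState.vertex '' A}

lemma escapeProb_nonneg (N : ℝ) {m : ℕ} (A : Set (Slab m)) (x : Slab m) :
    0 ≤ escapeProb N A x := measureReal_nonneg

lemma escapeProb_le_one (N : ℝ) {m : ℕ} (A : Set (Slab m)) (x : Slab m) :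
    escapeProb N A x ≤ 1 := measureReal_le_one

/-- Limit of the one-step recursion for `stayProb`. The cemetery avoids `A` forever, which accounts
for the additive `killRate N`; a neighbour in `A` contributes nothing. -/
lemma escapeProb_firstStep (N : ℝ) {m : ℕ} (A : Set (Slab m)) (x : Slab m) :
    (1 + killRate N) * escapeProb N A x =
      killRate N + 1 / 6 * ∑ i : Fin 6, Aᶜ.indicator (escapeProb N A) (x + unitStep m i) := by
  have hk := killRate_nonneg N
  set Q : Slab m → ENNReal := fun x => walkLaw N x {ω | ∀ i, 1 ≤ i → ω i ∈ offStates A} with hQ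
  have hQr : ∀ x, escapeProb N A x = (Q x).toReal := fun x => rfl
  have hQt : ∀ x, Q x ≠ ⊤ := fun x => measure_ne_top _ _
  have hind : ∀ (G : SlabState m → ENNReal) (y : Slab m),
      (offStates A).indicator G (.vertex y) = Aᶜ.indicator (fun y => G (.vertex y)) y := by
    intro G y
    by_cases hy : y ∈ A <;> simp [offStates, hy, Set.indicator]
  have hcem : ∀ n, (offStates A).indicator (stayProb N m (offStates A) n) .cemetery = 1 := by
    intro n
    rw [Set.indicator_of_mem (by simp [offStates]), stayProb_cemetery]
  have hrec : ∀ n, stayProb N m (offStates A) (n + 1) (.vertex x) =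
      (∑ i : Fin 6, ENNReal.ofReal (1 / 6 / (1 + killRate N)) *
        Aᶜ.indicator (fun y => stayProb N m (offStates A) n (.vertex y)) (x + unitStep m i)) +
      ENNReal.ofReal (killRate N / (1 + killRate N)) := by
    intro n
    conv_lhs => rw [stayProb, Function.iterate_succ_apply']
    rw [restrictedStep_vertex]
    change (∑ i : Fin 6, ENNReal.ofReal (1 / 6 / (1 + killRate N)) *
        (offStates A).indicator (stayProb N m (offStates A) n) (.vertex (x + unitStep m i))) +
      ENNReal.ofReal (killRate N / (1 + killRate N)) *
        (offStates A).indicator (stayProb N m (offStates A) n) .cemetery = _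
    rw [hcem, mul_one]
    simp only [hind]
  have hlim : Filter.Tendsto (fun n => stayProb N m (offStates A) (n + 1) (.vertex x))
      Filter.atTop (nhds ((∑ i : Fin 6, ENNReal.ofReal (1 / 6 / (1 + killRate N)) *
        Aᶜ.indicator Q (x + unitStep m i)) + ENNReal.ofReal (killRate N / (1 + killRate N)))) := by
    simp only [hrec]
    refine Filter.Tendsto.add (tendsto_finsetSum _ fun i _ => ?_) tendsto_const_nhds
    refine ENNReal.Tendsto.const_mul ?_ (Or.inr ENNReal.ofReal_ne_top)
    by_cases hy : x + unitStep m i ∈ A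
    · simp [hy]
    · simp only [Set.indicator_of_mem (show x + unitStep m i ∈ Aᶜ from hy)]
      exact tendsto_stayProb N _ _
  have heq := tendsto_nhds_unique
    ((Filter.tendsto_add_atTop_iff_nat 1).2 (tendsto_stayProb N x (offStates A))) hlim
  have hindt : ∀ y, Aᶜ.indicator Q y ≠ ⊤ := by
    intro y; by_cases hy : y ∈ A <;> simp [hy, hQt]
  have hreal : escapeProb N A x =
      (∑ i : Fin 6, 1 / 6 / (1 + killRate N) *
        Aᶜ.indicator (escapeProb N A) (x + unitStep m i)) + killRate N / (1 + killRate N) := by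
    rw [hQr]
    change (walkLaw N x {ω | ∀ i, 1 ≤ i → ω i ∈ offStates A}).toReal = _
    rw [heq, ENNReal.toReal_add _ ENNReal.ofReal_ne_top, ENNReal.toReal_sum,
      ENNReal.toReal_ofReal (by positivity)]
    · congr 1
      refine Finset.sum_congr rfl fun i _ => ?_
      rw [ENNReal.toReal_mul, ENNReal.toReal_ofReal (by positivity)]
      congr 1
      by_cases hy : x + unitStep m i ∈ A
      · simp [hy]
      · simp [hy, hQr]
    · intro i _; exact ENNReal.mul_ne_top ENNReal.ofReal_ne_top (hindt _)
    · exact ENNReal.sum_ne_top.2 fun i _ => ENNReal.mul_ne_top ENNReal.ofReal_ne_top (hindt _)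
  rw [hreal, ← Finset.mul_sum]
  field_simp
  ring

end

noncomputable section

/-! ## Potential theory of the killed walk -/

/-- The operator `(1 + κ) v x - (1/6) ∑ᵢ v (x + sᵢ)` on functions on an abelian group. -/
def stepOp {G : Type*} [AddCommGroup G] (κ : ℝ) (st : Fin 6 → G) (v : G → ℝ) (x : G) : ℝ :=
  (1 + κ) * v x - 1 / 6 * ∑ i : Fin 6, v (x + st i)

/-! ### Summation by parts for translation-invariant operators. -/

section StepOp

variable {G : Type*} [AddCommGroup G] {κ : ℝ} {st : Fin 6 → G}

lemma summable_comp_add {g : G → ℝ} (hg : Summable g) (s : G) :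
    Summable fun x => g (x + s) :=
  (Equiv.summable_iff (Equiv.addRight s)).2 hg

lemma tsum_comp_add (g : G → ℝ) (s : G) : ∑' x, g (x + s) = ∑' x, g x :=
  Equiv.tsum_eq (Equiv.addRight s) g

lemma Summable.mul_of_abs_le {ι : Type*} {g v : ι → ℝ} (hg : Summable g) {M : ℝ}
    (hv : ∀ x, |v x| ≤ M) : Summable fun x => g x * v x := by
  refine Summable.of_norm_bounded (g := fun x => |g x| * M) (hg.abs.mul_right M) fun x => ?_
  rw [Real.norm_eq_abs, abs_mul]
  exact mul_le_mul_of_nonneg_left (hv x) (abs_nonneg _)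

lemma summable_stepOp {g : G → ℝ} (hg : Summable g) : Summable (stepOp κ st g) :=
  (hg.mul_left _).sub ((summable_sum fun i _ => summable_comp_add hg (st i)).mul_left _)

/-- Translations preserve the total sum, so the average over the six steps cancels one copy of `g`.
-/
lemma tsum_stepOp {g : G → ℝ} (hg : Summable g) : ∑' x, stepOp κ st g x = κ * ∑' x, g x := by
  have h1 : Summable fun x => ∑ i : Fin 6, g (x + st i) :=
    summable_sum fun i _ => summable_comp_add hg (st i)
  unfold stepOp
  rw [(hg.mul_left _).tsum_sub (h1.mul_left _), tsum_mul_left, tsum_mul_left,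
    Summable.tsum_finsetSum fun i _ => summable_comp_add hg (st i)]
  simp only [tsum_comp_add, Finset.sum_const, Finset.card_univ, Fintype.card_fin, nsmul_eq_mul]
  push_cast
  ring

/-- The operator is symmetric because the step set is stable under negation. Only boundedness is
asked of `v`: it will be the lift of a hitting probability, which is periodic and hence not summable
on `ℤ³`. -/
lemma tsum_mul_stepOp (hst : ∀ F : G → ℝ, ∑ i, F (-st i) = ∑ i, F (st i)) {g v : G → ℝ}
    (hg : Summable g) {M : ℝ} (hv : ∀ x, |v x| ≤ M) :
    ∑' x, g x * stepOp κ st v x = ∑' x, stepOp κ st g x * v x := by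
  have hs1 : Summable fun x => g x * v x := hg.mul_of_abs_le hv
  have hs2 : ∀ s, Summable fun x => g x * v (x + s) :=
    fun s => hg.mul_of_abs_le fun x => hv (x + s)
  have hs3 : ∀ s, Summable fun x => g (x + s) * v x :=
    fun s => (summable_comp_add hg s).mul_of_abs_le hv
  have h1 : ∀ x, g x * stepOp κ st v x =
      (1 + κ) * (g x * v x) - 1 / 6 * ∑ i, g x * v (x + st i) := by
    intro x; rw [stepOp, ← Finset.mul_sum]; ring
  have h2 : ∀ x, stepOp κ st g x * v x =
      (1 + κ) * (g x * v x) - 1 / 6 * ∑ i, g (x + st i) * v x := by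
    intro x; rw [stepOp, ← Finset.sum_mul]; ring
  simp only [h1, h2]
  rw [(hs1.mul_left _).tsum_sub ((summable_sum fun i _ => hs2 _).mul_left _),
    (hs1.mul_left _).tsum_sub ((summable_sum fun i _ => hs3 _).mul_left _),
    tsum_mul_left (a := (1 / 6 : ℝ)), tsum_mul_left (a := (1 / 6 : ℝ)),
    Summable.tsum_finsetSum fun i _ => hs2 _, Summable.tsum_finsetSum fun i _ => hs3 _,
    ← hst fun s => ∑' x, g (x + s) * v x]
  congr 2
  refine Finset.sum_congr rfl fun i _ => ?_
  rw [← tsum_comp_add (fun x => g (x + -st i) * v x) (st i)]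
  simp

end StepOp

/-! ### Hitting probabilities, maximum principle and elementary properties of the capacity. -/

section Slab

variable {m : ℕ} {N : ℝ}

/-- The probability of ever visiting `A`. -/
def hitProb (N : ℝ) (A : Set (Slab m)) (x : Slab m) : ℝ := 1 - Aᶜ.indicator (escapeProb N A) x

lemma hitProb_of_mem {A : Set (Slab m)} {x : Slab m} (hx : x ∈ A) : hitProb N A x = 1 := by
  simp [hitProb, hx]

lemma hitProb_nonneg (A : Set (Slab m)) (x : Slab m) : 0 ≤ hitProb N A x := by
  unfold hitProb Set.indicator
  have := escapeProb_le_one N A x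
  split_ifs <;> linarith

lemma hitProb_le_one (A : Set (Slab m)) (x : Slab m) : hitProb N A x ≤ 1 := by
  unfold hitProb Set.indicator
  have := escapeProb_nonneg N A x
  split_ifs <;> linarith

lemma abs_hitProb_le_one (A : Set (Slab m)) (x : Slab m) : |hitProb N A x| ≤ 1 :=
  abs_le.2 ⟨by linarith [hitProb_nonneg (N := N) A x], hitProb_le_one A x⟩

lemma equilibriumMeasure_of_notMem {A : Set (Slab m)} {x : Slab m} (hx : x ∉ A) :
    equilibriumMeasure N A x = 0 := by
  simp [equilibriumMeasure, hx]

lemma equilibriumMeasure_nonneg (A : Set (Slab m)) (x : Slab m) :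
    0 ≤ equilibriumMeasure N A x := by
  have := killRate_nonneg N
  refine Set.indicator_nonneg (fun x _ => mul_nonneg ?_ measureReal_nonneg) x
  rw [totalWeight_eq]; positivity

/-- The first-step equation rewritten for `1 - escape`: constants contribute `κ`, which cancels the
killing term. Off `A` the two escape terms cancel as well; on `A` the weighted escape probability
survives. -/
lemma stepOp_hitProb (A : Set (Slab m)) (x : Slab m) :
    stepOp (killRate N) (unitStep m) (hitProb N A) x = equilibriumMeasure N A x := by
  have h := escapeProb_firstStep N A x
  have h1 : stepOp (killRate N) (unitStep m) (hitProb N A) x =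
      (1 + killRate N) * (escapeProb N A x - Aᶜ.indicator (escapeProb N A) x) := by
    simp only [stepOp, hitProb, Finset.sum_sub_distrib, Finset.sum_const, Finset.card_univ,
      Fintype.card_fin, nsmul_eq_mul]
    push_cast
    linarith
  rw [h1]
  by_cases hx : x ∈ A
  · simp [equilibriumMeasure, hx, totalWeight_eq, escapeProb]
  · simp [equilibriumMeasure, hx]

/-- From a point all of whose neighbours lie in `A`, the only way to avoid `A` is to be killed at
the first jump. -/
lemma equilibriumMeasure_interior {A : Set (Slab m)} {x : Slab m} (hx : x ∈ A)
    (hn : ∀ i, x + unitStep m i ∈ A) : equilibriumMeasure N A x = killRate N := by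
  rw [← stepOp_hitProb, stepOp, hitProb_of_mem hx,
    Finset.sum_congr rfl fun i _ => hitProb_of_mem (hn i)]
  simp

lemma killRate_le_equilibriumMeasure {A : Set (Slab m)} {x : Slab m} (hx : x ∈ A) :
    killRate N ≤ equilibriumMeasure N A x := by
  rw [← stepOp_hitProb, stepOp, hitProb_of_mem hx]
  have : ∑ i : Fin 6, hitProb N A (x + unitStep m i) ≤ ∑ i : Fin 6, (1 : ℝ) :=
    Finset.sum_le_sum fun i _ => hitProb_le_one A _
  simp at this
  linarith

lemma killRate_pos (hN : 1 ≤ N) : 0 < killRate N := by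
  unfold killRate; positivity

/-- Maximum principle. The supremum `M` need not be attained, but killing makes the operator
contract: where `u > 0` it is at most `M / (1 + κ)`, so a positive `M` would satisfy `M ≤ M / (1 +
κ)`. -/
lemma nonpos_of_stepOp_nonpos (hN : 1 ≤ N) {u : Slab m → ℝ} (hb : BddAbove (Set.range u))
    (hu : ∀ x, 0 < u x → stepOp (killRate N) (unitStep m) u x ≤ 0) (x : Slab m) : u x ≤ 0 := by
  have hk := killRate_pos hN
  set M := ⨆ x, u x with hM
  have hle : ∀ x, u x ≤ M := fun x => le_ciSup hb x
  suffices h : M ≤ 0 from (hle x).trans h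
  by_contra hpos
  push Not at hpos
  have hb1 : ∀ x, u x ≤ M / (1 + killRate N) := by
    intro x
    rcases le_or_gt (u x) 0 with h0 | h0
    · exact h0.trans (by positivity)
    · have h1 := hu x h0
      have h2 : ∑ i : Fin 6, u (x + unitStep m i) ≤ ∑ i : Fin 6, M :=
        Finset.sum_le_sum fun i _ => hle _
      simp only [Finset.sum_const, Finset.card_univ, Fintype.card_fin, nsmul_eq_mul] at h2
      unfold stepOp at h1
      rw [le_div_iff₀ (by positivity)]
      push_cast at h2
      linarith
  have h3 : M ≤ M / (1 + killRate N) := ciSup_le hb1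
  rw [le_div_iff₀ (by positivity)] at h3
  nlinarith

/-- The difference `hitProb - s` can be positive only off `A`, where `hitProb` is a solution and the
maximum principle applies. -/
lemma hitProb_le_of_supersolution (hN : 1 ≤ N) {A : Set (Slab m)} {s : Slab m → ℝ}
    (h0 : ∀ x, 0 ≤ s x) (hs : ∀ x, x ∉ A → 0 ≤ stepOp (killRate N) (unitStep m) s x)
    (hA : ∀ x ∈ A, 1 ≤ s x) (x : Slab m) : hitProb N A x ≤ s x := by
  have := nonpos_of_stepOp_nonpos hN (u := fun x => hitProb N A x - s x)
    ⟨1, by rintro _ ⟨x, rfl⟩; linarith [h0 x, hitProb_le_one (N := N) A x]⟩ (fun x hx => ?_) x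
  · linarith
  · have hxA : x ∉ A := fun h => by linarith [hA x h, hitProb_le_one (N := N) A x]
    have h1 := stepOp_hitProb (N := N) A x
    rw [equilibriumMeasure_of_notMem hxA] at h1
    have h2 := hs x hxA
    simp only [stepOp, Finset.sum_sub_distrib] at h1 h2 ⊢
    linarith

lemma summable_pow_natAbs {θ : ℝ} (h0 : 0 ≤ θ) (h1 : θ < 1) :
    Summable fun n : ℤ => θ ^ n.natAbs := by
  have := summable_geometric_of_lt_one h0 h1
  exact Summable.of_nat_of_neg (by simpa using this) (by simpa using this)

lemma summable_hitProb [NeZero m] (hN : 1 ≤ N) {A : Set (Slab m)} (hA : A.Finite) :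
    Summable (hitProb N A) := by
  have hk := killRate_pos hN
  -- Barrier `w = θ^(|y₁| + |y₂|)`: a step changes the exponent by at most 1, so `w` grows by at
  -- most the factor `1 + κ`, and every nonnegative multiple of `w` is a supersolution. It decays
  -- exponentially, and the vertical coordinate takes finitely many values.
  set θ : ℝ := (1 + killRate N)⁻¹ with hθ
  have hθ0 : 0 < θ := by positivity
  have hθ1 : θ < 1 := inv_lt_one_of_one_lt₀ (by linarith)
  let w : Slab m → ℝ := fun x => θ ^ x.1.1.natAbs * θ ^ x.1.2.natAbs
  have hw0 : ∀ x, 0 < w x := fun x => by positivity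
  obtain ⟨C, hC0, hC⟩ : ∃ C : ℝ, 0 ≤ C ∧ ∀ x ∈ A, 1 ≤ C * w x := by
    obtain ⟨C, hC⟩ := (hA.image fun x => (w x)⁻¹).bddAbove
    refine ⟨max C 0, le_max_right _ _, fun x hx => ?_⟩
    have h1 : (w x)⁻¹ ≤ max C 0 := (hC ⟨x, hx, rfl⟩).trans (le_max_left _ _)
    calc 1 = (w x)⁻¹ * w x := (inv_mul_cancel₀ (hw0 x).ne').symm
      _ ≤ _ := mul_le_mul_of_nonneg_right h1 (hw0 x).le
  have hstep : ∀ x i, w (x + unitStep m i) ≤ (1 + killRate N) * w x := by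
    have key : ∀ a b : ℕ, b ≤ a + 1 → θ ^ a ≤ (1 + killRate N) * θ ^ b := by
      intro a b hab
      have h1 : θ ^ (a + 1) ≤ θ ^ b := pow_le_pow_of_le_one hθ0.le hθ1.le hab
      calc θ ^ a = (1 + killRate N) * θ ^ (a + 1) := by
            rw [pow_succ, hθ]; field_simp
        _ ≤ _ := by gcongr
    intro x i
    simp only [w, ← pow_add]
    apply key
    fin_cases i <;> simp [unitStep] <;> omega
  have hsup : ∀ x, hitProb N A x ≤ C * w x := by
    refine hitProb_le_of_supersolution hN (fun x => mul_nonneg hC0 (hw0 x).le) (fun x _ => ?_) hC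
    have : ∑ i : Fin 6, C * w (x + unitStep m i) ≤
        ∑ i : Fin 6, C * ((1 + killRate N) * w x) :=
      Finset.sum_le_sum fun i _ => mul_le_mul_of_nonneg_left (hstep x i) hC0
    simp only [Finset.sum_const, Finset.card_univ, Fintype.card_fin, nsmul_eq_mul] at this
    unfold stepOp
    push_cast at this
    linarith
  have hsum : Summable w := by
    have h1 := summable_pow_natAbs hθ0.le hθ1
    have h2 : Summable fun p : ℤ × ℤ => θ ^ p.1.natAbs * θ ^ p.2.natAbs :=
      h1.mul_of_nonneg h1 (fun _ => by positivity) (fun _ => by positivity)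
    have h3 : Summable fun _ : ZMod m => (1 : ℝ) := (hasSum_fintype _).summable
    have := h2.mul_of_nonneg h3 (fun _ => by positivity) (fun _ => by positivity)
    simpa using this
  exact Summable.of_nonneg_of_le (hitProb_nonneg A) hsup (hsum.mul_left C)

/-- Sum `stepOp_hitProb` over the slab. Comparisons of capacities thereby reduce to pointwise
comparisons of hitting probabilities. -/
lemma slabCap_eq_killRate_mul [NeZero m] (hN : 1 ≤ N) {A : Set (Slab m)} (hA : A.Finite) :
    slabCap N A = killRate N * ∑' x, hitProb N A x := by
  rw [← tsum_stepOp (summable_hitProb hN hA) (st := unitStep m)]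
  exact tsum_congr fun x => (stepOp_hitProb A x).symm

lemma slabCap_eq_sum {A : Finset (Slab m)} :
    slabCap N (A : Set (Slab m)) = ∑ x ∈ A, equilibriumMeasure N (A : Set (Slab m)) x :=
  tsum_eq_sum fun _ hx => equilibriumMeasure_of_notMem (by simpa using hx)

lemma killRate_le_slabCap {A : Set (Slab m)} (hA : A.Finite) {x : Slab m} (hx : x ∈ A) :
    killRate N ≤ slabCap N A := by
  lift A to Finset (Slab m) using hA
  rw [slabCap_eq_sum]
  exact (killRate_le_equilibriumMeasure hx).trans
    (Finset.single_le_sum (fun y _ => equilibriumMeasure_nonneg _ y) (by simpa using hx))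

lemma slabCap_nonneg (A : Set (Slab m)) : 0 ≤ slabCap N A :=
  tsum_nonneg (equilibriumMeasure_nonneg A)

lemma slabCap_mono [NeZero m] (hN : 1 ≤ N) {A B : Set (Slab m)} (hB : B.Finite) (h : A ⊆ B) :
    slabCap N A ≤ slabCap N B := by
  have hA := hB.subset h
  rw [slabCap_eq_killRate_mul hN hA, slabCap_eq_killRate_mul hN hB]
  refine mul_le_mul_of_nonneg_left ?_ (killRate_nonneg N)
  refine Summable.tsum_le_tsum ?_ (summable_hitProb hN hA) (summable_hitProb hN hB)
  refine hitProb_le_of_supersolution hN (hitProb_nonneg B) (fun x _ => ?_)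
    fun x hx => (hitProb_of_mem (h hx)).ge
  rw [stepOp_hitProb]
  exact equilibriumMeasure_nonneg B x

/-- Union bound with translation invariance: the translates of `hitProb N {0}` to the points of `A`
sum to a supersolution that is at least 1 on `A`. It is used for balls of bounded radius. -/
lemma slabCap_le_card_mul [NeZero m] (hN : 1 ≤ N) {A : Finset (Slab m)} :
    slabCap N (A : Set (Slab m)) ≤ (A.card : ℝ) * slabCap N ({0} : Set (Slab m)) := by
  have hs := summable_hitProb hN (Set.finite_singleton (0 : Slab m))
  have hsa : ∀ a : Slab m, Summable fun x => hitProb N {0} (x - a) := by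
    intro a; simpa only [sub_eq_add_neg] using summable_comp_add hs (-a)
  have hta : ∀ a : Slab m, ∑' x : Slab m, hitProb N {0} (x - a) = ∑' x : Slab m, hitProb N {0} x := by
    intro a; simpa only [sub_eq_add_neg] using tsum_comp_add (hitProb N {0}) (-a)
  rw [slabCap_eq_killRate_mul hN A.finite_toSet,
    slabCap_eq_killRate_mul hN (Set.finite_singleton _), mul_left_comm]
  refine mul_le_mul_of_nonneg_left ?_ (killRate_nonneg N)
  have h1 : (A.card : ℝ) * ∑' x : Slab m, hitProb N {0} x =
      ∑' x : Slab m, ∑ a ∈ A, hitProb N {0} (x - a) := by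
    rw [Summable.tsum_finsetSum fun a _ => hsa a]
    simp only [hta, Finset.sum_const, nsmul_eq_mul]
  rw [h1]
  refine Summable.tsum_le_tsum ?_ (summable_hitProb hN A.finite_toSet)
    (summable_sum fun a _ => hsa a)
  refine hitProb_le_of_supersolution hN
    (fun x => Finset.sum_nonneg fun a _ => hitProb_nonneg _ _) (fun x _ => ?_) (fun x hx => ?_)
  · have h2 : stepOp (killRate N) (unitStep m) (fun x => ∑ a ∈ A, hitProb N {0} (x - a)) x =
        ∑ a ∈ A, equilibriumMeasure N {0} (x - a) := by
      simp only [← stepOp_hitProb, stepOp, Finset.sum_sub_distrib, Finset.mul_sum]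
      rw [Finset.sum_comm]
      simp only [sub_add_eq_add_sub]
    rw [h2]
    exact Finset.sum_nonneg fun a _ => equilibriumMeasure_nonneg _ _
  · have : hitProb N {0} (x - x) = 1 := hitProb_of_mem (by simp)
    rw [← this]
    exact Finset.single_le_sum (f := fun a => hitProb N {0} (x - a))
      (fun a _ => hitProb_nonneg _ _) (by simpa using hx)

end Slab

/-! ## Lifting to `ℤ³` -/

/-- The six unit steps of `ℤ³`. -/
def cubicStep : Fin 6 → (ℤ × ℤ) × ℤ :=
  ![((1, 0), 0), ((-1, 0), 0), ((0, 1), 0), ((0, -1), 0), ((0, 0), 1), ((0, 0), -1)]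

lemma sum_cubicStep_neg (F : (ℤ × ℤ) × ℤ → ℝ) : ∑ i, F (-cubicStep i) = ∑ i, F (cubicStep i) := by
  simp only [Fin.sum_univ_six, cubicStep, Matrix.cons_val, Prod.neg_mk, neg_zero, neg_neg]
  ring

/-- The covering map from `ℤ³` to the slab. -/
def slabProj (m : ℕ) (x : (ℤ × ℤ) × ℤ) : Slab m := (x.1, (x.2 : ZMod m))

lemma slabProj_add_cubicStep (m : ℕ) (x : (ℤ × ℤ) × ℤ) (i : Fin 6) :
    slabProj m (x + cubicStep i) = slabProj m x + unitStep m i := by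
  fin_cases i <;> simp [slabProj, cubicStep, unitStep]

lemma stepOp_comp_slabProj (κ : ℝ) (m : ℕ) (v : Slab m → ℝ) (x : (ℤ × ℤ) × ℤ) :
    stepOp κ cubicStep (fun x => v (slabProj m x)) x = stepOp κ (unitStep m) v (slabProj m x) := by
  simp only [stepOp, slabProj_add_cubicStep]

/-- The sum of `φ` over the fibre of the covering map. -/
def fibreSum (m : ℕ) (φ : (ℤ × ℤ) × ℤ → ℝ) (a : Slab m) : ℝ :=
  ∑' j : ℤ, φ (a.1, vertRep a + m * j)

lemma slabProj_eq_iff {m : ℕ} [NeZero m] (a : Slab m) (x : (ℤ × ℤ) × ℤ) :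
    slabProj m x = a ↔ ∃ j : ℤ, (a.1, vertRep a + m * j) = x := by
  obtain ⟨y, z⟩ := a
  obtain ⟨p, q⟩ := x
  simp only [slabProj, vertRep, Prod.mk.injEq]
  constructor
  · rintro ⟨rfl, rfl⟩
    have : (((q : ZMod m).valMinAbs : ℤ) : ZMod m) = (q : ZMod m) := ZMod.coe_valMinAbs _
    rw [ZMod.intCast_eq_intCast_iff_dvd_sub] at this
    obtain ⟨j, hj⟩ := this
    exact ⟨j, rfl, by linarith⟩
  · rintro ⟨j, rfl, rfl⟩
    simp

lemma tsum_mul_comp_slabProj {m : ℕ} [NeZero m] {φ : (ℤ × ℤ) × ℤ → ℝ} (hφ : Summable φ)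
    (A : Finset (Slab m)) {e : Slab m → ℝ} (he : ∀ a ∉ A, e a = 0) :
    ∑' x, φ x * e (slabProj m x) = ∑ a ∈ A, e a * fibreSum m φ a := by
  classical
  have hinj : ∀ a : Slab m, Function.Injective fun j : ℤ => (a.1, vertRep a + m * j) := by
    intro a i j hij
    simpa [NeZero.ne m] using hij
  have h1 : ∀ x, φ x * e (slabProj m x) =
      ∑ a ∈ A, e a * {x | slabProj m x = a}.indicator φ x := by
    intro x
    by_cases hx : slabProj m x ∈ A
    · rw [Finset.sum_eq_single_of_mem _ hx]
      · simp [mul_comm]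
      · intro b _ hb
        simp [Set.indicator, Ne.symm hb]
    · rw [he _ hx, mul_zero, Finset.sum_eq_zero]
      intro a ha
      have : slabProj m x ≠ a := fun h => hx (h ▸ ha)
      simp [Set.indicator, this]
  simp only [h1]
  rw [Summable.tsum_finsetSum fun a _ => (hφ.indicator _).mul_left _]
  refine Finset.sum_congr rfl fun a _ => ?_
  rw [tsum_mul_left]
  congr 1
  rw [fibreSum, ← (hinj a).tsum_eq (f := {x | slabProj m x = a}.indicator φ)]
  · refine tsum_congr fun j => ?_
    rw [Set.indicator_of_mem]
    exact (slabProj_eq_iff a _).2 ⟨j, rfl⟩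
  · intro x hx
    have : slabProj m x = a := by
      by_contra h
      exact hx (by simp [Set.indicator, h])
    exact (slabProj_eq_iff a x).1 this

/-- The pairing of a summable function on `ℤ³` with the equilibrium measure. -/
lemma sum_equilibriumMeasure_mul_fibreSum {m : ℕ} [NeZero m] (N : ℝ) {φ : (ℤ × ℤ) × ℤ → ℝ}
    (hφ : Summable φ) (A : Finset (Slab m)) :
    ∑ a ∈ A, equilibriumMeasure N (A : Set (Slab m)) a * fibreSum m φ a =
      ∑' x, stepOp (killRate N) cubicStep φ x * hitProb N (A : Set (Slab m)) (slabProj m x) := by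
  rw [← tsum_mul_comp_slabProj hφ A fun a ha => equilibriumMeasure_of_notMem (by simpa using ha),
    ← tsum_mul_stepOp sum_cubicStep_neg hφ (M := 1)
      (v := fun x => hitProb N (A : Set (Slab m)) (slabProj m x)) fun x => abs_hitProb_le_one _ _]
  refine tsum_congr fun x => ?_
  rw [stepOp_comp_slabProj, stepOp_hitProb]

end

noncomputable section

/-! ## The screened Coulomb potential on `ℤ³` -/

/-- The regularized distance `√(|x|² + 1)` to the origin. -/
def regNorm (x : (ℤ × ℤ) × ℤ) : ℝ :=
  √((x.1.1 : ℝ) ^ 2 + (x.1.2 : ℝ) ^ 2 + (x.2 : ℝ) ^ 2 + 1)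

/-- The screened Coulomb potential `e^{-kρ} / ρ`, as a function of the distance. -/
def screened (k ρ : ℝ) : ℝ := Real.exp (-(k * ρ)) / ρ

/-- The screened Coulomb potential on `ℤ³`, regularized at the origin. -/
def yukawa (k : ℝ) (x : (ℤ × ℤ) × ℤ) : ℝ := screened k (regNorm x)

/-- The first reverse Bessel polynomials. -/
def revBessel : ℕ → ℝ → ℝ
  | 0, _ => 1
  | 1, t => 1 + t
  | 2, t => 3 + 3 * t + t ^ 2
  | 3, t => 15 + 15 * t + 6 * t ^ 2 + t ^ 3
  | _, t => 105 + 105 * t + 45 * t ^ 2 + 10 * t ^ 3 + t ^ 4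

/-- The functions `(-ρ⁻¹ d/dρ)ⁿ (e^{-kρ} / ρ)` for `n ≤ 4`. -/
def screenedDeriv (k : ℝ) (n : ℕ) (ρ : ℝ) : ℝ :=
  revBessel n (k * ρ) * Real.exp (-(k * ρ)) / ρ ^ (2 * n + 1)

/-- Amounts to the recursion `p_{n+1}(t) = (2n + 1 + t) p_n(t) - t p_n'(t)` of the reverse Bessel
polynomials; `main` is applied with `j = 2n`. -/
lemma hasDerivAt_screenedDeriv (k : ℝ) {n : ℕ} (hn : n < 4) {ρ : ℝ} (hρ : 0 < ρ) :
    HasDerivAt (screenedDeriv k n) (-(ρ * screenedDeriv k (n + 1) ρ)) ρ := by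
  have hlin : HasDerivAt (fun ρ : ℝ => k * ρ) k ρ := by
    simpa using (hasDerivAt_id ρ).const_mul k
  have hexp : HasDerivAt (fun ρ : ℝ => Real.exp (-(k * ρ))) (Real.exp (-(k * ρ)) * -k) ρ :=
    hlin.neg.exp
  have main : ∀ (p p' : ℝ → ℝ), (∀ t, HasDerivAt p (p' t) t) → ∀ j : ℕ,
      HasDerivAt (fun ρ => p (k * ρ) * Real.exp (-(k * ρ)) / ρ ^ (j + 1))
        (Real.exp (-(k * ρ)) * (k * ρ * (p' (k * ρ) - p (k * ρ)) - (j + 1) * p (k * ρ)) /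
          ρ ^ (j + 2)) ρ := by
    intro p p' hp j
    have h1 : HasDerivAt (fun ρ => p (k * ρ)) (p' (k * ρ) * k) ρ := (hp _).comp ρ hlin
    convert! (h1.mul hexp).div (hasDerivAt_pow (j + 1) ρ) (by positivity) using 1
    rw [show ((fun ρ => p (k * ρ)) * fun ρ => Real.exp (-(k * ρ))) ρ =
      p (k * ρ) * Real.exp (-(k * ρ)) from rfl]
    field_simp
    push_cast
    ring
  have hp1 : ∀ t : ℝ, HasDerivAt (revBessel 1) 1 t := fun t => (hasDerivAt_id t).const_add 1
  have hp2 : ∀ t : ℝ, HasDerivAt (revBessel 2) (3 + 2 * t) t := by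
    intro t
    convert! (((hasDerivAt_id t).const_mul 3).const_add 3).add (hasDerivAt_pow 2 t) using 1
    norm_num
  have hp3 : ∀ t : ℝ, HasDerivAt (revBessel 3) (15 + 12 * t + 3 * t ^ 2) t := by
    intro t
    convert! ((((hasDerivAt_id t).const_mul 15).const_add 15).add
      ((hasDerivAt_pow 2 t).const_mul 6)).add (hasDerivAt_pow 3 t) using 1
    norm_num
    ring
  interval_cases n
  · convert! main (revBessel 0) (fun _ => 0) (fun t => hasDerivAt_const t 1) 0 using 1
    simp only [screenedDeriv, revBessel]
    field_simp
    push_cast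
    ring
  · convert! main (revBessel 1) _ hp1 2 using 1
    simp only [screenedDeriv, revBessel]
    field_simp
    push_cast
    ring
  · convert! main (revBessel 2) _ hp2 4 using 1
    simp only [screenedDeriv, revBessel]
    field_simp
    push_cast
    ring
  · convert! main (revBessel 3) _ hp3 6 using 1
    simp only [screenedDeriv, revBessel]
    field_simp
    push_cast
    ring

lemma pow_mul_exp_neg_le (n : ℕ) {t : ℝ} (ht : 0 ≤ t) :
    t ^ n * Real.exp (-t) ≤ n.factorial := by
  have h := Real.pow_div_factorial_le_exp t ht n
  rw [div_le_iff₀ (by positivity)] at h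
  rw [Real.exp_neg, ← div_eq_mul_inv, div_le_iff₀ (Real.exp_pos t)]
  linarith

/-- Bounds uniform in `k`, from `t^n e^{-t} ≤ n!` termwise: `8 = 3 + 3 + 2`, `48 = 15 + 15 + 6·2 +
6`, `384 = 105 + 105 + 45·2 + 10·6 + 24`. -/
lemma abs_screenedDeriv_le {k ρ : ℝ} (hk : 0 ≤ k) (hρ : 0 < ρ) :
    |screenedDeriv k 2 ρ| ≤ 8 / ρ ^ 5 ∧ |screenedDeriv k 3 ρ| ≤ 48 / ρ ^ 7 ∧
      |screenedDeriv k 4 ρ| ≤ 384 / ρ ^ 9 := by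
  have ht : 0 ≤ k * ρ := by positivity
  have e0 : Real.exp (-(k * ρ)) ≤ 1 := Real.exp_le_one_iff.2 (by linarith)
  have e1 := pow_mul_exp_neg_le 1 ht
  have e2 := pow_mul_exp_neg_le 2 ht
  have e3 := pow_mul_exp_neg_le 3 ht
  have e4 := pow_mul_exp_neg_le 4 ht
  norm_num [Nat.factorial] at e1 e2 e3 e4
  have hb : ∀ n : ℕ, 0 ≤ revBessel n (k * ρ) := by
    intro n; unfold revBessel; split <;> positivity
  have habs : ∀ n : ℕ, |screenedDeriv k n ρ| = screenedDeriv k n ρ := fun n =>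
    abs_of_nonneg (div_nonneg (mul_nonneg (hb n) (Real.exp_pos _).le) (by positivity))
  rw [habs, habs, habs]
  refine ⟨?_, ?_, ?_⟩ <;> simp only [screenedDeriv, revBessel] <;>
    refine div_le_div_of_nonneg_right ?_ (by positivity) <;> nlinarith

lemma abs_le_of_abs_hasDerivAt_le {f f' : ℝ → ℝ} {M : ℝ} (h0 : f 0 = 0)
    (hf : ∀ t ∈ Set.Icc (0 : ℝ) 1, HasDerivAt f (f' t) t)
    (hM : ∀ t ∈ Set.Icc (0 : ℝ) 1, |f' t| ≤ M) : ∀ t ∈ Set.Icc (0 : ℝ) 1, |f t| ≤ M := by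
  intro t ht
  have h := (convex_Icc (0 : ℝ) 1).norm_image_sub_le_of_norm_hasDerivWithin_le
    (fun x hx => (hf x hx).hasDerivWithinAt) hM (Set.left_mem_Icc.2 zero_le_one) ht
  rw [h0, sub_zero, sub_zero] at h
  have hM0 : 0 ≤ M := (abs_nonneg _).trans (hM t ht)
  refine h.trans ?_
  rw [Real.norm_of_nonneg ht.1]
  exact mul_le_of_le_one_right hM0 ht.2

/-- Symmetric Taylor formula. The function `t ↦ θ(s+t) + θ(s-t) - 2θ(s) - θ₂(s)t²` vanishes at 0
together with its first three derivatives; the bound `2M` on the fourth is carried down by four mean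
value estimates on `[0, 1]`, without tracking the factor `1/4!`. -/
lemma abs_secondDifference_sub_le {θ θ₁ θ₂ θ₃ θ₄ : ℝ → ℝ} (h1 : ∀ t, HasDerivAt θ (θ₁ t) t)
    (h2 : ∀ t, HasDerivAt θ₁ (θ₂ t) t) (h3 : ∀ t, HasDerivAt θ₂ (θ₃ t) t)
    (h4 : ∀ t, HasDerivAt θ₃ (θ₄ t) t) {s M : ℝ} (hM : ∀ u, |u - s| ≤ 1 → |θ₄ u| ≤ M) :
    |θ (s + 1) + θ (s - 1) - 2 * θ s - θ₂ s| ≤ 2 * M := by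
  have hp : ∀ {f f' : ℝ → ℝ}, (∀ t, HasDerivAt f (f' t) t) → ∀ t,
      HasDerivAt (fun t => f (s + t)) (f' (s + t)) t := by
    intro f f' hf t
    convert! (hf (s + t)).comp t ((hasDerivAt_id t).const_add s) using 1
    ring
  have hm : ∀ {f f' : ℝ → ℝ}, (∀ t, HasDerivAt f (f' t) t) → ∀ t,
      HasDerivAt (fun t => f (s - t)) (-f' (s - t)) t := by
    intro f f' hf t
    convert! (hf (s - t)).comp t ((hasDerivAt_id t).const_sub s) using 1
    ring
  have b4 : ∀ t ∈ Set.Icc (0 : ℝ) 1, |θ₄ (s + t) + θ₄ (s - t)| ≤ 2 * M := by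
    intro t ht
    have e1 := hM (s + t) (by rw [add_sub_cancel_left, abs_of_nonneg ht.1]; exact ht.2)
    have e2 := hM (s - t) (by rw [sub_sub_cancel_left, abs_neg, abs_of_nonneg ht.1]; exact ht.2)
    exact (abs_add_le _ _).trans (by linarith)
  have b3 := abs_le_of_abs_hasDerivAt_le (f := fun t => θ₃ (s + t) - θ₃ (s - t)) (by simp)
    (fun t _ => by convert! (hp h4 t).sub (hm h4 t) using 1; ring) b4
  have b2 := abs_le_of_abs_hasDerivAt_le (f := fun t => θ₂ (s + t) + θ₂ (s - t) - 2 * θ₂ s)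
    (by simp; ring)
    (fun t _ => by
      convert! ((hp h3 t).add (hm h3 t)).sub_const (2 * θ₂ s) using 1) b3
  have b1 := abs_le_of_abs_hasDerivAt_le
    (f := fun t => θ₁ (s + t) - θ₁ (s - t) - 2 * θ₂ s * t) (by simp)
    (fun t _ => by
      convert! ((hp h2 t).sub (hm h2 t)).sub ((hasDerivAt_id t).const_mul (2 * θ₂ s)) using 1
      ring) b2
  have b0 := abs_le_of_abs_hasDerivAt_le
    (f := fun t => θ (s + t) + θ (s - t) - 2 * θ s - θ₂ s * t ^ 2) (by simp; ring)
    (fun t _ => by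
      convert! (((hp h1 t).add (hm h1 t)).sub_const (2 * θ s)).sub
        ((hasDerivAt_pow 2 t).const_mul (θ₂ s)) using 1
      norm_num
      ring) b1
  simpa using b0 1 ⟨zero_le_one, le_rfl⟩

/-- With `ρ(s) = √(q + s²)` the chain rule reads `(ψₙ ∘ ρ)' = -s · ψₙ₊₁ ∘ ρ` for `ψₙ = screenedDeriv
k n`, so four derivatives involve only `ψ₀, …, ψ₄`. The hypothesis `1 ≤ q` keeps `ρ` comparable
across a unit interval. -/
lemma abs_secondDifference_screened_sub_le {k q : ℝ} (hk : 0 ≤ k) (hq : 1 ≤ q) (s : ℝ) :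
    |screened k √(q + (s + 1) ^ 2) + screened k √(q + (s - 1) ^ 2) - 2 * screened k √(q + s ^ 2) -
      (s ^ 2 * screenedDeriv k 2 √(q + s ^ 2) - screenedDeriv k 1 √(q + s ^ 2))| ≤
      44544 / √(q + s ^ 2) ^ 5 := by
  set ρ : ℝ → ℝ := fun s => √(q + s ^ 2) with hρ
  have hρ0 : ∀ s, 0 < ρ s := fun s => Real.sqrt_pos.2 (by positivity)
  have hρd : ∀ s, HasDerivAt ρ (s / ρ s) s := by
    intro s
    convert! ((hasDerivAt_pow 2 s).const_add q).sqrt (by positivity) using 1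
    norm_num [hρ]
    ring
  have hΨ : ∀ n < 4, ∀ s, HasDerivAt (fun s => screenedDeriv k n (ρ s))
      (-(s * screenedDeriv k (n + 1) (ρ s))) s := by
    intro n hn s
    convert! (hasDerivAt_screenedDeriv k hn (hρ0 s)).comp s (hρd s) using 1
    have := (hρ0 s).ne'
    field_simp
  have hid : ∀ s : ℝ, HasDerivAt (fun s : ℝ => s) 1 s := fun s => hasDerivAt_id s
  have key := abs_secondDifference_sub_le (s := s) (M := 22272 / ρ s ^ 5)
    (θ := fun s => screenedDeriv k 0 (ρ s))
    (θ₁ := fun s => -(s * screenedDeriv k 1 (ρ s)))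
    (θ₂ := fun s => s ^ 2 * screenedDeriv k 2 (ρ s) - screenedDeriv k 1 (ρ s))
    (θ₃ := fun s => 3 * (s * screenedDeriv k 2 (ρ s)) - s ^ 3 * screenedDeriv k 3 (ρ s))
    (θ₄ := fun s => 3 * screenedDeriv k 2 (ρ s) - 6 * (s ^ 2 * screenedDeriv k 3 (ρ s)) +
      s ^ 4 * screenedDeriv k 4 (ρ s))
    (hΨ 0 (by norm_num))
    (fun s => by
      convert! ((hid s).mul (hΨ 1 (by norm_num) s)).neg using 1
      norm_num
      ring)
    (fun s => by
      convert! ((hasDerivAt_pow 2 s).mul (hΨ 2 (by norm_num) s)).sub (hΨ 1 (by norm_num) s) using 1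
      norm_num
      ring)
    (fun s => by
      convert! (((hid s).mul (hΨ 2 (by norm_num) s)).const_mul 3).sub
        ((hasDerivAt_pow 3 s).mul (hΨ 3 (by norm_num) s)) using 1
      norm_num
      ring)
    -- The constant is `22272 = 32 · 696`: `696 = 3·8 + 6·48 + 384` bounds the fourth derivative in
    -- units of `ρ(u)⁻⁵`, and `32 = 2⁵` comes from `ρ(s) ≤ 2ρ(u)`.
    (fun u hu => by
      obtain ⟨c2, c3, c4⟩ := abs_screenedDeriv_le hk (hρ0 u)
      have hu2 : u ^ 2 ≤ ρ u ^ 2 := by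
        rw [hρ, Real.sq_sqrt (by positivity)]; linarith
      have d3 : |u ^ 2 * screenedDeriv k 3 (ρ u)| ≤ 48 / ρ u ^ 5 := by
        rw [abs_mul, abs_of_nonneg (sq_nonneg u)]
        calc _ ≤ ρ u ^ 2 * (48 / ρ u ^ 7) :=
              mul_le_mul hu2 c3 (abs_nonneg _) (by positivity)
          _ = _ := by have := (hρ0 u).ne'; field_simp
      have d4 : |u ^ 4 * screenedDeriv k 4 (ρ u)| ≤ 384 / ρ u ^ 5 := by
        rw [abs_mul, abs_of_nonneg (by positivity : 0 ≤ u ^ 4)]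
        calc _ ≤ ρ u ^ 4 * (384 / ρ u ^ 9) :=
              mul_le_mul (by nlinarith [sq_nonneg u, sq_nonneg (ρ u)]) c4 (abs_nonneg _)
                (by positivity)
          _ = _ := by have := (hρ0 u).ne'; field_simp
      have hρu : ρ s ≤ 2 * ρ u := by
        rw [hρ]
        refine Real.sqrt_le_iff.2 ⟨by positivity, ?_⟩
        rw [mul_pow, Real.sq_sqrt (by positivity)]
        have h1 : (u - s) ^ 2 ≤ 1 := (sq_le_one_iff_abs_le_one _).2 hu
        nlinarith [sq_nonneg (2 * u - s)]
      have h5 : 1 / ρ u ^ 5 ≤ 32 / ρ s ^ 5 := by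
        rw [div_le_div_iff₀ (pow_pos (hρ0 u) 5) (pow_pos (hρ0 s) 5)]
        have := pow_le_pow_left₀ (hρ0 s).le hρu 5
        rw [mul_pow] at this
        linarith
      have e2 := abs_le.1 c2
      have e3 := abs_le.1 d3
      have e4 := abs_le.1 d4
      have r2 : 8 / ρ u ^ 5 = 8 * (1 / ρ u ^ 5) := by ring
      have r3 : 48 / ρ u ^ 5 = 48 * (1 / ρ u ^ 5) := by ring
      have r4 : 384 / ρ u ^ 5 = 384 * (1 / ρ u ^ 5) := by ring
      have r5 : 22272 / ρ s ^ 5 = 696 * (32 / ρ s ^ 5) := by ring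
      rw [r2] at e2
      rw [r3] at e3
      rw [r4] at e4
      rw [r5]
      exact abs_le.2 ⟨by linarith, by linarith⟩)
  have h0 : ∀ s, screenedDeriv k 0 (ρ s) = screened k (ρ s) := by
    intro s; simp [screenedDeriv, screened, revBessel]
  simp only [h0] at key
  refine key.trans (le_of_eq ?_)
  ring

/-- The inverse length `√6 / N` at which the potential is screened. -/
def screening (N : ℝ) : ℝ := √6 / N

lemma screening_sq (N : ℝ) : screening N ^ 2 = 6 * killRate N := by
  rw [screening, killRate, div_pow, Real.sq_sqrt (by norm_num)]; ring

lemma screening_pos {N : ℝ} (hN : 1 ≤ N) : 0 < screening N := by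
  unfold screening; positivity

lemma regNorm_pos (x : (ℤ × ℤ) × ℤ) : 0 < regNorm x := Real.sqrt_pos.2 (by positivity)

/-- Two errors of order `ρ⁻⁵` remain: the regularization (`ψ₂/6`) and the discretization of three
second derivatives, in total `(8 + 3·44544)/6 < 25000`. The order is summable in dimension three,
which is all that is needed. -/
lemma abs_stepOp_yukawa_le {N : ℝ} (hN : 1 ≤ N) (x : (ℤ × ℤ) × ℤ) :
    |stepOp (killRate N) cubicStep (yukawa (screening N)) x| ≤ 25000 / regNorm x ^ 5 := by
  obtain ⟨⟨a, b⟩, c⟩ := x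
  set k := screening N with hk
  have hk0 : 0 < k := screening_pos hN
  set A : ℝ := (a : ℝ) with hA
  set B : ℝ := (b : ℝ) with hB
  set C : ℝ := (c : ℝ) with hC
  have hr : regNorm ((a, b), c) = √(A ^ 2 + B ^ 2 + C ^ 2 + 1) := rfl
  have e1 := abs_secondDifference_screened_sub_le hk0.le
    (show 1 ≤ B ^ 2 + C ^ 2 + 1 by nlinarith [sq_nonneg B, sq_nonneg C]) A
  have e2 := abs_secondDifference_screened_sub_le hk0.le
    (show 1 ≤ A ^ 2 + C ^ 2 + 1 by nlinarith [sq_nonneg A, sq_nonneg C]) B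
  have e3 := abs_secondDifference_screened_sub_le hk0.le
    (show 1 ≤ A ^ 2 + B ^ 2 + 1 by nlinarith [sq_nonneg B, sq_nonneg A]) C
  rw [show B ^ 2 + C ^ 2 + 1 + A ^ 2 = A ^ 2 + B ^ 2 + C ^ 2 + 1 by ring, ← hr] at e1
  rw [show A ^ 2 + C ^ 2 + 1 + B ^ 2 = A ^ 2 + B ^ 2 + C ^ 2 + 1 by ring, ← hr] at e2
  rw [show A ^ 2 + B ^ 2 + 1 + C ^ 2 = A ^ 2 + B ^ 2 + C ^ 2 + 1 by ring, ← hr] at e3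
  set ρ := regNorm ((a, b), c) with hρ
  have hρ0 : 0 < ρ := regNorm_pos _
  have hρ2 : A ^ 2 + B ^ 2 + C ^ 2 = ρ ^ 2 - 1 := by
    rw [hr, Real.sq_sqrt (by positivity)]; ring
  have e4 := (abs_screenedDeriv_le hk0.le hρ0).1
  -- The Laplacian of the regularized potential: `e^{-kr}/r` solves `Δu = k²u` off the origin, and
  -- replacing `r²` by `ρ² - 1` costs exactly `ψ₂`.
  have hlap : (A ^ 2 + B ^ 2 + C ^ 2) * screenedDeriv k 2 ρ - 3 * screenedDeriv k 1 ρ =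
      k ^ 2 * screened k ρ - screenedDeriv k 2 ρ := by
    rw [hρ2]
    simp only [screenedDeriv, screened, revBessel]
    field_simp
    ring
  have hL : stepOp (killRate N) cubicStep (yukawa k) ((a, b), c) =
      k ^ 2 / 6 * screened k ρ - 1 / 6 * (
        (screened k √(B ^ 2 + C ^ 2 + 1 + (A + 1) ^ 2) +
          screened k √(B ^ 2 + C ^ 2 + 1 + (A - 1) ^ 2) - 2 * screened k ρ) +
        (screened k √(A ^ 2 + C ^ 2 + 1 + (B + 1) ^ 2) +
          screened k √(A ^ 2 + C ^ 2 + 1 + (B - 1) ^ 2) - 2 * screened k ρ) +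
        (screened k √(A ^ 2 + B ^ 2 + 1 + (C + 1) ^ 2) +
          screened k √(A ^ 2 + B ^ 2 + 1 + (C - 1) ^ 2) - 2 * screened k ρ)) := by
    have hy : ∀ a b c : ℤ, yukawa k ((a, b), c) =
      screened k √((a : ℝ) ^ 2 + (b : ℝ) ^ 2 + (c : ℝ) ^ 2 + 1) := fun _ _ _ => rfl
    rw [hk, screening_sq, ← hk]
    simp only [stepOp, Fin.sum_univ_six, cubicStep, Matrix.cons_val, Prod.mk_add_mk, add_zero, hy,
      hr]
    push_cast
    rw [← hA, ← hB, ← hC,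
      show B ^ 2 + C ^ 2 + 1 + (A + 1) ^ 2 = (A + 1) ^ 2 + B ^ 2 + C ^ 2 + 1 by ring,
      show B ^ 2 + C ^ 2 + 1 + (A - 1) ^ 2 = (A + -1) ^ 2 + B ^ 2 + C ^ 2 + 1 by ring,
      show A ^ 2 + C ^ 2 + 1 + (B + 1) ^ 2 = A ^ 2 + (B + 1) ^ 2 + C ^ 2 + 1 by ring,
      show A ^ 2 + C ^ 2 + 1 + (B - 1) ^ 2 = A ^ 2 + (B + -1) ^ 2 + C ^ 2 + 1 by ring,
      show A ^ 2 + B ^ 2 + 1 + (C + 1) ^ 2 = A ^ 2 + B ^ 2 + (C + 1) ^ 2 + 1 by ring,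
      show A ^ 2 + B ^ 2 + 1 + (C - 1) ^ 2 = A ^ 2 + B ^ 2 + (C + -1) ^ 2 + 1 by ring]
    ring
  rw [hL]
  have hpos : 0 < 1 / ρ ^ 5 := by positivity
  rw [show 44544 / ρ ^ 5 = 44544 * (1 / ρ ^ 5) by ring, abs_le] at e1 e2 e3
  rw [show 8 / ρ ^ 5 = 8 * (1 / ρ ^ 5) by ring, abs_le] at e4
  rw [show 25000 / ρ ^ 5 = 25000 * (1 / ρ ^ 5) by ring, abs_le]
  constructor <;> linarith [e1.1, e1.2, e2.1, e2.2, e3.1, e3.2, e4.1, e4.2]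

end

noncomputable section

/-! ## Lattice sums as integrals -/

/-- The lattice point next to a point of Euclidean space. -/
def latticeRound (u : EuclideanSpace ℝ (Fin 3)) : (ℤ × ℤ) × ℤ :=
  ((round (u 0), round (u 1)), round (u 2))

lemma measurable_latticeRound : Measurable latticeRound := by
  unfold latticeRound
  have h : ∀ i : Fin 3, Measurable fun u : EuclideanSpace ℝ (Fin 3) => round (u i) := by
    intro i
    simp only [round_eq]
    exact Int.measurable_floor.comp
      (((by fun_prop : Measurable fun u : EuclideanSpace ℝ (Fin 3) => u i)).add_const _)
  exact ((h 0).prodMk (h 1)).prodMk (h 2)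

/-- The fibres of rounding are half-open unit cubes, of volume 1; sums over `ℤ³` are therefore
integrals of step functions. -/
lemma map_latticeRound : (volume : Measure (EuclideanSpace ℝ (Fin 3))).map latticeRound =
    Measure.count := by
  rw [Measure.ext_iff_singleton]
  intro x
  rw [Measure.map_apply measurable_latticeRound (measurableSet_singleton _),
    Measure.count_singleton]
  set a : Fin 3 → ℤ := ![x.1.1, x.1.2, x.2] with ha
  have hpre : latticeRound ⁻¹' {x} = (WithLp.ofLp) ⁻¹'
      (Set.univ.pi fun i => Set.Ico ((a i : ℝ) - 1 / 2) ((a i : ℝ) + 1 / 2)) := by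
    ext u
    have hr : ∀ (r : ℝ) (n : ℤ), round r = n ↔ r ∈ Set.Ico ((n : ℝ) - 1 / 2) ((n : ℝ) + 1 / 2) := by
      intro r n
      rw [round_eq, Int.floor_eq_iff, Set.mem_Ico]
      constructor <;> rintro ⟨h1, h2⟩ <;> constructor <;> linarith
    obtain ⟨⟨p, q⟩, r⟩ := x
    simp only [Set.mem_preimage, Set.mem_singleton_iff, latticeRound, Prod.mk.injEq, hr,
      Set.mem_univ_pi, Fin.forall_fin_succ, ha, Matrix.cons_val_zero, Matrix.cons_val_succ,
      IsEmpty.forall_iff, and_true, and_assoc]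
    rfl
  have hvp := EuclideanSpace.volume_preserving_symm_measurableEquiv_toLp (Fin 3)
  rw [hpre]
  have := hvp.measure_preimage
    (s := Set.univ.pi fun i => Set.Ico ((a i : ℝ) - 1 / 2) ((a i : ℝ) + 1 / 2))
    (MeasurableSet.univ_pi fun i => measurableSet_Ico).nullMeasurableSet
  refine this.trans ?_
  rw [volume_pi_pi]
  exact Finset.prod_eq_one fun i _ => by rw [Real.volume_Ico]; norm_num

lemma integrable_comp_latticeRound_iff {g : (ℤ × ℤ) × ℤ → ℝ} :
    Integrable (fun u => g (latticeRound u)) ↔ Summable g := by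
  rw [← summable_norm_iff, ← integrable_count_iff, ← map_latticeRound,
    integrable_map_measure (Measurable.aestronglyMeasurable (measurable_of_countable g))
      measurable_latticeRound.aemeasurable]
  rfl

lemma integral_comp_latticeRound {g : (ℤ × ℤ) × ℤ → ℝ} (hg : Summable g) :
    ∫ u, g (latticeRound u) = ∑' x, g x := by
  have h1 := integral_map (μ := (volume : Measure (EuclideanSpace ℝ (Fin 3))))
    measurable_latticeRound.aemeasurable (f := g)
    (Measurable.aestronglyMeasurable (measurable_of_countable g))
  rw [← h1, map_latticeRound, integral_countable (integrable_count_iff.2 hg.norm)]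
  simp [Measure.real]

/-- Rounding moves a point by at most `√3/2 ≤ 1` and regularizing costs at most 1. The first bound
gives convergence after rescaling, the second an integrable majorant. -/
lemma abs_norm_sub_regNorm_latticeRound_le (u : EuclideanSpace ℝ (Fin 3)) :
    |‖u‖ - regNorm (latticeRound u)| ≤ 2 ∧ ‖u‖ ≤ 2 * regNorm (latticeRound u) := by
  set x := latticeRound u with hx
  set w : EuclideanSpace ℝ (Fin 3) := !₂[(x.1.1 : ℝ), (x.1.2 : ℝ), (x.2 : ℝ)] with hw
  have hwn : ‖w‖ ^ 2 = (x.1.1 : ℝ) ^ 2 + (x.1.2 : ℝ) ^ 2 + (x.2 : ℝ) ^ 2 := by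
    rw [EuclideanSpace.norm_sq_eq, Fin.sum_univ_three]; simp [hw]
  have hr2 : regNorm x ^ 2 = ‖w‖ ^ 2 + 1 := by
    rw [regNorm, Real.sq_sqrt (by positivity), hwn]
  have hr0 := regNorm_pos x
  have hd : ‖u - w‖ ≤ 1 := by
    have h0 := abs_sub_round (u 0)
    have h1 := abs_sub_round (u 1)
    have h2 := abs_sub_round (u 2)
    have : ‖u - w‖ ^ 2 ≤ 1 := by
      rw [EuclideanSpace.norm_sq_eq, Fin.sum_univ_three]
      have e0 : (u - w) 0 = u 0 - round (u 0) := by simp [hw, hx, latticeRound]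
      have e1 : (u - w) 1 = u 1 - round (u 1) := by simp [hw, hx, latticeRound]
      have e2 : (u - w) 2 = u 2 - round (u 2) := by simp [hw, hx, latticeRound]
      rw [e0, e1, e2, Real.norm_eq_abs, Real.norm_eq_abs, Real.norm_eq_abs]
      have s0 := pow_le_pow_left₀ (abs_nonneg _) h0 2
      have s1 := pow_le_pow_left₀ (abs_nonneg _) h1 2
      have s2 := pow_le_pow_left₀ (abs_nonneg _) h2 2
      linarith
    exact (sq_le_one_iff₀ (norm_nonneg _)).1 this
  have hd2 := abs_le.1 ((abs_norm_sub_norm_le u w).trans hd)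
  have hw0 := norm_nonneg w
  have h1 : ‖w‖ ≤ regNorm x := abs_le_of_sq_le_sq' (by linarith) hr0.le |>.2
  have h2 : regNorm x ≤ ‖w‖ + 1 :=
    abs_le_of_sq_le_sq' (by nlinarith) (by positivity) |>.2
  have h3 : 1 ≤ regNorm x := by nlinarith
  exact ⟨abs_le.2 ⟨by linarith, by linarith⟩, by linarith⟩

lemma screened_nonneg (k : ℝ) {ρ : ℝ} (hρ : 0 ≤ ρ) : 0 ≤ screened k ρ :=
  div_nonneg (Real.exp_pos _).le hρ

lemma screened_anti {k ρ ρ' : ℝ} (hk : 0 ≤ k) (hρ : 0 < ρ) (h : ρ ≤ ρ') :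
    screened k ρ' ≤ screened k ρ :=
  div_le_div₀ (Real.exp_pos _).le
    (Real.exp_le_exp.2 (neg_le_neg (mul_le_mul_of_nonneg_left h hk))) hρ h

lemma yukawa_nonneg (k : ℝ) (x : (ℤ × ℤ) × ℤ) : 0 ≤ yukawa k x :=
  screened_nonneg k (regNorm_pos x).le

lemma integrable_screened_norm {b : ℝ} (hb : 0 < b) :
    Integrable fun v : EuclideanSpace ℝ (Fin 3) => screened 1 (b * ‖v‖) := by
  rw [integrable_fun_norm_addHaar volume (f := fun r => screened 1 (b * r)), finrank_euclideanSpace,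
    Fintype.card_fin]
  have := (integrableOn_rpow_mul_exp_neg_mul_rpow (p := 1) (s := 1) (b := b) (by norm_num)
    (by norm_num) hb).const_mul b⁻¹
  refine IntegrableOn.congr_fun (f := fun r => b⁻¹ * (r ^ (1 : ℝ) * Real.exp (-b * r ^ (1 : ℝ))))
    this (fun r hr => ?_) measurableSet_Ioi
  have hr : 0 < r := hr
  simp only [screened, Real.rpow_one, smul_eq_mul, one_mul, neg_mul]
  field_simp

/-- Polar coordinates: `3 · (4π/3) · ∫ r e^{-r} dr`. The constants `π/3` and `2π/3` of the sharp
asymptotics come from here. -/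
lemma integral_screened_norm :
    ∫ v : EuclideanSpace ℝ (Fin 3), screened 1 ‖v‖ = 4 * Real.pi := by
  rw [integral_fun_norm_addHaar, finrank_euclideanSpace, Fintype.card_fin]
  have h1 : ∫ y in Set.Ioi (0 : ℝ), y ^ (3 - 1) • screened 1 y = 1 := by
    have := Real.integral_rpow_mul_exp_neg_mul_Ioi (a := 2) (r := 1) (by norm_num) (by norm_num)
    rw [Real.Gamma_two, one_div_one, Real.one_rpow, one_mul] at this
    refine Eq.trans ?_ this
    refine setIntegral_congr_fun measurableSet_Ioi fun r hr => ?_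
    have hr : 0 < r := hr
    norm_num [screened]
    field_simp
  rw [h1, Measure.real, EuclideanSpace.volume_ball_fin_three]
  simp
  rw [ENNReal.toReal_ofReal (by positivity)]
  ring

/-- The regularized distance at scale `k⁻¹`. -/
def scaledDist (k : ℝ) (v : EuclideanSpace ℝ (Fin 3)) : ℝ := k * regNorm (latticeRound (k⁻¹ • v))

lemma scaledDist_bounds {k : ℝ} (hk : 0 < k) (v : EuclideanSpace ℝ (Fin 3)) :
    |‖v‖ - scaledDist k v| ≤ 2 * k ∧ 1 / 2 * ‖v‖ ≤ scaledDist k v := by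
  obtain ⟨h1, h2⟩ := abs_norm_sub_regNorm_latticeRound_le (k⁻¹ • v)
  rw [norm_smul, norm_inv, Real.norm_of_nonneg hk.le] at h1 h2
  have e : k * (k⁻¹ * ‖v‖) = ‖v‖ := by field_simp
  constructor
  · rw [← e, scaledDist, ← mul_sub, abs_mul, abs_of_pos hk, mul_comm 2]
    exact mul_le_mul_of_nonneg_left h1 hk.le
  · have := mul_le_mul_of_nonneg_left h2 hk.le
    rw [e] at this
    rw [scaledDist]
    linarith

lemma measurable_screened_scaledDist (k : ℝ) : Measurable fun v => screened 1 (scaledDist k v) := by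
  have h : Measurable fun u => screened 1 (k * regNorm (latticeRound u)) :=
    (measurable_of_countable fun x => screened 1 (k * regNorm x)).comp measurable_latticeRound
  exact h.comp (measurable_const_smul k⁻¹)

lemma screened_scaledDist_le {k : ℝ} (hk : 0 < k) {v : EuclideanSpace ℝ (Fin 3)} (hv : v ≠ 0) :
    screened 1 (scaledDist k v) ≤ screened 1 (1 / 2 * ‖v‖) :=
  screened_anti zero_le_one (by have := norm_pos_iff.2 hv; positivity) (scaledDist_bounds hk v).2

lemma ae_ne_zero_euclidean : ∀ᵐ v : EuclideanSpace ℝ (Fin 3), v ≠ 0 := by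
  rw [ae_iff]
  simp

lemma scaledDist_nonneg {k : ℝ} (hk : 0 < k) (v : EuclideanSpace ℝ (Fin 3)) :
    0 ≤ scaledDist k v := mul_nonneg hk.le (regNorm_pos _).le

lemma integrable_screened_scaledDist {k : ℝ} (hk : 0 < k) :
    Integrable fun v => screened 1 (scaledDist k v) := by
  refine (integrable_screened_norm (b := 1 / 2) (by norm_num)).mono'
    (measurable_screened_scaledDist k).aestronglyMeasurable ?_
  filter_upwards [ae_ne_zero_euclidean] with v hv
  rw [Real.norm_of_nonneg (screened_nonneg _ (scaledDist_nonneg hk v))]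
  exact screened_scaledDist_le hk hv

lemma yukawa_eq_screened {k : ℝ} (hk : 0 < k) (x : (ℤ × ℤ) × ℤ) :
    yukawa k x = k * screened 1 (k * regNorm x) := by
  have := (regNorm_pos x).ne'
  simp only [yukawa, screened, one_mul]
  field_simp

lemma summable_yukawa {k : ℝ} (hk : 0 < k) : Summable (yukawa k) := by
  rw [← integrable_comp_latticeRound_iff]
  have h := (integrable_comp_smul_iff volume
    (fun v => screened 1 (scaledDist k v)) hk.ne').2 (integrable_screened_scaledDist hk)
  refine (h.const_mul k).congr (Filter.Eventually.of_forall fun u => ?_)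
  simp only [yukawa_eq_screened hk, scaledDist, smul_smul, inv_mul_cancel₀ hk.ne', one_smul]

/-- The rescaled sum of the screened potential over a set of lattice points is an integral. -/
lemma sq_mul_tsum_indicator_yukawa {k : ℝ} (hk : 0 < k) (S : Set ((ℤ × ℤ) × ℤ)) :
    k ^ 2 * ∑' x, S.indicator (yukawa k) x =
      ∫ v, {v | latticeRound (k⁻¹ • v) ∈ S}.indicator (fun v => screened 1 (scaledDist k v)) v := by
  rw [← integral_comp_latticeRound ((summable_yukawa hk).indicator S)]
  have h := Measure.integral_comp_smul (volume : Measure (EuclideanSpace ℝ (Fin 3)))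
    ({v | latticeRound (k⁻¹ • v) ∈ S}.indicator fun v => screened 1 (scaledDist k v)) k
  rw [finrank_euclideanSpace, Fintype.card_fin, abs_of_pos (by positivity), smul_eq_mul] at h
  have h2 : ∀ u, S.indicator (yukawa k) (latticeRound u) = k *
      {v | latticeRound (k⁻¹ • v) ∈ S}.indicator (fun v => screened 1 (scaledDist k v))
        (k • u) := by
    intro u
    have e : k⁻¹ • k • u = u := by rw [smul_smul, inv_mul_cancel₀ hk.ne', one_smul]
    by_cases hS : latticeRound u ∈ S
    · rw [Set.indicator_of_mem hS,
        Set.indicator_of_mem (s := {v | latticeRound (k⁻¹ • v) ∈ S})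
          (by rw [Set.mem_ofPred_eq, e]; exact hS), yukawa_eq_screened hk, scaledDist, e]
    · rw [Set.indicator_of_notMem hS, Set.indicator_of_notMem
        (s := {v | latticeRound (k⁻¹ • v) ∈ S}) (by rw [Set.mem_ofPred_eq, e]; exact hS), mul_zero]
  simp only [h2]
  rw [integral_const_mul, h]
  field_simp

lemma sq_mul_tsum_yukawa {k : ℝ} (hk : 0 < k) :
    k ^ 2 * ∑' x, yukawa k x = ∫ v, screened 1 (scaledDist k v) := by
  have := sq_mul_tsum_indicator_yukawa hk Set.univ
  simpa only [Set.indicator_univ, Set.mem_univ, Set.ofPred_true] using this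

/-- Riemann sums of `e^{-|v|}/|v|` with mesh `k`, by dominated convergence with the majorant
`screened 1 (|v|/2)`. -/
lemma tendsto_sq_mul_tsum_yukawa :
    Filter.Tendsto (fun k => k ^ 2 * ∑' x, yukawa k x) (nhdsWithin 0 (Set.Ioi 0))
      (nhds (4 * Real.pi)) := by
  rw [← integral_screened_norm]
  have hmem : ∀ᶠ k : ℝ in nhdsWithin 0 (Set.Ioi 0), 0 < k := self_mem_nhdsWithin
  refine Filter.Tendsto.congr' (f₁ := fun k => ∫ v, screened 1 (scaledDist k v)) ?_ ?_
  · filter_upwards [hmem] with k hk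
    exact (sq_mul_tsum_yukawa hk).symm
  refine tendsto_integral_filter_of_dominated_convergence
    (fun v => screened 1 (1 / 2 * ‖v‖)) ?_ ?_ (integrable_screened_norm (by norm_num)) ?_
  · exact Filter.Eventually.of_forall fun k =>
      (measurable_screened_scaledDist k).aestronglyMeasurable
  · filter_upwards [hmem] with k hk
    filter_upwards [ae_ne_zero_euclidean] with v hv
    rw [Real.norm_of_nonneg (screened_nonneg _ (scaledDist_nonneg hk v))]
    exact screened_scaledDist_le hk hv
  · filter_upwards [ae_ne_zero_euclidean] with v hv
    have hcont : ContinuousAt (screened 1) ‖v‖ := by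
      unfold screened
      exact ContinuousAt.div (by fun_prop) (by fun_prop) (norm_ne_zero_iff.2 hv)
    refine hcont.tendsto.comp ?_
    rw [tendsto_iff_norm_sub_tendsto_zero]
    have h0 : Filter.Tendsto (fun k : ℝ => 2 * k) (nhdsWithin 0 (Set.Ioi 0)) (nhds 0) := by
      have : Filter.Tendsto (fun k : ℝ => 2 * k) (nhds 0) (nhds (2 * 0)) :=
        (continuous_const.mul continuous_id).tendsto _
      rw [mul_zero] at this
      exact this.mono_left nhdsWithin_le_nhds
    refine squeeze_zero' (Filter.Eventually.of_forall fun _ => norm_nonneg _) ?_ h0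
    filter_upwards [hmem] with k hk
    rw [Real.norm_eq_abs, abs_sub_comm]
    exact (scaledDist_bounds hk v).1

lemma ae_coord_ne_zero : ∀ᵐ v : EuclideanSpace ℝ (Fin 3), v 0 ≠ 0 := by
  have h := Measure.addHaar_submodule (volume : Measure (EuclideanSpace ℝ (Fin 3)))
    (LinearMap.ker (EuclideanSpace.proj (𝕜 := ℝ) (0 : Fin 3)).toLinearMap) (by
      rw [Ne, LinearMap.ker_eq_top]
      intro h
      have := congrArg (fun f => f (EuclideanSpace.single (0 : Fin 3) (1 : ℝ))) h
      simp at this)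
  rw [ae_iff]
  convert! h using 2
  ext v
  simp

/-- The mass of the dominating function in the slab `|v 0| < δ`. -/
lemma tendsto_integral_strip :
    Filter.Tendsto (fun δ : ℝ => ∫ v : EuclideanSpace ℝ (Fin 3),
      {v : EuclideanSpace ℝ (Fin 3) | |v 0| < δ}.indicator (fun v => screened 1 (1 / 2 * ‖v‖)) v)
      (nhdsWithin 0 (Set.Ioi 0)) (nhds 0) := by
  have hms : ∀ δ : ℝ, MeasurableSet {v : EuclideanSpace ℝ (Fin 3) | |v 0| < δ} := fun δ =>
    measurableSet_lt (by fun_prop) measurable_const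
  have hint := integrable_screened_norm (b := 1 / 2) (by norm_num)
  rw [show nhds (0 : ℝ) = nhds (∫ _ : EuclideanSpace ℝ (Fin 3), (0 : ℝ)) by rw [integral_zero]]
  refine tendsto_integral_filter_of_dominated_convergence
    (fun v => screened 1 (1 / 2 * ‖v‖)) ?_ ?_ hint ?_
  · exact Filter.Eventually.of_forall fun δ => hint.aestronglyMeasurable.indicator (hms δ)
  · refine Filter.Eventually.of_forall fun δ => Filter.Eventually.of_forall fun v => ?_
    have h0 : 0 ≤ screened 1 (1 / 2 * ‖v‖) := screened_nonneg _ (by positivity)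
    refine (norm_indicator_le_norm_self _ _).trans ?_
    rw [Real.norm_of_nonneg h0]
  · filter_upwards [ae_coord_ne_zero] with v hv
    refine tendsto_const_nhds.congr' ?_
    have : ∀ᶠ δ : ℝ in nhdsWithin 0 (Set.Ioi 0), δ < |v 0| :=
      nhdsWithin_le_nhds (eventually_lt_nhds (abs_pos.2 hv))
    filter_upwards [this] with δ hδ
    rw [Set.indicator_of_notMem]
    simpa using hδ.le

/-- Rounding moves a coordinate by at most `1/2 ≤ R`, so at scale `k⁻¹` the strip sits inside `|v 0|
< 2kR`. Confining a single coordinate already makes the mass small, uniformly in `k`. -/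
lemma exists_sq_mul_tsum_strip_le {η : ℝ} (hη : 0 < η) : ∃ δ : ℝ, 0 < δ ∧ ∀ k R : ℝ, 0 < k →
    1 ≤ R → k * R ≤ δ →
    k ^ 2 * ∑' x, {x : (ℤ × ℤ) × ℤ | |(x.1.1 : ℝ)| < R}.indicator (yukawa k) x ≤ η := by
  have h := tendsto_integral_strip.eventually (eventually_le_nhds hη)
  rw [eventually_nhdsWithin_iff, Metric.eventually_nhds_iff] at h
  obtain ⟨ε, hε, h⟩ := h
  refine ⟨ε / 4, by positivity, fun k R hk hR hkR => ?_⟩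
  have hkR0 : 0 < k * R := by positivity
  have h1 := h (y := 2 * (k * R)) (by
    rw [Real.dist_eq, sub_zero, abs_of_pos (by positivity)]; linarith) (by
    simp only [Set.mem_Ioi]; positivity)
  refine le_trans ?_ h1
  rw [sq_mul_tsum_indicator_yukawa hk]
  have hms : MeasurableSet {v : EuclideanSpace ℝ (Fin 3) | |v 0| < 2 * (k * R)} :=
    measurableSet_lt (by fun_prop) measurable_const
  have hms2 : MeasurableSet {v : EuclideanSpace ℝ (Fin 3) |
      latticeRound (k⁻¹ • v) ∈ {x : (ℤ × ℤ) × ℤ | |(x.1.1 : ℝ)| < R}} :=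
    (measurable_latticeRound.comp (measurable_const_smul k⁻¹))
      (Set.to_countable _).measurableSet
  refine integral_mono_ae ((integrable_screened_scaledDist hk).indicator hms2)
    ((integrable_screened_norm (by norm_num)).indicator hms) ?_
  filter_upwards [ae_ne_zero_euclidean] with v hv
  by_cases hmem : latticeRound (k⁻¹ • v) ∈ {x : (ℤ × ℤ) × ℤ | |(x.1.1 : ℝ)| < R}
  · have hv0 : |v 0| < 2 * (k * R) := by
      have h2 := abs_sub_round ((k⁻¹ • v) 0)
      have h3 : |((round ((k⁻¹ • v) 0) : ℤ) : ℝ)| < R := hmem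
      have h4 : |(k⁻¹ • v) 0| < 2 * R := by
        have := abs_sub_abs_le_abs_sub ((k⁻¹ • v) 0) (round ((k⁻¹ • v) 0) : ℝ)
        linarith
      rw [PiLp.smul_apply, smul_eq_mul, abs_mul, abs_of_pos (inv_pos.2 hk),
        inv_mul_lt_iff₀ hk] at h4
      linarith
    rw [Set.indicator_of_mem (by exact hmem), Set.indicator_of_mem (by exact hv0)]
    exact screened_scaledDist_le hk hv
  · rw [Set.indicator_of_notMem (by exact hmem)]
    exact Set.indicator_nonneg (fun v _ => screened_nonneg _ (by positivity)) _

lemma summable_regNorm_pow : Summable fun x => 1 / regNorm x ^ 5 := by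
  rw [← integrable_comp_latticeRound_iff]
  -- The exponent 5 exceeds the dimension 3; the factor `3 ^ 5` comes from `1 + ‖u‖ ≤ 3 · regNorm`.
  have h := (integrable_one_add_norm (E := EuclideanSpace ℝ (Fin 3)) (μ := volume) (r := 5)
    (by simp; norm_num)).const_mul (3 ^ 5)
  refine h.mono' ?_ (Filter.Eventually.of_forall fun u => ?_)
  · exact ((measurable_of_countable fun x => 1 / regNorm x ^ 5).comp
      measurable_latticeRound).aestronglyMeasurable
  · have h0 := regNorm_pos (latticeRound u)
    have h1 : 1 ≤ regNorm (latticeRound u) := by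
      rw [regNorm, Real.one_le_sqrt]; nlinarith [sq_nonneg ((latticeRound u).2 : ℝ),
        sq_nonneg ((latticeRound u).1.1 : ℝ), sq_nonneg ((latticeRound u).1.2 : ℝ)]
    have h2 := (abs_norm_sub_regNorm_latticeRound_le u).2
    rw [Real.norm_of_nonneg (by positivity), Real.rpow_neg (by positivity)]
    have h3 : (1 + ‖u‖) ^ (5 : ℝ) = (1 + ‖u‖) ^ 5 := by exact_mod_cast Real.rpow_natCast (1 + ‖u‖) 5
    rw [h3, ← div_eq_mul_inv, div_le_div_iff₀ (by positivity) (by positivity), ← mul_pow, one_mul]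
    gcongr
    linarith

lemma exists_tail_regNorm_pow_le {η : ℝ} (hη : 0 < η) : ∃ R₀ : ℝ, ∀ R, R₀ ≤ R →
    ∑' x, {x | R ^ 2 + 1 ≤ regNorm x ^ 2}.indicator (fun x => 1 / regNorm x ^ 5) x ≤ η := by
  have h : Filter.Tendsto (fun R : ℝ => ∑' x,
      {x | R ^ 2 + 1 ≤ regNorm x ^ 2}.indicator (fun x => 1 / regNorm x ^ 5) x)
      Filter.atTop (nhds (∑' _ : (ℤ × ℤ) × ℤ, (0 : ℝ))) := by
    refine tendsto_tsum_of_dominated_convergence summable_regNorm_pow (fun x => ?_) ?_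
    · refine tendsto_const_nhds.congr' ?_
      filter_upwards [Filter.eventually_gt_atTop (regNorm x)] with R hR
      rw [Set.indicator_of_notMem]
      have := regNorm_pos x
      simp only [Set.mem_ofPred_eq, not_le]
      nlinarith
    · refine Filter.Eventually.of_forall fun R x => ?_
      refine (norm_indicator_le_norm_self _ _).trans ?_
      have := regNorm_pos x
      rw [Real.norm_of_nonneg (by positivity)]
  rw [tsum_zero] at h
  exact Filter.eventually_atTop.1 (h.eventually (eventually_le_nhds hη))

end

noncomputable section

/-! ## Pairing of the potential with the equilibrium measure -/

lemma abs_valMinAbs_intCast_le {m : ℕ} [NeZero m] (z : ℤ) :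
    ((z : ZMod m).valMinAbs).natAbs ≤ z.natAbs :=
  ZMod.natAbs_min_of_le_div_two m _ _ (ZMod.coe_valMinAbs _) (ZMod.natAbs_valMinAbs_le _)

lemma sq_le_sq_of_natAbs_le {a b : ℤ} (h : a.natAbs ≤ b.natAbs) : (a : ℝ) ^ 2 ≤ (b : ℝ) ^ 2 := by
  have := Int.natAbs_le_iff_sq_le.1 h
  exact_mod_cast this

lemma slabNorm_slabProj_lt {m : ℕ} [NeZero m] {x : (ℤ × ℤ) × ℤ} {R : ℝ} (hR : 0 ≤ R)
    (h : regNorm x ^ 2 < R ^ 2 + 1) : slabNorm (slabProj m x) < R := by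
  rw [regNorm, Real.sq_sqrt (by positivity)] at h
  have hz : (vertRep (slabProj m x) : ℝ) ^ 2 ≤ (x.2 : ℝ) ^ 2 :=
    sq_le_sq_of_natAbs_le (abs_valMinAbs_intCast_le x.2)
  rw [slabNorm, Real.sqrt_lt' (lt_of_le_of_ne hR ?_)]
  · simp only [slabProj] at hz ⊢
    linarith
  · rintro rfl
    nlinarith [sq_nonneg (x.1.1 : ℝ), sq_nonneg (x.1.2 : ℝ), sq_nonneg (x.2 : ℝ)]

/-- The total potential at the origin of the equilibrium measure of `A`. -/
def equilibriumPotential (N : ℝ) {m : ℕ} (A : Finset (Slab m)) : ℝ :=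
  ∑ a ∈ A, equilibriumMeasure N (A : Set (Slab m)) a * fibreSum m (yukawa (screening N)) a

/-- After summation by parts, the hitting probability is at most 1 and `L φ` is dominated by `25000
ρ⁻⁵`. No assumption on `A` enters, hence the upper bound of part (i) in the full range of `R`. -/
lemma exists_equilibriumPotential_le : ∃ M : ℝ, 0 < M ∧ ∀ (N : ℝ), 1 ≤ N → ∀ (m : ℕ) [NeZero m]
    (A : Finset (Slab m)), equilibriumPotential N A ≤ M := by
  refine ⟨25000 * (∑' x, 1 / regNorm x ^ 5) + 1, ?_, fun N hN m _ A => ?_⟩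
  · have : 0 ≤ ∑' x, 1 / regNorm x ^ 5 := tsum_nonneg fun x => by
      have := regNorm_pos x
      positivity
    linarith
  rw [equilibriumPotential,
    sum_equilibriumMeasure_mul_fibreSum N (summable_yukawa (screening_pos hN)) A]
  have h : ∑' x, stepOp (killRate N) cubicStep (yukawa (screening N)) x *
      hitProb N (A : Set (Slab m)) (slabProj m x) ≤ ∑' x, 25000 * (1 / regNorm x ^ 5) := by
    refine Summable.tsum_le_tsum (fun x => ?_)
      ((summable_stepOp (summable_yukawa (screening_pos hN))).mul_of_abs_le
        fun x => abs_hitProb_le_one _ _) (summable_regNorm_pow.mul_left _)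
    refine (le_abs_self _).trans ?_
    rw [abs_mul, mul_one_div]
    refine le_trans (mul_le_of_le_one_right (abs_nonneg _) (abs_hitProb_le_one _ _)) ?_
    exact abs_stepOp_yukawa_le hN x
  rw [tsum_mul_left] at h
  linarith

/-- The pairing differs from `∑ L φ` only through points where the lifted hitting probability is not
1. These have `|x| ≥ R`, because projecting to the slab does not increase the norm. One half of `η`
pays for their tail, the other for the Riemann sum. -/
lemma exists_abs_equilibriumPotential_sub_le {η : ℝ} (hη : 0 < η) :
    ∃ R₀ N₀ : ℝ, 1 ≤ R₀ ∧ 1 ≤ N₀ ∧ ∀ (N R : ℝ), N₀ ≤ N → R₀ ≤ R → ∀ (m : ℕ) [NeZero m]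
      (A : Finset (Slab m)), slabBall m R ⊆ A →
      |equilibriumPotential N A - 2 * Real.pi / 3| ≤ η := by
  obtain ⟨R₀, hR₀⟩ := exists_tail_regNorm_pow_le (η := η / 2 / 25000) (by positivity)
  have hlim : Filter.Tendsto (fun N : ℝ => killRate N * ∑' x, yukawa (screening N) x)
      Filter.atTop (nhds (2 * Real.pi / 3)) := by
    have hs : Filter.Tendsto screening Filter.atTop (nhdsWithin 0 (Set.Ioi 0)) := by
      refine tendsto_nhdsWithin_iff.2 ⟨?_, ?_⟩
      · exact tendsto_const_nhds.div_atTop Filter.tendsto_id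
      · filter_upwards [Filter.eventually_ge_atTop 1] with N hN using screening_pos hN
    have := (tendsto_sq_mul_tsum_yukawa.comp hs).const_mul (1 / 6)
    convert! this using 1
    · ext N
      simp only [Function.comp, screening_sq]
      ring
    · congr 1
      ring
  obtain ⟨N₀, hN₀⟩ := Filter.eventually_atTop.1
    (Metric.tendsto_nhds.1 hlim (η / 2) (by positivity))
  refine ⟨max R₀ 1, max N₀ 1, le_max_right _ _, le_max_right _ _, fun N R hN hR m _ A hA => ?_⟩
  have hN1 : 1 ≤ N := (le_max_right _ _).trans hN
  have hR1 : 1 ≤ R := (le_max_right _ _).trans hR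
  have h1 := hN₀ N ((le_max_left _ _).trans hN)
  have h2 := hR₀ R ((le_max_left _ _).trans hR)
  rw [Real.dist_eq] at h1
  have hφ := summable_yukawa (screening_pos hN1)
  rw [← tsum_stepOp hφ (st := cubicStep)] at h1
  set L := stepOp (killRate N) cubicStep (yukawa (screening N)) with hL
  have hLs : Summable L := summable_stepOp hφ
  set v := fun x => hitProb N (A : Set (Slab m)) (slabProj m x) with hv
  have hLv : Summable fun x => L x * v x := hLs.mul_of_abs_le fun x => abs_hitProb_le_one _ _
  have h3 : |equilibriumPotential N A - ∑' x, L x| ≤ η / 2 := by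
    rw [equilibriumPotential, sum_equilibriumMeasure_mul_fibreSum N hφ A,
      ← hLv.tsum_sub hLs, ← Real.norm_eq_abs]
    set S : Set ((ℤ × ℤ) × ℤ) := {x | R ^ 2 + 1 ≤ regNorm x ^ 2} with hS
    have hb : ∀ x, ‖L x * v x - L x‖ ≤ 25000 * S.indicator (fun x => 1 / regNorm x ^ 5) x := by
      intro x
      by_cases hx : x ∈ S
      · rw [Set.indicator_of_mem hx, mul_one_div, Real.norm_eq_abs,
          show L x * v x - L x = L x * (v x - 1) by ring, abs_mul]
        refine le_trans (mul_le_of_le_one_right (abs_nonneg _) ?_) (abs_stepOp_yukawa_le hN1 x)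
        have e1 := hitProb_nonneg (N := N) (A : Set (Slab m)) (slabProj m x)
        have e2 := hitProb_le_one (N := N) (A : Set (Slab m)) (slabProj m x)
        exact abs_le.2 ⟨by simp only [hv]; linarith, by simp only [hv]; linarith⟩
      · have hx' : regNorm x ^ 2 < R ^ 2 + 1 := not_le.1 hx
        have : v x = 1 := hitProb_of_mem (hA (slabNorm_slabProj_lt (by linarith) hx'))
        rw [this, Set.indicator_of_notMem hx]
        simp
    have hsum : Summable fun x => 25000 * S.indicator (fun x => 1 / regNorm x ^ 5) x :=
      (summable_regNorm_pow.indicator S).mul_left _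
    refine (tsum_of_norm_bounded hsum.hasSum hb).trans ?_
    rw [tsum_mul_left]
    linarith
  calc _ = |(equilibriumPotential N A - ∑' x, L x) + (∑' x, L x - 2 * Real.pi / 3)| := by
        congr 1; ring
    _ ≤ _ := (abs_add_le _ _).trans (by linarith)

lemma fibreSum_nonneg {m : ℕ} (k : ℝ) (a : Slab m) : 0 ≤ fibreSum m (yukawa k) a :=
  tsum_nonneg fun _ => yukawa_nonneg _ _

/-- Controls the contribution of interior points, whose equilibrium mass is exactly `κ = k²/6`. The
fibres over a column of radius `R` lie in the strip `|x₁| < R`. -/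
lemma exists_killRate_mul_sum_fibreSum_le {η : ℝ} (hη : 0 < η) : ∃ δ : ℝ, 0 < δ ∧
    ∀ (N R : ℝ), 1 ≤ N → 1 ≤ R → R ≤ δ * N → ∀ (m : ℕ) [NeZero m] (A : Finset (Slab m)),
      (∀ a ∈ A, horNorm a < R) →
      killRate N * ∑ a ∈ A, fibreSum m (yukawa (screening N)) a ≤ η := by
  obtain ⟨δ, hδ, h⟩ := exists_sq_mul_tsum_strip_le hη
  refine ⟨δ / √6, by positivity, fun N R hN hR hRN m _ A hA => ?_⟩
  have hk := screening_pos hN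
  have h1 := h (screening N) R hk hR (by
    rw [screening, div_mul_eq_mul_div, div_le_iff₀ (by linarith)]
    calc √6 * R ≤ √6 * (δ / √6 * N) := by gcongr
      _ = δ * N := by field_simp)
  rw [screening_sq] at h1
  classical
  set e : Slab m → ℝ := (A : Set (Slab m)).indicator 1 with he
  have h2 := tsum_mul_comp_slabProj (summable_yukawa hk) A (e := e) fun a ha => by
    simp [he, ha]
  have h3 : ∑ a ∈ A, e a * fibreSum m (yukawa (screening N)) a =
      ∑ a ∈ A, fibreSum m (yukawa (screening N)) a :=
    Finset.sum_congr rfl fun a ha => by simp [he, ha]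
  rw [← h3, ← h2]
  have hk0 := killRate_nonneg N
  have h4 : ∑' x, yukawa (screening N) x * e (slabProj m x) ≤
      ∑' x, {x : (ℤ × ℤ) × ℤ | |(x.1.1 : ℝ)| < R}.indicator (yukawa (screening N)) x := by
    refine Summable.tsum_le_tsum (fun x => ?_)
      ((summable_yukawa hk).mul_of_abs_le (M := 1) fun x => ?_) ((summable_yukawa hk).indicator _)
    · by_cases hx : slabProj m x ∈ A
      · have h5 := hA _ hx
        have h6 : |(x.1.1 : ℝ)| < R := by
          refine lt_of_le_of_lt (Real.abs_le_sqrt ?_) h5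
          simp only [slabProj]
          nlinarith [sq_nonneg (x.1.2 : ℝ)]
        rw [Set.indicator_of_mem (by exact h6)]
        simp [he, hx]
      · simp only [he, Set.indicator_of_notMem (show slabProj m x ∉ (A : Set (Slab m)) from hx),
          mul_zero]
        exact Set.indicator_nonneg (fun x _ => yukawa_nonneg _ x) x
    · by_cases hx : slabProj m x ∈ A <;> simp [he, hx]
  have h5 : 0 ≤ ∑' x, {x : (ℤ × ℤ) × ℤ | |(x.1.1 : ℝ)| < R}.indicator (yukawa (screening N)) x :=
    tsum_nonneg fun x => Set.indicator_nonneg (fun x _ => yukawa_nonneg _ x) x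
  nlinarith [mul_le_mul_of_nonneg_left h4 hk0, mul_nonneg hk0 h5]

end

noncomputable section

/-! ## The Bessel function `K₀` -/

lemma self_le_cosh (r : ℝ) : r ≤ Real.cosh r := by
  rcases le_or_gt 0 r with h | h
  · exact (Real.self_le_sinh_iff.2 h).trans (Real.sinh_lt_cosh r).le
  · exact h.le.trans (Real.cosh_pos r).le

lemma integrableOn_exp_neg_mul_cosh {t : ℝ} (ht : 0 < t) (a : ℝ) :
    IntegrableOn (fun r => Real.exp (-t * Real.cosh r)) (Set.Ioi a) := by
  refine (exp_neg_integrableOn_Ioi a ht).mono' (by fun_prop) ?_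
  refine Filter.Eventually.of_forall fun r => ?_
  rw [Real.norm_of_nonneg (Real.exp_pos _).le]
  refine Real.exp_le_exp.2 ?_
  nlinarith [self_le_cosh r]

lemma besselKZero_pos {t : ℝ} (ht : 0 < t) : 0 < besselKZero t := by
  refine (setIntegral_pos_iff_support_of_nonneg_ae
    (Filter.Eventually.of_forall fun r => (Real.exp_pos _).le)
    (integrableOn_exp_neg_mul_cosh ht 0)).2 ?_
  have : Function.support (fun r => Real.exp (-t * Real.cosh r)) = Set.univ :=
    Set.eq_univ_of_forall fun r => (Real.exp_pos _).ne'
  rw [this, Set.univ_inter, Real.volume_Ioi]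
  exact ENNReal.zero_lt_top

lemma besselKZero_anti {s t : ℝ} (hs : 0 < s) (h : s ≤ t) : besselKZero t ≤ besselKZero s := by
  refine integral_mono (integrableOn_exp_neg_mul_cosh (hs.trans_le h) 0)
    (integrableOn_exp_neg_mul_cosh hs 0) fun r => Real.exp_le_exp.2 ?_
  nlinarith [Real.cosh_pos r]

/-- With `e^L = 2c` one has `c cosh r ≤ cosh (r + L)`. A shift by `L` thus bounds `K₀(cs)` below by
the integral for `K₀(s)` over `(L, ∞)`; the missing piece over `(0, L]` is at most `L`. -/
lemma besselKZero_sub_log_le {c s : ℝ} (hc : 1 ≤ c) (hs : 0 < s) :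
    besselKZero s - Real.log (2 * c) ≤ besselKZero (c * s) := by
  set L := Real.log (2 * c) with hL
  have hL0 : 0 ≤ L := Real.log_nonneg (by linarith)
  have heL : Real.exp L = 2 * c := Real.exp_log (by linarith)
  have hcs : 0 < c * s := by positivity
  have h1 : ∫ r in Set.Ioi (0 : ℝ), Real.exp (-s * Real.cosh (r + L)) ≤ besselKZero (c * s) := by
    refine setIntegral_mono_on ?_ (integrableOn_exp_neg_mul_cosh hcs 0) measurableSet_Ioi
      fun r hr => Real.exp_le_exp.2 ?_
    · refine (exp_neg_integrableOn_Ioi 0 hs).mono' (by fun_prop)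
        (Filter.Eventually.of_forall fun r => ?_)
      rw [Real.norm_of_nonneg (Real.exp_pos _).le]
      refine Real.exp_le_exp.2 ?_
      nlinarith [self_le_cosh (r + L)]
    · have hr : 0 < r := hr
      have h2 : c * Real.cosh r ≤ Real.cosh (r + L) := by
        rw [Real.cosh_eq, Real.cosh_eq, Real.exp_add, heL]
        have e1 : Real.exp (-r) ≤ Real.exp r := Real.exp_le_exp.2 (by linarith)
        have e2 := (Real.exp_pos (-(r + L))).le
        nlinarith
      nlinarith
  have h3 : ∫ r in Set.Ioi (0 : ℝ), Real.exp (-s * Real.cosh (r + L)) =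
      ∫ r in Set.Ioi L, Real.exp (-s * Real.cosh r) := by
    have := (measurePreserving_add_right volume L).setIntegral_preimage_emb
      (measurableEmbedding_addRight L) (fun r => Real.exp (-s * Real.cosh r)) (Set.Ioi L)
    simpa using this
  have h4 : besselKZero s = (∫ r in Set.Ioc 0 L, Real.exp (-s * Real.cosh r)) +
      ∫ r in Set.Ioi L, Real.exp (-s * Real.cosh r) := by
    rw [besselKZero, ← Set.Ioc_union_Ioi_eq_Ioi hL0]
    exact setIntegral_union (Set.Ioc_disjoint_Ioi le_rfl) measurableSet_Ioi
      ((integrableOn_exp_neg_mul_cosh hs 0).mono_set Set.Ioc_subset_Ioi_self)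
      (integrableOn_exp_neg_mul_cosh hs L)
  have h5 : ∫ r in Set.Ioc 0 L, Real.exp (-s * Real.cosh r) ≤ ∫ r in Set.Ioc 0 L, (1 : ℝ) := by
    refine integral_mono ((integrableOn_exp_neg_mul_cosh hs 0).mono_set Set.Ioc_subset_Ioi_self)
      (integrable_const _) fun r => Real.exp_le_one_iff.2 ?_
    have := Real.cosh_pos r
    nlinarith
  have h6 : ∫ r in Set.Ioc 0 L, (1 : ℝ) = L := by simp [hL0]
  linarith

lemma exists_le_besselKZero (M : ℝ) : ∃ t₀ : ℝ, 0 < t₀ ∧ ∀ t, 0 < t → t ≤ t₀ →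
    M ≤ besselKZero t := by
  set M' := max M 1 with hM'
  have hM0 : 0 < M' := lt_of_lt_of_le one_pos (le_max_right _ _)
  have hc := Real.cosh_pos (2 * M')
  -- For such `t` the integrand is at least `1/2` on `(0, 2M']`.
  refine ⟨(2 * Real.cosh (2 * M'))⁻¹, by positivity, fun t ht htt => (le_max_left M 1).trans ?_⟩
  have htc : t * Real.cosh (2 * M') ≤ 1 / 2 := by
    calc t * Real.cosh (2 * M') ≤ (2 * Real.cosh (2 * M'))⁻¹ * Real.cosh (2 * M') := by gcongr
      _ = 1 / 2 := by field_simp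
  have h1 : ∫ r in Set.Ioc 0 (2 * M'), (1 / 2 : ℝ) ≤
      ∫ r in Set.Ioc 0 (2 * M'), Real.exp (-t * Real.cosh r) := by
    refine setIntegral_mono_on (integrable_const _) ((integrableOn_exp_neg_mul_cosh ht 0).mono_set
      Set.Ioc_subset_Ioi_self) measurableSet_Ioc fun r hr => ?_
    have h2 : Real.cosh r ≤ Real.cosh (2 * M') :=
      Real.cosh_le_cosh.2 (by rw [abs_of_pos hr.1, abs_of_pos (by positivity)]; exact hr.2)
    have h3 := Real.add_one_le_exp (-t * Real.cosh r)
    nlinarith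
  have h4 : ∫ r in Set.Ioc 0 (2 * M'), Real.exp (-t * Real.cosh r) ≤ besselKZero t :=
    setIntegral_mono_set (integrableOn_exp_neg_mul_cosh ht 0)
      (Filter.Eventually.of_forall fun r => (Real.exp_pos _).le)
      Set.Ioc_subset_Ioi_self.eventuallyLE
  have h5 : ∫ r in Set.Ioc 0 (2 * M'), (1 / 2 : ℝ) = M' := by
    simp [hM0.le]
    ring
  linarith

lemma exists_mul_besselKZero_le {c C : ℝ} (hc : 1 ≤ c) (hC : 0 < C) : ∃ b : ℝ, 0 < b ∧
    ∀ t, 0 < t → t ≤ C → b * besselKZero t ≤ besselKZero (c * t) := by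
  set L := Real.log (2 * c) with hL
  have hL0 : 0 < L := Real.log_pos (by linarith)
  have hK := besselKZero_pos (show 0 < c * C by positivity)
  refine ⟨min (1 / 2) (besselKZero (c * C) / (2 * L)), lt_min (by norm_num) (by positivity),
    fun t ht htC => ?_⟩
  have h0 := besselKZero_pos ht
  -- If `K₀(t) ≥ 2L`, the additive loss `L` is at most half of it; otherwise `K₀(t)` is bounded, and
  -- `K₀(ct) ≥ K₀(cC)` suffices.
  rcases le_total (2 * L) (besselKZero t) with h | h
  · have := besselKZero_sub_log_le hc ht
    calc _ ≤ 1 / 2 * besselKZero t := by gcongr; exact min_le_left _ _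
      _ ≤ _ := by linarith
  · calc _ ≤ besselKZero (c * C) / (2 * L) * (2 * L) :=
          mul_le_mul (min_le_right _ _) h h0.le (by positivity)
      _ = besselKZero (c * C) := by field_simp
      _ ≤ _ := besselKZero_anti (by positivity) (by gcongr)

/-! ## Sums of the screened potential along a line -/

lemma screened_sqrt_anti {k s a b : ℝ} (hk : 0 ≤ k) (hs : 0 < s) (h : a ^ 2 ≤ b ^ 2) :
    screened k √(s ^ 2 + b ^ 2) ≤ screened k √(s ^ 2 + a ^ 2) :=
  screened_anti hk (Real.sqrt_pos.2 (by positivity)) (Real.sqrt_le_sqrt (by linarith))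

lemma continuous_screened_sqrt (k : ℝ) {s : ℝ} (hs : 0 < s) :
    Continuous fun ζ : ℝ => screened k √(s ^ 2 + ζ ^ 2) := by
  unfold screened
  refine Continuous.div (by fun_prop) (by fun_prop) fun ζ => ?_
  exact (Real.sqrt_pos.2 (by positivity)).ne'

lemma screened_sqrt_le_div (k s ζ : ℝ) (hk : 0 ≤ k) (hs : 0 < s) :
    screened k √(s ^ 2 + ζ ^ 2) ≤ 1 / s := by
  have h1 : s ≤ √(s ^ 2 + ζ ^ 2) := Real.le_sqrt_of_sq_le (by nlinarith [sq_nonneg ζ])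
  refine (screened_anti hk hs h1).trans ?_
  exact div_le_div_of_nonneg_right (Real.exp_le_one_iff.2 (by nlinarith)) hs.le

lemma integrableOn_screened_sqrt {k s : ℝ} (hk : 0 < k) (hs : 0 < s) :
    IntegrableOn (fun ζ => screened k √(s ^ 2 + ζ ^ 2)) (Set.Ioi 0) := by
  refine ((exp_neg_integrableOn_Ioi 0 hk).div_const s).mono'
    (continuous_screened_sqrt k hs).aestronglyMeasurable.restrict ?_
  filter_upwards [ae_restrict_mem measurableSet_Ioi] with ζ hζ
  have hζ : 0 < ζ := hζ
  rw [Real.norm_of_nonneg (screened_nonneg _ (Real.sqrt_nonneg _))]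
  have h1 : s ≤ √(s ^ 2 + ζ ^ 2) := Real.le_sqrt_of_sq_le (by nlinarith)
  have h2 : ζ ≤ √(s ^ 2 + ζ ^ 2) := Real.le_sqrt_of_sq_le (by nlinarith)
  refine div_le_div₀ (Real.exp_pos _).le (Real.exp_le_exp.2 ?_) hs h1
  nlinarith

/-- Substitute `ζ = s sinh r`. A three-dimensional screened potential integrated along a line is the
two-dimensional one; this is how `K₀` enters. -/
lemma integral_screened_sqrt {k s : ℝ} (hk : 0 < k) (hs : 0 < s) :
    ∫ ζ in Set.Ioi (0 : ℝ), screened k √(s ^ 2 + ζ ^ 2) = besselKZero (k * s) := by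
  have hd : ∀ r : ℝ, HasDerivAt (fun r => s * Real.sinh r) (s * Real.cosh r) r :=
    fun r => (Real.hasDerivAt_sinh r).const_mul s
  have hsq : ∀ r : ℝ, √(s ^ 2 + (s * Real.sinh r) ^ 2) = s * Real.cosh r := by
    intro r
    have : s ^ 2 + (s * Real.sinh r) ^ 2 = (s * Real.cosh r) ^ 2 := by
      rw [mul_pow, mul_pow, Real.cosh_sq]; ring
    rw [this, Real.sqrt_sq (by have := Real.cosh_pos r; positivity)]
  have hg : ∀ r : ℝ, ((fun ζ => screened k √(s ^ 2 + ζ ^ 2)) ∘ fun r => s * Real.sinh r) r *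
      (s * Real.cosh r) = Real.exp (-(k * s) * Real.cosh r) := by
    intro r
    have := Real.cosh_pos r
    simp only [Function.comp, hsq, screened]
    rw [show -(k * (s * Real.cosh r)) = -(k * s) * Real.cosh r by ring]
    field_simp
  have hmaps : ∀ r ∈ Set.Ici (0 : ℝ), s * Real.sinh r ∈ Set.Ici (0 : ℝ) := fun r hr =>
    mul_nonneg hs.le (Real.sinh_nonneg_iff.2 hr)
  have h := integral_comp_mul_deriv_Ioi (f := fun r => s * Real.sinh r)
    (f' := fun r => s * Real.cosh r) (g := fun ζ => screened k √(s ^ 2 + ζ ^ 2)) (a := 0)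
    (by fun_prop)
    (Filter.tendsto_atTop_mono' _ (f₁ := fun r => s * r)
      (by
        filter_upwards [Filter.eventually_ge_atTop 0] with r hr
        exact mul_le_mul_of_nonneg_left (Real.self_le_sinh_iff.2 hr) hs.le)
      (Filter.tendsto_id.const_mul_atTop hs))
    (fun r _ => (hd r).hasDerivWithinAt) (continuous_screened_sqrt k hs).continuousOn
    (((integrableOn_Ici_iff_integrableOn_Ioi (by simp)).2 (integrableOn_screened_sqrt hk hs)).mono_set
      (by rintro _ ⟨r, hr, rfl⟩; exact hmaps r hr))
    (by
      simp only [hg]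
      exact (integrableOn_Ici_iff_integrableOn_Ioi (by simp)).2
        (integrableOn_exp_neg_mul_cosh (by positivity) 0))
  simp only [hg, Real.sinh_zero, mul_zero] at h
  exact h.symm

section LineSum

variable {k s b : ℝ}

lemma antitoneOn_lineScreened (hk : 0 < k) (hs : 0 < s) (hb : 0 < b) :
    AntitoneOn (fun x : ℝ => screened k √(s ^ 2 + (b * x) ^ 2)) (Set.Ici 0) := by
  intro x hx y _ hxy
  have hx : 0 ≤ x := hx
  refine screened_sqrt_anti hk.le hs ?_
  gcongr

lemma lineScreened_nonneg (k s x : ℝ) : 0 ≤ screened k √(s ^ 2 + x ^ 2) :=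
  screened_nonneg _ (Real.sqrt_nonneg _)

lemma integrableOn_lineScreened (hk : 0 < k) (hs : 0 < s) (hb : 0 < b) :
    IntegrableOn (fun x : ℝ => screened k √(s ^ 2 + (b * x) ^ 2)) (Set.Ioi 0) := by
  have := (integrableOn_Ioi_comp_mul_left_iff (fun ζ => screened k √(s ^ 2 + ζ ^ 2)) 0 hb).2
    (by simpa using integrableOn_screened_sqrt hk hs)
  exact this

lemma integral_lineScreened (hk : 0 < k) (hs : 0 < s) (hb : 0 < b) :
    ∫ x in Set.Ioi (0 : ℝ), screened k √(s ^ 2 + (b * x) ^ 2) = besselKZero (k * s) / b := by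
  have := integral_comp_mul_left_Ioi (fun ζ => screened k √(s ^ 2 + ζ ^ 2)) 0 hb
  rw [mul_zero, integral_screened_sqrt hk hs, smul_eq_mul] at this
  rw [this]
  ring

lemma summable_lineScreened (hk : 0 < k) (hs : 0 < s) (hb : 0 < b) :
    Summable fun n : ℕ => screened k √(s ^ 2 + (b * n) ^ 2) :=
  (antitoneOn_lineScreened hk hs hb).summable_of_integrableOn_Ioi_zero
    (integrableOn_lineScreened hk hs hb) fun _ _ => lineScreened_nonneg _ _ _

lemma tsum_succ_lineScreened_le (hk : 0 < k) (hs : 0 < s) (hb : 0 < b) :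
    ∑' n : ℕ, screened k √(s ^ 2 + (b * (n + 1)) ^ 2) ≤ besselKZero (k * s) / b := by
  rw [← integral_lineScreened hk hs hb]
  have := (antitoneOn_lineScreened hk hs hb).tsum_add_one_le_integral
    (integrableOn_lineScreened hk hs hb) fun _ _ => lineScreened_nonneg _ _ _
  exact_mod_cast this

lemma le_tsum_lineScreened (hk : 0 < k) (hs : 0 < s) (hb : 0 < b) :
    besselKZero (k * s) / b ≤ ∑' n : ℕ, screened k √(s ^ 2 + (b * n) ^ 2) := by
  rw [← integral_lineScreened hk hs hb]
  exact (antitoneOn_lineScreened hk hs hb).integral_le_tsum (summable_lineScreened hk hs hb)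
    fun _ _ => lineScreened_nonneg _ _ _

lemma summable_lineScreened_add_two (hk : 0 < k) (hs : 0 < s) (hb : 0 < b) :
    Summable fun n : ℕ => screened k √(s ^ 2 + (b * (n + 2)) ^ 2) := by
  have := (summable_nat_add_iff 2).2 (summable_lineScreened hk hs hb)
  exact_mod_cast this

/-- Each of the two omitted terms is at most `1/s ≤ 1/b`. The offset 2 appears because the copies
numbered `±(n + 1)` of a point have height at most `m(n + 2)`. -/
lemma le_tsum_lineScreened_add_two (hk : 0 < k) (hb : 0 < b) (hsb : b ≤ s) :
    (besselKZero (k * s) - 2) / b ≤ ∑' n : ℕ, screened k √(s ^ 2 + (b * (n + 2)) ^ 2) := by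
  have hs : 0 < s := hb.trans_le hsb
  have h1 := (summable_lineScreened hk hs hb).sum_add_tsum_nat_add 2
  have h2 := le_tsum_lineScreened hk hs hb
  rw [← h1, Finset.sum_range_succ, Finset.sum_range_one] at h2
  have e0 := screened_sqrt_le_div k s (b * (0 : ℕ)) hk.le hs
  have e1 := screened_sqrt_le_div k s (b * (1 : ℕ)) hk.le hs
  have e2 : 1 / s ≤ 1 / b := one_div_le_one_div_of_le hb hsb
  rw [sub_div]
  have e3 : 2 / b = 1 / b + 1 / b := by ring
  push_cast at h2 e0 e1
  linarith

/-- Multiplicative version, still informative when `K₀` is small, that is, for `R` of order `N`. By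
`(n + 2)² ≤ 2(n² + 4)` the offset is absorbed into `s'` at the cost of a factor `√2` in the
distance. -/
lemma le_tsum_lineScreened_add_two' (hk : 0 < k) (hb : 0 < b) (hsb : b ≤ s) :
    besselKZero (4 * (k * s)) / (2 * b) ≤
      ∑' n : ℕ, screened k √(s ^ 2 + (b * (n + 2)) ^ 2) := by
  have hs : 0 < s := hb.trans_le hsb
  set s' := √(s ^ 2 + 4 * b ^ 2) with hs'
  have hs0 : 0 < s' := Real.sqrt_pos.2 (by positivity)
  have hs2 : s' ^ 2 = s ^ 2 + 4 * b ^ 2 := Real.sq_sqrt (by positivity)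
  have h2 : 0 < √2 := by positivity
  have hk' : 0 < √2 * k := by positivity
  have hterm : ∀ n : ℕ, 1 / √2 * screened (√2 * k) √(s' ^ 2 + (b * n) ^ 2) ≤
      screened k √(s ^ 2 + (b * (n + 2)) ^ 2) := by
    intro n
    have h3 : √(s ^ 2 + (b * (n + 2)) ^ 2) ≤ √2 * √(s' ^ 2 + (b * n) ^ 2) := by
      rw [← Real.sqrt_mul (by norm_num)]
      refine Real.sqrt_le_sqrt ?_
      rw [hs2]
      nlinarith [sq_nonneg (b * n - b * 2), sq_nonneg s]
    refine le_trans (le_of_eq ?_) (screened_anti hk.le (Real.sqrt_pos.2 (by positivity)) h3)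
    unfold screened
    rw [show k * (√2 * √(s' ^ 2 + (b * n) ^ 2)) = √2 * k * √(s' ^ 2 + (b * n) ^ 2) by ring]
    field_simp
  have h4 := Summable.tsum_le_tsum hterm ((summable_lineScreened hk' hs0 hb).mul_left _)
    (summable_lineScreened_add_two hk hs hb)
  rw [tsum_mul_left] at h4
  refine le_trans ?_ h4
  have h5 := le_tsum_lineScreened hk' hs0 hb
  have h6 : √2 * k * s' ≤ 4 * (k * s) := by
    have : √2 * s' ≤ 4 * s := by
      rw [hs', ← Real.sqrt_mul (by norm_num)]
      refine Real.sqrt_le_iff.2 ⟨by positivity, by nlinarith⟩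
    nlinarith
  have h7 := besselKZero_anti (by positivity) h6
  have h8 : 1 / 2 ≤ 1 / √2 :=
    one_div_le_one_div_of_le h2 (Real.sqrt_le_iff.2 ⟨by norm_num, by norm_num⟩)
  have h9 := besselKZero_pos (show 0 < 4 * (k * s) by positivity)
  calc besselKZero (4 * (k * s)) / (2 * b) = 1 / 2 * (besselKZero (4 * (k * s)) / b) := by
        field_simp
    _ ≤ 1 / √2 * (besselKZero (√2 * k * s') / b) := by gcongr
    _ ≤ _ := by gcongr

end LineSum

/-! ## Bounds on the fibre sums -/

section FibreSum

lemma hasSum_succ_add_neg_succ {F : ℤ → ℝ} (hF : Summable F) :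
    HasSum (fun n : ℕ => F (n + 1) + F (-(n + 1))) (∑' j, F j - F 0) := by
  have h1 : Summable fun n : ℕ => F n := hF.comp_injective Nat.cast_injective
  have h2 : Summable fun n : ℕ => F (-((n : ℤ) + 1)) :=
    hF.comp_injective (i := fun n : ℕ => -((n : ℤ) + 1)) fun i j hij => by simpa using hij
  have h4 : Summable fun n : ℕ => F ((n : ℤ) + 1) := by
    have := (summable_nat_add_iff 1).2 h1
    exact_mod_cast this
  have h5 := h1.tsum_eq_zero_add
  push_cast at h5
  have h6 := (h4.add h2).hasSum
  rw [h4.tsum_add h2] at h6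
  rw [tsum_of_nat_of_neg_add_one h1 h2, h5]
  convert! h6 using 1
  ring

variable {m : ℕ}

lemma abs_vertRep_le [NeZero m] (a : Slab m) : |(vertRep a : ℝ)| ≤ m / 2 := by
  have h := ZMod.natAbs_valMinAbs_le a.2
  have h2 : (a.2.valMinAbs.natAbs : ℝ) ≤ ((m / 2 : ℕ) : ℝ) := by exact_mod_cast h
  have h3 : ((m / 2 : ℕ) : ℝ) ≤ (m : ℝ) / 2 := Nat.cast_div_le
  have h4 : |(vertRep a : ℝ)| = (a.2.valMinAbs.natAbs : ℝ) := by
    rw [vertRep, ← Int.cast_abs, Int.abs_eq_natAbs, Int.cast_natCast]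
  linarith

lemma yukawa_fibre (k : ℝ) (a : Slab m) (j : ℤ) : yukawa k (a.1, vertRep a + m * j) =
    screened k √(√(horNorm a ^ 2 + 1) ^ 2 + ((vertRep a : ℝ) + m * j) ^ 2) := by
  have h : horNorm a ^ 2 = (a.1.1 : ℝ) ^ 2 + (a.1.2 : ℝ) ^ 2 := Real.sq_sqrt (by positivity)
  rw [Real.sq_sqrt (by positivity), h, yukawa, regNorm]
  push_cast
  congr 2
  ring

variable [NeZero m]

lemma summable_fibre {k : ℝ} (hk : 0 < k) (a : Slab m) :
    Summable fun j : ℤ => yukawa k (a.1, vertRep a + m * j) := by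
  refine (summable_yukawa hk).comp_injective (i := fun j : ℤ => (a.1, vertRep a + m * j)) ?_
  intro i j hij
  simpa [NeZero.ne m] using hij

lemma hasSum_fibre {k : ℝ} (hk : 0 < k) (a : Slab m) : HasSum (fun n : ℕ =>
      yukawa k (a.1, vertRep a + m * (n + 1)) + yukawa k (a.1, vertRep a + m * (-(n + 1))))
      (fibreSum m (yukawa k) a - yukawa k (a.1, vertRep a)) := by
  have h := hasSum_succ_add_neg_succ (summable_fibre hk a)
  rw [mul_zero, add_zero] at h
  exact h

lemma fibreSum_le {N : ℝ} (hN : 1 ≤ N) (a : Slab m) {M : ℝ} (hM : 0 < M)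
    (hMa : M ≤ max (horNorm a) m) : fibreSum m (yukawa (screening N)) a ≤
      1 / √(slabNorm a ^ 2 + 1) + 4 / m + 2 * besselKZero (M / N) / m := by
  have hm : (0 : ℝ) < m := Nat.cast_pos.2 (NeZero.pos m)
  have hk := screening_pos hN
  set k := screening N with hkd
  set s := √(horNorm a ^ 2 + 1) with hs
  have hs0 : 0 < s := Real.sqrt_pos.2 (by positivity)
  have hs2 : s ^ 2 = horNorm a ^ 2 + 1 := Real.sq_sqrt (by positivity)
  set z : ℝ := (vertRep a : ℝ) with hz
  have hzm := abs_le.1 (abs_vertRep_le a)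
  have h0 : yukawa k (a.1, vertRep a) ≤ 1 / √(slabNorm a ^ 2 + 1) := by
    have : regNorm (a.1, vertRep a) = √(slabNorm a ^ 2 + 1) := by
      rw [slabNorm, Real.sq_sqrt (by positivity)]; rfl
    rw [yukawa, this]
    exact div_le_div_of_nonneg_right (Real.exp_le_one_iff.2
      (by have := Real.sqrt_nonneg (slabNorm a ^ 2 + 1); nlinarith)) (Real.sqrt_nonneg _)
  -- Since `(n + 3/2)² ≥ (n + 1)² + 1/4`, the copies with `|j| ≥ 2` are bounded by a line sum at
  -- distance `s'` instead of `s`. This keeps the argument of `K₀` above `m/N` even when `horNorm a`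
  -- is small. The copies `j = ±1` are bounded by `2/m` each.
  set s' := √(s ^ 2 + m ^ 2 / 4) with hs'
  have hs'0 : 0 < s' := Real.sqrt_pos.2 (by positivity)
  have hs'2 : s' ^ 2 = s ^ 2 + m ^ 2 / 4 := Real.sq_sqrt (by positivity)
  have hsum := hasSum_fibre hk a
  have hterm : ∀ n : ℕ, yukawa k (a.1, vertRep a + m * (n + 1)) +
      yukawa k (a.1, vertRep a + m * (-(n + 1))) ≤
      2 * screened k √(s ^ 2 + (m * (n + 1 / 2)) ^ 2) := by
    intro n
    have y1 := yukawa_fibre k a (n + 1)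
    have y2 := yukawa_fibre k a (-(n + 1))
    rw [y1, y2]
    push_cast
    rw [← hs, ← hz]
    have hn : (0 : ℝ) ≤ m * n := by positivity
    have e1 := screened_sqrt_anti hk.le hs0 (a := m * (n + 1 / 2)) (b := z + m * (n + 1))
      (by apply pow_le_pow_left₀ (by positivity); linarith)
    have e2 := screened_sqrt_anti hk.le hs0 (a := m * (n + 1 / 2)) (b := z + m * (-(n + 1)))
      (by rw [← neg_sq (z + _)]; apply pow_le_pow_left₀ (by positivity); linarith)
    rw [show (-((n : ℝ) + 1)) = (-1 + -(n : ℝ)) by ring] at *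
    linarith
  have hterm' : ∀ n : ℕ, yukawa k (a.1, vertRep a + m * ((n + 1 : ℕ) + 1)) +
      yukawa k (a.1, vertRep a + m * (-((n + 1 : ℕ) + 1))) ≤
      2 * screened k √(s' ^ 2 + (m * (n + 1)) ^ 2) := by
    intro n
    refine (hterm (n + 1)).trans ?_
    refine mul_le_mul_of_nonneg_left ?_ zero_le_two
    refine screened_anti hk.le (Real.sqrt_pos.2 (by positivity)) (Real.sqrt_le_sqrt ?_)
    rw [hs'2]
    push_cast
    have hn : (0 : ℝ) ≤ n := by positivity
    nlinarith [sq_nonneg (m : ℝ), mul_nonneg hn (sq_nonneg (m : ℝ))]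
  have hsplit := hsum.summable.tsum_eq_zero_add
  rw [hsum.tsum_eq] at hsplit
  have hfirst := hterm 0
  have hfirst2 : screened k √(s ^ 2 + (m * ((0 : ℕ) + 1 / 2)) ^ 2) ≤ 2 / m := by
    rw [add_comm]
    refine (screened_sqrt_le_div k _ s hk.le (by push_cast; positivity)).trans (le_of_eq ?_)
    push_cast
    field_simp
    ring
  have hsl : Summable fun n : ℕ => 2 * screened k √(s' ^ 2 + (m * (n + 1)) ^ 2) := by
    have := (summable_nat_add_iff 1).2 (summable_lineScreened hk hs'0 hm)
    push_cast at this
    exact this.mul_left 2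
  have hrest := Summable.tsum_le_tsum hterm' ((summable_nat_add_iff 1).2 hsum.summable) hsl
  rw [tsum_mul_left] at hrest
  have hline := tsum_succ_lineScreened_le hk hs'0 hm
  have hK : besselKZero (k * s') ≤ besselKZero (M / N) := by
    refine besselKZero_anti (by positivity) ?_
    rw [hkd, screening, div_mul_eq_mul_div]
    refine div_le_div_of_nonneg_right ?_ (by linarith)
    rw [hs', ← Real.sqrt_mul (by norm_num)]
    refine Real.le_sqrt_of_sq_le ?_
    rw [hs2]
    have hh : 0 ≤ horNorm a := Real.sqrt_nonneg _
    rcases le_max_iff.1 hMa with h | h <;> nlinarith [sq_nonneg (m : ℝ), sq_nonneg (horNorm a)]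
  have hK2 : besselKZero (k * s') / m ≤ besselKZero (M / N) / m := by gcongr
  have r1 : 2 * besselKZero (M / N) / m = 2 * (besselKZero (M / N) / m) := by ring
  have r2 : 4 / (m : ℝ) = 2 * (2 / m) := by ring
  have f1 := hfirst.trans (mul_le_mul_of_nonneg_left hfirst2 zero_le_two)
  have f2 := hrest.trans (mul_le_mul_of_nonneg_left (hline.trans hK2) zero_le_two)
  have f3 := add_le_add h0 (add_le_add f1 f2)
  rw [← hsplit, add_sub_cancel] at f3
  rw [r1, r2, add_assoc]
  exact f3

/-- Comparison of a fibre sum with a sum along a line at larger distance. -/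
lemma le_fibreSum_aux {N : ℝ} (hN : 1 ≤ N) (a : Slab m) {M : ℝ} (hM : max (horNorm a) m ≤ M) :
    yukawa (screening N) (a.1, vertRep a) +
      2 * ∑' n : ℕ, screened (screening N) √((2 * M) ^ 2 + (m * (n + 2)) ^ 2) ≤
    fibreSum m (yukawa (screening N)) a := by
  have hm : (0 : ℝ) < m := Nat.cast_pos.2 (NeZero.pos m)
  have hm1 : (1 : ℝ) ≤ m := Nat.one_le_cast.2 (NeZero.pos m)
  have hMm : (m : ℝ) ≤ M := (le_max_right _ _).trans hM
  have hMh : horNorm a ≤ M := (le_max_left _ _).trans hM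
  have hh : 0 ≤ horNorm a := Real.sqrt_nonneg _
  have hk := screening_pos hN
  set k := screening N with hkd
  have hs0 : 0 < 2 * M := by linarith
  set z : ℝ := (vertRep a : ℝ) with hz
  have hzm := abs_le.1 (abs_vertRep_le a)
  have hsum := hasSum_fibre hk a
  have hterm : ∀ n : ℕ, 2 * screened k √((2 * M) ^ 2 + (m * (n + 2)) ^ 2) ≤
      yukawa k (a.1, vertRep a + m * (n + 1)) + yukawa k (a.1, vertRep a + m * (-(n + 1))) := by
    intro n
    have y1 := yukawa_fibre k a (n + 1)
    have y2 := yukawa_fibre k a (-(n + 1))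
    rw [y1, y2]
    push_cast
    rw [← hz, Real.sq_sqrt (by positivity)]
    have hn : (0 : ℝ) ≤ m * n := by positivity
    -- The factor 2 absorbs the regularizing 1, as `M ≥ m ≥ 1`.
    have e0 : horNorm a ^ 2 + 1 ≤ (2 * M) ^ 2 := by nlinarith
    have e1 : (z + m * (n + 1)) ^ 2 ≤ (m * (n + 2)) ^ 2 := by
      refine sq_le_sq' ?_ ?_ <;> linarith
    have e2 : (z + m * (-1 + -n)) ^ 2 ≤ (m * (n + 2)) ^ 2 := by
      refine sq_le_sq' ?_ ?_ <;> linarith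
    have f1 := screened_anti (k := k) hk.le (Real.sqrt_pos.2 (by positivity :
      0 < horNorm a ^ 2 + 1 + (z + m * (n + 1)) ^ 2)) (Real.sqrt_le_sqrt (add_le_add e0 e1))
    have f2 := screened_anti (k := k) hk.le (Real.sqrt_pos.2 (by positivity :
      0 < horNorm a ^ 2 + 1 + (z + m * (-1 + -n)) ^ 2)) (Real.sqrt_le_sqrt (add_le_add e0 e2))
    rw [show (-((n : ℝ) + 1)) = (-1 + -(n : ℝ)) by ring]
    linarith
  have h := Summable.tsum_le_tsum hterm ((summable_lineScreened_add_two hk hs0 hm).mul_left 2)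
    hsum.summable
  rw [tsum_mul_left, hsum.tsum_eq] at h
  linarith

lemma le_fibreSum {N : ℝ} (hN : 1 ≤ N) (a : Slab m) {M : ℝ} (hM : max (horNorm a) m ≤ M) :
    yukawa (screening N) (a.1, vertRep a) + 2 * (besselKZero (M / N) - 5) / m ≤
      fibreSum m (yukawa (screening N)) a := by
  have hm : (0 : ℝ) < m := Nat.cast_pos.2 (NeZero.pos m)
  have hMm : (m : ℝ) ≤ M := (le_max_right _ _).trans hM
  have hk := screening_pos hN
  have h1 := le_tsum_lineScreened_add_two hk hm (show (m : ℝ) ≤ 2 * M by linarith)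
  have h2 := le_fibreSum_aux hN a hM
  have hMN : 0 < M / N := by have := hm.trans_le hMm; positivity
  -- `c = 5` because `k · 2M = 2√6 · M/N ≤ 5M/N`. The final 5 is `2 + 3`: the two omitted terms and
  -- `log 10 ≤ 3`.
  have h3 := besselKZero_sub_log_le (c := 5) (by norm_num) hMN
  have h4 : besselKZero (5 * (M / N)) ≤ besselKZero (screening N * (2 * M)) := by
    refine besselKZero_anti (by have := hm.trans_le hMm; positivity) ?_
    have h6 : √6 ≤ 5 / 2 := Real.sqrt_le_iff.2 ⟨by norm_num, by norm_num⟩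
    rw [screening, div_mul_eq_mul_div, mul_div_assoc']
    refine div_le_div_of_nonneg_right ?_ (by linarith)
    nlinarith
  have h5 : Real.log (2 * 5) ≤ 3 := by
    rw [Real.log_le_iff_le_exp (by norm_num)]
    have := Real.add_one_le_exp 1
    have e : Real.exp 3 = Real.exp 1 ^ 3 := by rw [← Real.exp_nat_mul]; norm_num
    have e1 := Real.exp_one_gt_d9
    have e2 : (2.7 : ℝ) ≤ Real.exp 1 := by linarith
    rw [e]
    calc (2 * 5 : ℝ) ≤ 2.7 ^ 3 := by norm_num
      _ ≤ _ := by gcongr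
  have h6 : (besselKZero (M / N) - 5) / m ≤ (besselKZero (screening N * (2 * M)) - 2) / m := by
    refine div_le_div_of_nonneg_right ?_ hm.le
    have h7 := (sub_le_sub_left h5 _).trans (h3.trans h4)
    generalize besselKZero (M / N) = K at h7
    linarith
  have r : 2 * (besselKZero (M / N) - 5) / m = 2 * ((besselKZero (M / N) - 5) / m) := by ring
  rw [r]
  linarith

lemma le_fibreSum' {N : ℝ} (hN : 1 ≤ N) (a : Slab m) {M : ℝ} (hM : max (horNorm a) m ≤ M) :
    yukawa (screening N) (a.1, vertRep a) + besselKZero (20 * (M / N)) / m ≤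
      fibreSum m (yukawa (screening N)) a := by
  have hm : (0 : ℝ) < m := Nat.cast_pos.2 (NeZero.pos m)
  have hMm : (m : ℝ) ≤ M := (le_max_right _ _).trans hM
  have hk := screening_pos hN
  have h1 := le_tsum_lineScreened_add_two' hk hm (show (m : ℝ) ≤ 2 * M by linarith)
  have h2 := le_fibreSum_aux hN a hM
  have h4 : besselKZero (20 * (M / N)) ≤ besselKZero (4 * (screening N * (2 * M))) := by
    refine besselKZero_anti (by have := hm.trans_le hMm; positivity) ?_
    have h6 : √6 ≤ 5 / 2 := Real.sqrt_le_iff.2 ⟨by norm_num, by norm_num⟩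
    rw [screening, div_mul_eq_mul_div, mul_div_assoc', mul_div_assoc']
    refine div_le_div_of_nonneg_right ?_ (by linarith)
    nlinarith
  have h5 : besselKZero (20 * (M / N)) / m ≤
      2 * (besselKZero (4 * (screening N * (2 * M))) / (2 * m)) := by
    refine (div_le_div_of_nonneg_right h4 hm.le).trans (le_of_eq ?_)
    field_simp
  linarith

end FibreSum

end

noncomputable section

/-! ## Geometry of balls and disks in the slab -/

section Geometry

variable {m : ℕ}

lemma horNorm_nonneg (a : Slab m) : 0 ≤ horNorm a := Real.sqrt_nonneg _

lemma slabNorm_nonneg (a : Slab m) : 0 ≤ slabNorm a := Real.sqrt_nonneg _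

lemma horNorm_sq (a : Slab m) : horNorm a ^ 2 = (a.1.1 : ℝ) ^ 2 + (a.1.2 : ℝ) ^ 2 :=
  Real.sq_sqrt (by positivity)

lemma slabNorm_sq (a : Slab m) : slabNorm a ^ 2 = horNorm a ^ 2 + (vertRep a : ℝ) ^ 2 := by
  rw [horNorm_sq, slabNorm, Real.sq_sqrt (by positivity)]

lemma horNorm_le_slabNorm (a : Slab m) : horNorm a ≤ slabNorm a :=
  Real.sqrt_le_sqrt (by nlinarith [sq_nonneg (vertRep a : ℝ)])

lemma abs_vertRep_le_slabNorm (a : Slab m) : |(vertRep a : ℝ)| ≤ slabNorm a :=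
  Real.abs_le_sqrt (by nlinarith [sq_nonneg (a.1.1 : ℝ), sq_nonneg (a.1.2 : ℝ)])

lemma slabBall_subset_slabDisk (R : ℝ) : slabBall m R ⊆ slabDisk m R := fun a ha =>
  ⟨(horNorm_le_slabNorm a).trans_lt ha, (abs_vertRep_le_slabNorm a).trans_lt ha⟩

lemma slabBall_mono {R R' : ℝ} (h : R ≤ R') : slabBall m R ⊆ slabBall m R' :=
  fun _ ha => lt_of_lt_of_le ha h

lemma zero_mem_slabBall {R : ℝ} (hR : 0 < R) : (0 : Slab m) ∈ slabBall m R := by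
  have : slabNorm (0 : Slab m) = 0 := by simp [slabNorm, vertRep]
  change slabNorm (0 : Slab m) < R
  rwa [this]

lemma finite_slabDisk [NeZero m] (R : ℝ) : (slabDisk m R).Finite := by
  refine ((((Set.finite_Icc (-⌈R⌉) ⌈R⌉).prod (Set.finite_Icc (-⌈R⌉) ⌈R⌉)).prod
    (Set.finite_univ (α := ZMod m)))).subset ?_
  rintro ⟨⟨p, q⟩, z⟩ ⟨h1, _⟩
  have key : ∀ n : ℤ, |(n : ℝ)| < R → n ∈ Set.Icc (-⌈R⌉) ⌈R⌉ := by
    intro n hn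
    have h2 := abs_lt.1 (hn.trans_le (Int.le_ceil R))
    constructor
    · exact_mod_cast h2.1.le
    · exact_mod_cast h2.2.le
  refine ⟨⟨key p ((Real.abs_le_sqrt ?_).trans_lt h1), key q ((Real.abs_le_sqrt ?_).trans_lt h1)⟩,
    Set.mem_univ _⟩
  · simp only; nlinarith [sq_nonneg (q : ℝ)]
  · simp only; nlinarith [sq_nonneg (p : ℝ)]

lemma finite_slabBall [NeZero m] (R : ℝ) : (slabBall m R).Finite :=
  (finite_slabDisk R).subset (slabBall_subset_slabDisk R)

lemma abs_vertRep_add_le [NeZero m] (z : ZMod m) (s : ℤ) (hs : s.natAbs ≤ 1) :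
    |((z + (s : ZMod m)).valMinAbs : ℝ)| ≤ |(z.valMinAbs : ℝ)| + 1 := by
  have h1 := ZMod.natAbs_valMinAbs_add_le z (s : ZMod m)
  have h2 := abs_valMinAbs_intCast_le (m := m) s
  have h3 := Int.natAbs_add_le z.valMinAbs (s : ZMod m).valMinAbs
  have h4 : (z + (s : ZMod m)).valMinAbs.natAbs ≤ z.valMinAbs.natAbs + 1 := by omega
  rw [← Int.cast_abs, ← Int.cast_abs, Int.abs_eq_natAbs, Int.abs_eq_natAbs]
  exact_mod_cast h4

lemma slabNorm_add_unitStep_le [NeZero m] (a : Slab m) (i : Fin 6) :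
    slabNorm (a + unitStep m i) ≤ slabNorm a + 1 := by
  have h0 := slabNorm_nonneg a
  have hsq : slabNorm a ^ 2 = (a.1.1 : ℝ) ^ 2 + (a.1.2 : ℝ) ^ 2 + (vertRep a : ℝ) ^ 2 := by
    rw [slabNorm_sq, horNorm_sq]
  have hp : |(a.1.1 : ℝ)| ≤ slabNorm a := Real.abs_le_sqrt (by
    nlinarith [sq_nonneg (vertRep a : ℝ), sq_nonneg (a.1.2 : ℝ)])
  have hq : |(a.1.2 : ℝ)| ≤ slabNorm a := Real.abs_le_sqrt (by
    nlinarith [sq_nonneg (vertRep a : ℝ), sq_nonneg (a.1.1 : ℝ)])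
  have hz := abs_vertRep_le_slabNorm a
  have hp' := abs_le.1 hp
  have hq' := abs_le.1 hq
  have hvert : ∀ s : ℤ, s.natAbs ≤ 1 →
      (((a.2 + (s : ZMod m)).valMinAbs : ℤ) : ℝ) ^ 2 ≤ (vertRep a : ℝ) ^ 2 + 2 * slabNorm a + 1 := by
    intro s hs
    have h1 := abs_vertRep_add_le a.2 s hs
    have h2 := pow_le_pow_left₀ (abs_nonneg _) h1 2
    rw [sq_abs, add_sq, sq_abs] at h2
    unfold vertRep at hz ⊢
    linarith
  have hv1 := hvert 1 (by simp)
  have hv2 := hvert (-1) (by simp)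
  push_cast at hv1 hv2
  refine Real.sqrt_le_iff.2 ⟨by positivity, ?_⟩
  rw [add_sq, hsq]
  fin_cases i <;> simp [unitStep] <;> unfold vertRep at * <;> simp <;> nlinarith

lemma equilibriumMeasure_of_slabNorm_lt [NeZero m] {N R : ℝ} {A : Set (Slab m)}
    (hA : slabBall m R ⊆ A) {a : Slab m} (ha : slabNorm a < R - 1) :
    equilibriumMeasure N A a = killRate N := by
  refine equilibriumMeasure_interior (hA (show slabNorm a < R by linarith)) fun i => hA ?_
  have := slabNorm_add_unitStep_le a i
  exact show slabNorm (a + unitStep m i) < R by linarith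

/-- If `R > 3m`, the height is at most `m/2 < R/6`, so a point near or beyond the sphere must be
horizontally far. -/
lemma max_div_three_le [NeZero m] {R : ℝ} (hR : 4 ≤ R) {a : Slab m} (ha : R - 1 ≤ slabNorm a) :
    max R m / 3 ≤ max (horNorm a) m := by
  have hm : (0 : ℝ) < m := Nat.cast_pos.2 (NeZero.pos m)
  rcases le_or_gt R (3 * m) with h | h
  · refine le_trans ?_ (le_max_right _ _)
    rw [div_le_iff₀ (by norm_num)]
    exact max_le (by linarith) (by linarith)
  · refine le_trans ?_ (le_max_left _ _)
    have h1 := abs_vertRep_le a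
    have h2 := pow_le_pow_left₀ (abs_nonneg _) h1 2
    rw [sq_abs] at h2
    have h3 := slabNorm_sq a
    have h4 := horNorm_nonneg a
    have h5 : (R - 1) ^ 2 ≤ slabNorm a ^ 2 := pow_le_pow_left₀ (by linarith) ha 2
    rw [max_eq_left (by linarith)]
    refine abs_le_of_sq_le_sq' ?_ h4 |>.2
    nlinarith

/-- The ball is covered by the projection of a cube of `ℤ³`, which does not depend on `m`. -/
lemma exists_card_slabBall_le (R : ℝ) : ∃ n : ℕ, ∀ (m : ℕ) [NeZero m] (A : Finset (Slab m)),
    (A : Set (Slab m)) = slabBall m R → A.card ≤ n := by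
  classical
  let I : Finset ℤ := Finset.Icc (-⌈R⌉) ⌈R⌉
  refine ⟨((I ×ˢ I) ×ˢ I).card, fun m _ A hA => ?_⟩
  have key : ∀ n : ℤ, |(n : ℝ)| < R → n ∈ I := by
    intro n hn
    have h2 := abs_lt.1 (hn.trans_le (Int.le_ceil R))
    refine Finset.mem_Icc.2 ⟨?_, ?_⟩
    · exact_mod_cast h2.1.le
    · exact_mod_cast h2.2.le
  refine (Finset.card_le_card (t := ((I ×ˢ I) ×ˢ I).image (slabProj m)) ?_).trans
    Finset.card_image_le
  intro a ha
  have ha' : slabNorm a < R := by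
    have : a ∈ (A : Set (Slab m)) := ha
    rw [hA] at this
    exact this
  refine Finset.mem_image.2 ⟨(a.1, vertRep a), ?_, ?_⟩
  · refine Finset.mem_product.2 ⟨Finset.mem_product.2 ⟨key _ ?_, key _ ?_⟩, key _ ?_⟩
    · exact (Real.abs_le_sqrt (by
        nlinarith [sq_nonneg (vertRep a : ℝ), sq_nonneg (a.1.2 : ℝ)])).trans_lt ha'
    · exact (Real.abs_le_sqrt (by
        nlinarith [sq_nonneg (vertRep a : ℝ), sq_nonneg (a.1.1 : ℝ)])).trans_lt ha'
    · exact (abs_vertRep_le_slabNorm a).trans_lt ha'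
  · exact (slabProj_eq_iff a _).2 ⟨0, by simp⟩

end Geometry

/-! ## Comparison of the capacity with the potential -/

section Capacity

variable {m : ℕ} {N R : ℝ}

lemma slabCap_mul_le_equilibriumPotential {A : Finset (Slab m)} {c : ℝ}
    (hc : ∀ a ∈ A, c ≤ fibreSum m (yukawa (screening N)) a) :
    slabCap N (A : Set (Slab m)) * c ≤ equilibriumPotential N A := by
  rw [slabCap_eq_sum, Finset.sum_mul]
  exact Finset.sum_le_sum fun a ha =>
    mul_le_mul_of_nonneg_left (hc a ha) (equilibriumMeasure_nonneg _ a)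

lemma max_horNorm_le {a : Slab m} (ha : horNorm a < R) : max (horNorm a) m ≤ max R m :=
  max_le_max ha.le le_rfl

variable [NeZero m]

/-- Points with `slabNorm a < R - 1` have all neighbours in `A` and carry mass `κ`; at the others
the fibre sum is at most `c`. -/
lemma equilibriumPotential_le_add {A : Finset (Slab m)} (hA : slabBall m R ⊆ A) {c : ℝ}
    (hc0 : 0 ≤ c)
    (hc : ∀ a ∈ A, R - 1 ≤ slabNorm a → fibreSum m (yukawa (screening N)) a ≤ c) :
    equilibriumPotential N A ≤
      killRate N * ∑ a ∈ A, fibreSum m (yukawa (screening N)) a +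
        slabCap N (A : Set (Slab m)) * c := by
  rw [slabCap_eq_sum, Finset.sum_mul, Finset.mul_sum, ← Finset.sum_add_distrib]
  refine Finset.sum_le_sum fun a ha => ?_
  have h0 := fibreSum_nonneg (screening N) a
  have h1 := equilibriumMeasure_nonneg (N := N) (A : Set (Slab m)) a
  have h2 := killRate_nonneg N
  rcases lt_or_ge (slabNorm a) (R - 1) with h | h
  · rw [equilibriumMeasure_of_slabNorm_lt hA h]
    nlinarith [mul_nonneg h2 hc0]
  · nlinarith [mul_le_mul_of_nonneg_left (hc a ha h) h1, mul_nonneg h2 h0]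

lemma fibreSum_le_of_le_slabNorm (hN : 1 ≤ N) (hR : 4 ≤ R) {a : Slab m}
    (ha : R - 1 ≤ slabNorm a) : fibreSum m (yukawa (screening N)) a ≤
      1 / (R - 1) + (2 * besselKZero (max R m / N) + 8) / m := by
  have hm : (0 : ℝ) < m := Nat.cast_pos.2 (NeZero.pos m)
  have hmax : 0 < max R m := lt_max_of_lt_right hm
  have h1 := fibreSum_le hN a (by positivity) (max_div_three_le hR ha)
  -- Removing the factor `1/3` costs `log 6 ≤ 2`, so the constant in the bound is `8 = 4 + 2·2`.
  have h2 := besselKZero_sub_log_le (c := 3) (s := max R m / 3 / N) (by norm_num) (by positivity)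
  rw [show 3 * (max R m / 3 / N) = max R m / N by ring] at h2
  have h3 : Real.log (2 * 3) ≤ 2 := by
    rw [Real.log_le_iff_le_exp (by norm_num)]
    have e : Real.exp 2 = Real.exp 1 ^ 2 := by rw [← Real.exp_nat_mul]; norm_num
    have e1 := Real.exp_one_gt_d9
    rw [e]
    nlinarith
  have h4 : 1 / √(slabNorm a ^ 2 + 1) ≤ 1 / (R - 1) := by
    refine one_div_le_one_div_of_le (by linarith) (Real.le_sqrt_of_sq_le ?_)
    have := pow_le_pow_left₀ (by linarith) ha 2
    linarith
  have h5 : besselKZero (max R m / 3 / N) ≤ besselKZero (max R m / N) + 2 :=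
    (sub_le_iff_le_add.1 h2).trans (add_le_add le_rfl h3)
  calc _ ≤ _ := h1
    _ ≤ 1 / (R - 1) + 4 / m + 2 * (besselKZero (max R m / N) + 2) / m := by gcongr
    _ = _ := by ring

/-- Lower bound on the capacity of a set between a ball and a column. -/
lemma sub_le_slabCap_mul (hN : 1 ≤ N) (hR : 4 ≤ R) {A : Finset (Slab m)}
    (hA : slabBall m R ⊆ A) {η : ℝ}
    (hη : killRate N * ∑ a ∈ A, fibreSum m (yukawa (screening N)) a ≤ η) :
    equilibriumPotential N A - η ≤ slabCap N (A : Set (Slab m)) *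
      (1 / (R - 1) + (2 * besselKZero (max R m / N) + 8) / m) := by
  have hm : (0 : ℝ) < m := Nat.cast_pos.2 (NeZero.pos m)
  have hK := besselKZero_pos (show 0 < max R m / N by
    have : 0 < max R m := lt_max_of_lt_right hm
    positivity)
  have := equilibriumPotential_le_add (N := N) hA
    (c := 1 / (R - 1) + (2 * besselKZero (max R m / N) + 8) / m)
    (by have : 0 < R - 1 := by linarith
        positivity)
    (fun a _ h => fibreSum_le_of_le_slabNorm hN hR h)
  linarith

end Capacity

end

noncomputable section

/-! ## Order of magnitude of the capacity -/

section Order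

lemma max_div_pos {N R : ℝ} (hN : 1 ≤ N) (m : ℕ) [NeZero m] : 0 < max R m / N := by
  have : 0 < max R (m : ℝ) := lt_max_of_lt_right (Nat.cast_pos.2 (NeZero.pos m))
  positivity

lemma slabF_mono {N : ℝ} (hN : 1 ≤ N) (m : ℕ) [NeZero m] {R R' : ℝ} (h : R ≤ R') :
    slabF N m R ≤ slabF N m R' := by
  refine min_le_min h (div_le_div_of_nonneg_left (Nat.cast_nonneg m)
    (besselKZero_pos (max_div_pos hN m)) (besselKZero_anti (max_div_pos hN m) ?_))
  gcongr

lemma slabF_nonneg {N R : ℝ} (hN : 1 ≤ N) (hR : 0 ≤ R) (m : ℕ) [NeZero m] : 0 ≤ slabF N m R :=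
  le_min hR (div_nonneg (Nat.cast_nonneg m) (besselKZero_pos (max_div_pos hN m)).le)

lemma exp_div_le_yukawa {N R : ℝ} (hN : 1 ≤ N) (hR : 1 ≤ R) {m : ℕ} {a : Slab m}
    (ha : a ∈ slabDisk m R) :
    Real.exp (-(5 * R / N)) / (2 * R) ≤ yukawa (screening N) (a.1, vertRep a) := by
  have hk := screening_pos hN
  have hr : regNorm (a.1, vertRep a) ≤ 2 * R := by
    have h1 := horNorm_sq a
    have h2 := pow_le_pow_left₀ (horNorm_nonneg a) ha.1.le 2
    have h3 := pow_le_pow_left₀ (abs_nonneg _) ha.2.le 2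
    rw [sq_abs] at h3
    refine Real.sqrt_le_iff.2 ⟨by positivity, ?_⟩
    simp only
    nlinarith
  refine le_trans ?_ (screened_anti hk.le (regNorm_pos _) hr)
  refine div_le_div_of_nonneg_right (Real.exp_le_exp.2 (neg_le_neg ?_)) (by positivity)
  have h6 : √6 ≤ 5 / 2 := Real.sqrt_le_iff.2 ⟨by norm_num, by norm_num⟩
  rw [screening, div_mul_eq_mul_div]
  refine div_le_div_of_nonneg_right ?_ (by linarith)
  nlinarith

/-- The two entries of the minimum come from the two parts of `le_fibreSum'`: keeping only the
nearest copy gives `R`, keeping only the other copies gives `m / K₀`. -/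
lemma exists_slabCap_slabDisk_le {C₀ : ℝ} (hC₀ : 1 ≤ C₀) : ∃ C : ℝ, 0 < C ∧ ∀ (N : ℝ), 1 ≤ N →
    ∀ (m : ℕ) [NeZero m], (m : ℝ) ≤ N → ∀ R : ℝ, 1 ≤ R → R ≤ C₀ * N →
      slabCap N (slabDisk m R) ≤ C * slabF N m R := by
  obtain ⟨M, hM0, hM⟩ := exists_equilibriumPotential_le
  obtain ⟨b, hb0, hb⟩ := exists_mul_besselKZero_le (c := 20) (C := C₀) (by norm_num) (by linarith)
  refine ⟨max (2 * M * Real.exp (5 * C₀)) (M / b), by positivity,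
    fun N hN m _ hmN R hR hRN => ?_⟩
  have hm : (0 : ℝ) < m := Nat.cast_pos.2 (NeZero.pos m)
  obtain ⟨A, hA⟩ := (finite_slabDisk (m := m) R).exists_finset_coe
  rw [← hA]
  have hcap := hM N hN m A
  have hcap0 := slabCap_nonneg (N := N) (A : Set (Slab m))
  have hmem : ∀ a ∈ A, a ∈ slabDisk m R := fun a ha => by rw [← hA]; exact ha
  set t := max R m / N with ht
  have ht0 : 0 < t := max_div_pos hN m
  have htC : t ≤ C₀ := by
    rw [ht, div_le_iff₀ (by linarith)]
    exact max_le hRN (by nlinarith)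
  have hK := besselKZero_pos ht0
  have hK20 := besselKZero_pos (show 0 < 20 * t by positivity)
  set E := Real.exp (5 * C₀) with hE
  have hE0 : 0 < E := Real.exp_pos _
  have h1 : slabCap N (A : Set (Slab m)) ≤ 2 * M * E * R := by
    have h := (slabCap_mul_le_equilibriumPotential (N := N) (A := A) (c := 1 / (2 * R * E))
      fun a ha => ?_).trans hcap
    · rw [mul_one_div, div_le_iff₀ (by positivity)] at h
      linarith
    · have h2 := le_fibreSum' hN a (max_horNorm_le (m := m) (hmem a ha).1)
      have h3 := exp_div_le_yukawa hN hR (hmem a ha)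
      have h4 : 1 / (2 * R * E) ≤ Real.exp (-(5 * R / N)) / (2 * R) := by
        have : E⁻¹ ≤ Real.exp (-(5 * R / N)) := by
          rw [hE, ← Real.exp_neg]
          refine Real.exp_le_exp.2 (neg_le_neg ?_)
          rw [div_le_iff₀ (by linarith)]
          linarith
        calc 1 / (2 * R * E) = E⁻¹ / (2 * R) := by field_simp
          _ ≤ _ := by gcongr
      have h5 : 0 ≤ besselKZero (20 * t) / m := by positivity
      exact (h4.trans h3).trans ((le_add_of_nonneg_right h5).trans h2)
  have h2 : slabCap N (A : Set (Slab m)) ≤ M / b * (m / besselKZero t) := by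
    have h := (slabCap_mul_le_equilibriumPotential (N := N) (A := A) (c := b * besselKZero t / m)
      fun a ha => ?_).trans hcap
    · rw [div_mul_div_comm, le_div_iff₀ (by positivity)]
      rw [← mul_div_assoc, div_le_iff₀ hm] at h
      linarith
    · have h2 := le_fibreSum' hN a (max_horNorm_le (m := m) (hmem a ha).1)
      have h3 : b * besselKZero t / m ≤ besselKZero (20 * t) / m :=
        div_le_div_of_nonneg_right (hb t ht0 htC) hm.le
      exact h3.trans ((le_add_of_nonneg_left (yukawa_nonneg _ _)).trans h2)
  rw [slabF, mul_min_of_nonneg _ _ (by positivity)]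
  refine le_min (h1.trans ?_) (h2.trans ?_)
  · exact mul_le_mul_of_nonneg_right (le_max_left _ _) (by linarith)
  · exact mul_le_mul_of_nonneg_right (le_max_right _ _) (by positivity)

lemma exists_le_slabCap_slabBall_of_le : ∃ R₀ N₀ δ c : ℝ, 4 ≤ R₀ ∧ 1 ≤ N₀ ∧ 0 < δ ∧ δ ≤ 1 ∧
    0 < c ∧ ∀ (N : ℝ), N₀ ≤ N → ∀ (m : ℕ) [NeZero m], (m : ℝ) ≤ N → ∀ R : ℝ, R₀ ≤ R →
      R ≤ δ * N → c * slabF N m R ≤ slabCap N (slabBall m R) := by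
  obtain ⟨R₀, N₀, hR₀, hN₀, h1⟩ := exists_abs_equilibriumPotential_sub_le (η := 1 / 2) (by norm_num)
  obtain ⟨δ, hδ, h2⟩ := exists_killRate_mul_sum_fibreSum_le (η := 1 / 2) (by norm_num)
  have hK1 := besselKZero_pos one_pos
  set C := 4 + 8 / besselKZero 1 with hC
  have hC0 : 0 < C := by positivity
  refine ⟨max R₀ 4, N₀, min δ 1, C⁻¹, le_max_right _ _, hN₀, lt_min hδ one_pos, min_le_right _ _,
    by positivity, fun N hN m _ hmN R hR hRN => ?_⟩
  have hN1 : 1 ≤ N := hN₀.trans hN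
  have hR4 : 4 ≤ R := (le_max_right _ _).trans hR
  have hm : (0 : ℝ) < m := Nat.cast_pos.2 (NeZero.pos m)
  obtain ⟨A, hA⟩ := (finite_slabBall (m := m) R).exists_finset_coe
  have hRδ : R ≤ δ * N := hRN.trans (by gcongr; exact min_le_left _ _)
  have hR1 : R ≤ N := hRN.trans (mul_le_of_le_one_left (by linarith) (min_le_right _ _))
  have h3 := abs_le.1 (h1 N R hN ((le_max_left _ _).trans hR) m A hA.ge)
  have h4 := h2 N R hN1 (by linarith) hRδ m A fun a ha => by
    have : a ∈ slabBall m R := by rw [← hA]; exact ha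
    exact (horNorm_le_slabNorm a).trans_lt this
  have h5 := sub_le_slabCap_mul hN1 hR4 hA.ge h4
  rw [hA] at h5
  have hpi := Real.pi_gt_three
  set t := max R m / N with ht
  have ht0 : 0 < t := max_div_pos hN1 m
  have ht1 : t ≤ 1 := by
    rw [ht, div_le_one (by linarith)]
    exact max_le hR1 hmN
  have hK := besselKZero_anti ht0 ht1
  set K := besselKZero t with hKd
  have hK0 : 0 < K := hK1.trans_le hK
  set cap := slabCap N (slabBall m R) with hcap
  have hcap0 : 0 ≤ cap := slabCap_nonneg _
  -- Here `2π/3 - 1/2 - 1/2 ≥ 1`, since `π > 3`.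
  have h6 : 1 ≤ cap * (1 / (R - 1) + (2 * K + 8) / m) := by linarith [h3.1]
  have hF0 : 0 ≤ slabF N m R := slabF_nonneg hN1 (by linarith) m
  have hFR : slabF N m R ≤ R := min_le_left _ _
  have hFK : slabF N m R ≤ m / K := min_le_right _ _
  have h7 : slabF N m R * (1 / (R - 1) + (2 * K + 8) / m) ≤ C := by
    have e1 : slabF N m R * (1 / (R - 1)) ≤ 2 := by
      rw [mul_one_div, div_le_iff₀ (by linarith)]
      linarith
    have e2 : slabF N m R * ((2 * K + 8) / m) ≤ 2 + 8 / besselKZero 1 := by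
      calc _ ≤ m / K * ((2 * K + 8) / m) := by gcongr
        _ = 2 + 8 / K := by field_simp
        _ ≤ _ := by gcongr
    rw [mul_add, hC]
    linarith
  rw [inv_mul_le_iff₀ hC0]
  calc slabF N m R ≤ slabF N m R * (cap * (1 / (R - 1) + (2 * K + 8) / m)) :=
        le_mul_of_one_le_right hF0 h6
    _ = slabF N m R * (1 / (R - 1) + (2 * K + 8) / m) * cap := by ring
    _ ≤ C * cap := mul_le_mul_of_nonneg_right h7 hcap0

/-- Extends the range `R₀ ≤ R ≤ δN`. For bounded `N`, `cap ≥ κ` suffices (`c₁`). For `R < R₀`, a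
point has at least `1/n` of the capacity of `B_{R₀}` (`c₂`). For `R > δN`, compare with the ball of
radius `δN`, where `slabF` is smaller by at most the factor `D` (`c₃`). -/
lemma exists_le_slabCap_slabBall {C₀ : ℝ} (hC₀ : 1 ≤ C₀) : ∃ c : ℝ, 0 < c ∧ ∀ (N : ℝ), 1 ≤ N →
    ∀ (m : ℕ) [NeZero m], (m : ℝ) ≤ N → ∀ R : ℝ, 1 ≤ R → R ≤ C₀ * N →
      c * slabF N m R ≤ slabCap N (slabBall m R) := by
  obtain ⟨R₀, N₀, δ, c, hR₀, hN₀, hδ0, hδ1, hc0, hmid⟩ := exists_le_slabCap_slabBall_of_le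
  obtain ⟨n, hn⟩ := exists_card_slabBall_le R₀
  set N₁ := max N₀ (R₀ / δ) with hN₁
  have hN₁0 : 1 ≤ N₁ := hN₀.trans (le_max_left _ _)
  have hKδ := besselKZero_pos hδ0
  have hKC := besselKZero_pos (show 0 < C₀ by linarith)
  set D := max (C₀ / δ) (besselKZero δ / besselKZero C₀) with hD
  have hD0 : 0 < D := lt_max_of_lt_left (by positivity)
  set c₁ := (N₁ ^ 2 * (C₀ * N₁))⁻¹ with hc₁
  set c₂ := c / (n + 1) with hc₂
  set c₃ := min c (c / D) with hc₃
  refine ⟨min c₁ (min c₂ c₃), by positivity, fun N hN m _ hmN R hR hRN => ?_⟩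
  have hm : (0 : ℝ) < m := Nat.cast_pos.2 (NeZero.pos m)
  have hF0 : 0 ≤ slabF N m R := slabF_nonneg hN (by linarith) m
  have hfin := finite_slabBall (m := m) R
  have hle1 : min c₁ (min c₂ c₃) ≤ c₁ := min_le_left _ _
  have hle2 : min c₁ (min c₂ c₃) ≤ c₂ := (min_le_right _ _).trans (min_le_left _ _)
  have hle3 : min c₁ (min c₂ c₃) ≤ c₃ := (min_le_right _ _).trans (min_le_right _ _)
  have hzero : (0 : Slab m) ∈ slabBall m R := zero_mem_slabBall (by linarith)
  rcases lt_or_ge N N₁ with hNN | hNN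
  · have h1 := killRate_le_slabCap (N := N) hfin hzero
    refine le_trans ?_ h1
    have h2 : slabF N m R ≤ C₀ * N₁ := (min_le_left _ _).trans (hRN.trans (by gcongr))
    calc _ ≤ c₁ * (C₀ * N₁) := mul_le_mul hle1 h2 hF0 (by positivity)
      _ = (N₁ ^ 2)⁻¹ := by rw [hc₁]; field_simp
      _ ≤ killRate N := by unfold killRate; gcongr
  have hN0N : N₀ ≤ N := (le_max_left _ _).trans hNN
  have hRδ : R₀ ≤ δ * N := by
    have : R₀ / δ ≤ N := (le_max_right _ _).trans hNN
    rw [div_le_iff₀ hδ0] at this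
    linarith
  rcases lt_or_ge R R₀ with hRR | hRR
  · have h1 := hmid N hN0N m hmN R₀ le_rfl hRδ
    have h2 := slabF_mono hN m hRR.le
    obtain ⟨A, hA⟩ := (finite_slabBall (m := m) R₀).exists_finset_coe
    have h3 := slabCap_le_card_mul hN (A := A)
    have h4 := hn m A hA
    rw [hA] at h3
    have h5 : slabCap N ({0} : Set (Slab m)) ≤ slabCap N (slabBall m R) :=
      slabCap_mono hN hfin (Set.singleton_subset_iff.2 hzero)
    have h6 := slabCap_nonneg (N := N) ({0} : Set (Slab m))
    have h7 : (A.card : ℝ) ≤ n + 1 := by exact_mod_cast h4.trans (Nat.le_succ n)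
    calc _ ≤ c₂ * slabF N m R₀ := mul_le_mul hle2 h2 hF0 (by positivity)
      _ = (c * slabF N m R₀) / (n + 1) := by rw [hc₂]; ring
      _ ≤ ((n + 1) * slabCap N ({0} : Set (Slab m))) / (n + 1) := by
          refine div_le_div_of_nonneg_right (h1.trans (h3.trans ?_)) (by positivity)
          exact mul_le_mul_of_nonneg_right h7 h6
      _ = slabCap N ({0} : Set (Slab m)) := by field_simp
      _ ≤ _ := h5
  rcases le_or_gt R (δ * N) with hRδ' | hRδ'
  · refine le_trans ?_ (hmid N hN0N m hmN R hRR hRδ')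
    exact mul_le_mul_of_nonneg_right (hle3.trans (min_le_left _ _)) hF0
  · have h1 := hmid N hN0N m hmN (δ * N) hRδ le_rfl
    have h2 := slabCap_mono hN hfin (slabBall_mono (m := m) hRδ'.le)
    have hN0 : 0 < N := by linarith
    have h3 : slabF N m R ≤ D * slabF N m (δ * N) := by
      rw [slabF, slabF, mul_min_of_nonneg _ _ hD0.le]
      refine le_min ((min_le_left _ _).trans ?_) ((min_le_right _ _).trans ?_)
      · calc R ≤ C₀ * N := hRN
          _ = C₀ / δ * (δ * N) := by field_simp
          _ ≤ _ := by gcongr; exact le_max_left _ _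
      · have e1 : besselKZero C₀ ≤ besselKZero (max R m / N) := by
          refine besselKZero_anti (max_div_pos hN m) ?_
          rw [div_le_iff₀ hN0]
          exact max_le hRN (by nlinarith)
        have e2 : besselKZero (max (δ * N) m / N) ≤ besselKZero δ := by
          refine besselKZero_anti hδ0 ?_
          rw [le_div_iff₀ hN0]
          exact le_max_left _ _
        have e3 := besselKZero_pos (max_div_pos (R := δ * N) hN m)
        calc m / besselKZero (max R m / N) ≤ m / besselKZero C₀ := by gcongr
          _ = besselKZero δ / besselKZero C₀ * (m / besselKZero δ) := by field_simp
          _ ≤ D * (m / besselKZero (max (δ * N) m / N)) := by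
              gcongr
              exact le_max_right _ _
    refine le_trans ?_ (h1.trans h2)
    calc _ ≤ c / D * (D * slabF N m (δ * N)) :=
          mul_le_mul (hle3.trans (min_le_right _ _)) h3 hF0 (by positivity)
      _ = c * slabF N m (δ * N) := by field_simp

end Order

/-! ## Sharp asymptotics -/

section Sharp

variable {ε : ℝ}

/-- The lower-order terms become relative errors `ε/8`: `R ≥ 16/ε` treats `1/(R - 1)`, and `K ≥
64/ε` gives `8 ≤ (ε/8)K`. -/
lemma sharp_lower {ε R K m cap T : ℝ} (hε0 : 0 < ε) (hε1 : ε < 1) (hR : 16 ≤ ε * R)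
    (hK : 64 ≤ ε * K) (hm : 0 < m) (hT : 2 * Real.pi / 3 * (1 - ε / 4) ≤ T)
    (hcap : T ≤ cap * (1 / (R - 1) + (2 * K + 8) / m)) (hcap0 : 0 ≤ cap) :
    2 * Real.pi / 3 * (1 - ε / 4) ≤ cap * ((1 + ε / 8) * (1 / R) + (2 + ε / 8) * (K / m)) := by
  have hR1 : 16 < R := by nlinarith
  have e1 : 1 / (R - 1) ≤ (1 + ε / 8) * (1 / R) := by
    rw [mul_one_div, div_le_div_iff₀ (by linarith) (by linarith)]
    nlinarith
  have e2 : (2 * K + 8) / m ≤ (2 + ε / 8) * (K / m) := by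
    rw [← mul_div_assoc]
    exact div_le_div_of_nonneg_right (by linarith) hm.le
  exact (hT.trans hcap).trans (mul_le_mul_of_nonneg_left (add_le_add e1 e2) hcap0)

lemma sharp_lower_disk {ε R K m cap : ℝ} (hε0 : 0 < ε) (hε1 : ε < 1) (hR : 0 < R)
    (hK : 0 < K) (hm : 0 < m) (hcond : 1 / (ε * R) ≤ K / m) (hcap0 : 0 ≤ cap)
    (h : 2 * Real.pi / 3 * (1 - ε / 4) ≤
      cap * ((1 + ε / 8) * (1 / R) + (2 + ε / 8) * (K / m))) :
    Real.pi * (1 - ε) / 3 * (m / K) ≤ cap := by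
  have hτ0 := Real.pi_pos
  have hKm : 0 < K / m := by positivity
  -- In this regime the nearest copy is negligible against the other copies.
  have e1 : 1 / R ≤ ε * (K / m) := by
    calc 1 / R = ε * (1 / (ε * R)) := by field_simp
      _ ≤ _ := by gcongr
  have e2 : (1 + ε / 8) * (1 / R) + (2 + ε / 8) * (K / m) ≤ (2 + 5 * ε / 4) * (K / m) := by
    have f1 : (1 + ε / 8) * (1 / R) ≤ (1 + ε / 8) * (ε * (K / m)) := by gcongr
    have f2 : (1 + ε / 8) * ε + (2 + ε / 8) ≤ 2 + 5 * ε / 4 := by nlinarith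
    have f3 := mul_le_mul_of_nonneg_right f2 hKm.le
    linarith
  have e3 : Real.pi * (1 - ε) / 3 * (m / K) = Real.pi * (1 - ε) / 3 / (K / m) := by
    field_simp
  rw [e3, div_le_iff₀ hKm]
  have e4 := h.trans (mul_le_mul_of_nonneg_left e2 hcap0)
  have e5 : (1 - ε) * (2 + 5 * ε / 4) ≤ 2 * (1 - ε / 4) := by nlinarith
  refine le_of_mul_le_mul_right (a := 2 + 5 * ε / 4) ?_ (by linarith)
  have e6 := mul_le_mul_of_nonneg_left e5 (show 0 ≤ Real.pi / 3 by positivity)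
  linarith

lemma sharp_upper_disk {ε K m cap T : ℝ} (hε0 : 0 < ε) (hε1 : ε < 1) (hK : 64 ≤ ε * K)
    (hm : 0 < m) (hT : T ≤ 2 * Real.pi / 3 * (1 + ε / 8)) (h : cap * (2 * (K - 5) / m) ≤ T) :
    cap ≤ Real.pi * (1 + ε) / 3 * (m / K) := by
  have hpi := Real.pi_pos
  have hK0 : 64 < K := by nlinarith
  have e2 : cap * (2 * (K - 5)) ≤ 2 * Real.pi / 3 * (1 + ε / 8) * m := by
    rw [← mul_div_assoc, div_le_iff₀ hm] at h
    exact h.trans (mul_le_mul_of_nonneg_right hT hm.le)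
  rw [← mul_div_assoc, le_div_iff₀ (by linarith)]
  have e3 : (1 + ε / 8) * K ≤ (1 + ε) * (K - 5) := by linarith
  refine le_of_mul_le_mul_right (a := 2 * (K - 5)) ?_ (by linarith)
  calc cap * K * (2 * (K - 5)) = cap * (2 * (K - 5)) * K := by ring
    _ ≤ 2 * Real.pi / 3 * (1 + ε / 8) * m * K := by gcongr
    _ = 2 * Real.pi / 3 * m * ((1 + ε / 8) * K) := by ring
    _ ≤ 2 * Real.pi / 3 * m * ((1 + ε) * (K - 5)) := by gcongr
    _ = _ := by ring

lemma sharp_lower_ball {ε R K m cap : ℝ} (hε0 : 0 < ε) (hε1 : ε < 1) (hR : 0 < R)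
    (hK : 0 < K) (hm : 0 < m) (hcap0 : 0 ≤ cap)
    (h : 2 * Real.pi / 3 * (1 - ε / 4) ≤
      cap * ((1 + ε / 8) * (1 / R) + (2 + ε / 8) * (K / m))) :
    2 * Real.pi * (1 - ε) / 3 * (1 / R + 2 * K / m)⁻¹ ≤ cap := by
  have hpi := Real.pi_pos
  have hKm : 0 < K / m := by positivity
  have hG0 : 0 < 1 / R + 2 * K / m := by positivity
  rw [← div_eq_mul_inv, div_le_iff₀ hG0]
  refine le_of_mul_le_mul_right (a := 1 + ε / 8) ?_ (by linarith)
  have e1 : (1 + ε / 8) * (1 / R) + (2 + ε / 8) * (K / m) ≤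
      (1 / R + 2 * K / m) * (1 + ε / 8) := by
    rw [mul_div_assoc]
    have := mul_pos hKm hε0
    linarith
  have e2 := h.trans (mul_le_mul_of_nonneg_left e1 hcap0)
  have e3 : (1 - ε) * (1 + ε / 8) ≤ 1 - ε / 4 := by nlinarith
  have e4 := mul_le_mul_of_nonneg_left e3 (show 0 ≤ 2 * Real.pi / 3 by positivity)
  linarith

lemma sharp_upper_ball {ε G cap T : ℝ} (hε0 : 0 < ε) (hε1 : ε < 1) (hG : 0 < G)
    (hT : T ≤ 2 * Real.pi / 3 * (1 + ε / 8)) (h : cap * ((1 - ε / 8) * G) ≤ T) :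
    cap ≤ 2 * Real.pi * (1 + ε) / 3 * G⁻¹ := by
  have hpi := Real.pi_pos
  rw [← div_eq_mul_inv, le_div_iff₀ hG]
  refine le_of_mul_le_mul_right (a := 1 - ε / 8) ?_ (by linarith)
  have e3 : 1 + ε / 8 ≤ (1 + ε) * (1 - ε / 8) := by nlinarith
  have e4 := mul_le_mul_of_nonneg_left e3 (show 0 ≤ 2 * Real.pi / 3 by positivity)
  linarith

/-- Throughout `B_R` the regularized distance is at most `R + 1`. The screening is invisible at this
scale, since `k(R + 1) ≤ ε/16`. -/
lemma le_screened_succ {ε N R : ℝ} (hε0 : 0 < ε) (hε1 : ε < 1) (hN : 1 ≤ N) (hR : 16 ≤ ε * R)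
    (hRN : 80 * R ≤ ε * N) : (1 - ε / 8) * (1 / R) ≤ screened (screening N) (R + 1) := by
  have hR1 : 16 < R := by nlinarith
  rw [screened, mul_one_div, div_le_div_iff₀ (by linarith) (by linarith)]
  have g3 : screening N * (R + 1) ≤ ε / 16 := by
    have h6 : √6 ≤ 5 / 2 := Real.sqrt_le_iff.2 ⟨by norm_num, by norm_num⟩
    have h7 : √6 * (R + 1) ≤ 5 / 2 * (R + 1) := by gcongr
    rw [screening, div_mul_eq_mul_div, div_le_iff₀ (by linarith)]
    linarith
  have g4 := Real.add_one_le_exp (-(screening N * (R + 1)))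
  calc (1 - ε / 8) * (R + 1) ≤ (1 - ε / 16) * R := by linarith
    _ ≤ _ := by
      refine mul_le_mul_of_nonneg_right ?_ (by linarith)
      linarith

lemma exists_sharp (hε0 : 0 < ε) (hε1 : ε < 1) : ∃ C₁ C₂ C₃ : ℝ, 0 < C₁ ∧ 0 < C₂ ∧ 0 < C₃ ∧
    ∀ (N R : ℝ), 1 ≤ N → ∀ (m : ℕ) [NeZero m], C₁ ≤ R → R ≤ 1 / C₂ * N → (m : ℝ) ≤ 1 / C₃ * N →
      (1 / (ε * R) ≤ besselKZero (max R m / N) / m →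
        Real.pi * (1 - ε) / 3 * (m / besselKZero (max R m / N)) ≤ slabCap N (slabDisk m R) ∧
        slabCap N (slabDisk m R) ≤ Real.pi * (1 + ε) / 3 * (m / besselKZero (max R m / N))) ∧
      (besselKZero (max R m / N) / m < 1 / (ε * R) →
        2 * Real.pi * (1 - ε) / 3 * (1 / R + 2 * besselKZero (m / N) / m)⁻¹ ≤
          slabCap N (slabBall m R) ∧
        slabCap N (slabBall m R) ≤
          2 * Real.pi * (1 + ε) / 3 * (1 / R + 2 * besselKZero (m / N) / m)⁻¹) := by
  have hpi := Real.pi_pos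
  set τ := 2 * Real.pi / 3 with hτ
  have hτ0 : 0 < τ := by positivity
  obtain ⟨R₀, N₀, hR₀, hN₀, h1⟩ :=
    exists_abs_equilibriumPotential_sub_le (η := τ * ε / 8) (by positivity)
  obtain ⟨δ, hδ, h2⟩ := exists_killRate_mul_sum_fibreSum_le (η := τ * ε / 8) (by positivity)
  obtain ⟨t₀, ht₀, h3⟩ := exists_le_besselKZero (64 / ε)
  -- The four entries serve, in order, the limit `2π/3`, the smallness of the interior term, `K₀ ≥
  -- 64/ε`, and the exponential factor in `le_screened_succ`.
  set C₂ := max (max N₀ (1 / δ)) (max (1 / t₀) (80 / ε)) with hC₂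
  have hC₂N : N₀ ≤ C₂ := (le_max_left _ _).trans (le_max_left _ _)
  have hC₂δ : 1 / δ ≤ C₂ := (le_max_right _ _).trans (le_max_left _ _)
  have hC₂t : 1 / t₀ ≤ C₂ := (le_max_left _ _).trans (le_max_right _ _)
  have hC₂ε : 80 / ε ≤ C₂ := (le_max_right _ _).trans (le_max_right _ _)
  have hC₂0 : 0 < C₂ := by linarith
  refine ⟨max R₀ (16 / ε), C₂, 1 / t₀, by positivity, hC₂0, by positivity,
    fun N R hN m _ hR hRN hmN => ?_⟩
  have hm : (0 : ℝ) < m := Nat.cast_pos.2 (NeZero.pos m)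
  have hRR₀ : R₀ ≤ R := (le_max_left _ _).trans hR
  have hR16 : 16 / ε ≤ R := (le_max_right _ _).trans hR
  have hR16' : 16 ≤ ε * R := by rw [div_le_iff₀ hε0] at hR16; linarith
  have hR4 : 4 ≤ R := by nlinarith
  have hR0 : 0 < R := by linarith
  have hN0 : 0 < N := by linarith
  have hRC : C₂ * R ≤ N := by
    rw [one_div, ← div_eq_inv_mul, le_div_iff₀ hC₂0] at hRN
    linarith
  have hNN : N₀ ≤ N := by nlinarith
  have hRδ : R ≤ δ * N := by
    have : 1 / δ * R ≤ N := (by gcongr : 1 / δ * R ≤ C₂ * R).trans hRC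
    rw [one_div, inv_mul_le_iff₀ hδ] at this
    exact this
  have hRt : R ≤ t₀ * N := by
    have : 1 / t₀ * R ≤ N := (by gcongr : 1 / t₀ * R ≤ C₂ * R).trans hRC
    rw [one_div, inv_mul_le_iff₀ ht₀] at this
    exact this
  have hRε : 80 * R ≤ ε * N := by
    have : 80 / ε * R ≤ N := (by gcongr : 80 / ε * R ≤ C₂ * R).trans hRC
    rw [div_mul_eq_mul_div, div_le_iff₀ hε0] at this
    linarith
  rw [one_div_one_div] at hmN
  have hmax : max R m / N ≤ t₀ := by
    rw [div_le_iff₀ hN0]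
    exact max_le hRt hmN
  have hK := h3 _ (max_div_pos hN m) hmax
  set K := besselKZero (max R m / N) with hKd
  have hK64 : 64 ≤ ε * K := by
    have := hK
    rw [div_le_iff₀ hε0] at this
    linarith
  have hK0 : 64 < K := by nlinarith
  constructor
  · intro hcond
    obtain ⟨A, hA⟩ := (finite_slabDisk (m := m) R).exists_finset_coe
    have hBA : slabBall m R ⊆ A := by rw [hA]; exact slabBall_subset_slabDisk R
    have hmem : ∀ a ∈ A, a ∈ slabDisk m R := fun a ha => by rw [← hA]; exact ha
    have h4 := abs_le.1 (h1 N R hNN hRR₀ m A hBA)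
    have h5 := h2 N R hN (by linarith) hRδ m A fun a ha => (hmem a ha).1
    have h6 := sub_le_slabCap_mul hN hR4 hBA h5
    rw [← hKd, hA] at h6
    have hcap0 := slabCap_nonneg (N := N) (slabDisk m R)
    have h7 := sharp_lower hε0 hε1 hR16' hK64 hm
      (T := equilibriumPotential N A - τ * ε / 8) (by rw [← hτ]; linarith [h4.1]) h6 hcap0
    refine ⟨sharp_lower_disk hε0 hε1 hR0 (by linarith) hm hcond hcap0 h7,
      sharp_upper_disk hε0 hε1 hK64 hm (T := equilibriumPotential N A)
        (by rw [← hτ]; linarith [h4.2]) ?_⟩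
    rw [← hA]
    exact slabCap_mul_le_equilibriumPotential fun a ha =>
      (le_add_of_nonneg_left (yukawa_nonneg _ _)).trans
        (le_fibreSum hN a (max_horNorm_le (m := m) (hmem a ha).1))
  · intro hcond
    -- Failure of the first alternative gives `εKR < m`, and `εK ≥ 64`. Hence `R ∨ m = m` and both
    -- `K₀` terms coincide.
    have hRm : R < m := by
      rw [div_lt_div_iff₀ hm (by positivity)] at hcond
      nlinarith
    have hmaxm : max R (m : ℝ) = m := max_eq_right hRm.le
    have hKm' : besselKZero (m / N) = K := by rw [hKd, hmaxm]
    rw [hKm']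
    obtain ⟨A, hA⟩ := (finite_slabBall (m := m) R).exists_finset_coe
    have hmem : ∀ a ∈ A, a ∈ slabBall m R := fun a ha => by rw [← hA]; exact ha
    have h4 := abs_le.1 (h1 N R hNN hRR₀ m A hA.ge)
    have h5 := h2 N R hN (by linarith) hRδ m A fun a ha =>
      (slabBall_subset_slabDisk R (hmem a ha)).1
    have h6 := sub_le_slabCap_mul hN hR4 hA.ge h5
    rw [← hKd, hA] at h6
    have hcap0 := slabCap_nonneg (N := N) (slabBall m R)
    have h7 := sharp_lower hε0 hε1 hR16' hK64 hm
      (T := equilibriumPotential N A - τ * ε / 8) (by rw [← hτ]; linarith [h4.1]) h6 hcap0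
    refine ⟨sharp_lower_ball hε0 hε1 hR0 (by linarith) hm hcap0 h7,
      sharp_upper_ball hε0 hε1 (by positivity) (T := equilibriumPotential N A)
        (by rw [← hτ]; linarith [h4.2]) ?_⟩
    rw [← hA]
    refine slabCap_mul_le_equilibriumPotential fun a ha => ?_
    have hma := hmem a ha
    have f1 := le_fibreSum hN a (max_horNorm_le (m := m) (slabBall_subset_slabDisk R hma).1)
    rw [← hKd] at f1
    have hr : regNorm (a.1, vertRep a) ≤ R + 1 := by
      have g1 : slabNorm a < R := hma
      have g2 := pow_le_pow_left₀ (slabNorm_nonneg a) g1.le 2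
      rw [slabNorm_sq, horNorm_sq] at g2
      refine Real.sqrt_le_iff.2 ⟨by positivity, ?_⟩
      simp only
      linarith
    have f2 : (1 - ε / 8) * (1 / R) ≤ yukawa (screening N) (a.1, vertRep a) :=
      (le_screened_succ hε0 hε1 hN hR16' hRε).trans
        (screened_anti (screening_pos hN).le (regNorm_pos _) hr)
    have f3 : (1 - ε / 8) * (2 * K / m) ≤ 2 * (K - 5) / m := by
      rw [← mul_div_assoc]
      exact div_le_div_of_nonneg_right (by linarith) hm.le
    rw [mul_add]
    exact (add_le_add f2 f3).trans f1

end Sharp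

/-! ### Height profiles and conclusion. -/

lemma slabHeight_pos {h : ℝ → ℝ} (hh : IsHeightProfile h) {N : ℝ} (hN : 1 ≤ N) :
    0 < slabHeight h N := Nat.floor_pos.2 (hh.one_le N hN)

lemma slabHeight_le {h : ℝ → ℝ} (hh : IsHeightProfile h) {N : ℝ} (hN : 1 ≤ N) :
    (slabHeight h N : ℝ) ≤ N :=
  (Nat.floor_le (by linarith [hh.one_le N hN])).trans (hh.le_self N hN)

end
theorem mainTheorem9 :
    (∀ Crange : ℝ, 0 < Crange → ∃ c C : ℝ, 0 < c ∧ 0 < C ∧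
      ∀ (h : ℝ → ℝ), IsHeightProfile h → ∀ N : ℝ, 1 ≤ N →
        (∀ R : ℝ, 1 ≤ R → R ≤ Crange * N →
          c * slabF N (slabHeight h N) R ≤ slabCap N (slabBall (slabHeight h N) R) ∧
          slabCap N (slabBall (slabHeight h N) R) ≤ slabCap N (slabDisk (slabHeight h N) R) ∧
          slabCap N (slabDisk (slabHeight h N) R) ≤ C * slabF N (slabHeight h N) R) ∧
        c * (slabHeight h N : ℝ) ≤ slabCap N (slabBall (slabHeight h N) N) ∧
        slabCap N (slabBall (slabHeight h N) N) ≤ slabCap N (slabDisk (slabHeight h N) N) ∧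
        slabCap N (slabDisk (slabHeight h N) N) ≤ C * (slabHeight h N : ℝ)) ∧
    (∀ ε : ℝ, 0 < ε → ε < 1 → ∃ C₁ C₂ C₃ : ℝ, 0 < C₁ ∧ 0 < C₂ ∧ 0 < C₃ ∧
      ∀ (h : ℝ → ℝ), IsHeightProfile h → ∀ N R : ℝ, 1 ≤ N →
        C₁ ≤ R → R ≤ 1 / C₂ * N → (slabHeight h N : ℝ) ≤ 1 / C₃ * N →
        (1 / (ε * R) ≤
            besselKZero (max R (slabHeight h N : ℝ) / N) / (slabHeight h N : ℝ) →
          Real.pi * (1 - ε) / 3 *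
              ((slabHeight h N : ℝ) / besselKZero (max R (slabHeight h N : ℝ) / N)) ≤
            slabCap N (slabDisk (slabHeight h N) R) ∧
          slabCap N (slabDisk (slabHeight h N) R) ≤
            Real.pi * (1 + ε) / 3 *
              ((slabHeight h N : ℝ) / besselKZero (max R (slabHeight h N : ℝ) / N))) ∧
        (besselKZero (max R (slabHeight h N : ℝ) / N) / (slabHeight h N : ℝ) < 1 / (ε * R) →
          2 * Real.pi * (1 - ε) / 3 *
              (1 / R + 2 * besselKZero ((slabHeight h N : ℝ) / N) / (slabHeight h N : ℝ))⁻¹ ≤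
            slabCap N (slabBall (slabHeight h N) R) ∧
          slabCap N (slabBall (slabHeight h N) R) ≤
            2 * Real.pi * (1 + ε) / 3 *
              (1 / R + 2 * besselKZero ((slabHeight h N : ℝ) / N) / (slabHeight h N : ℝ))⁻¹)) := by
  refine ⟨fun C₀ hC₀ => ?_, fun ε hε0 hε1 => ?_⟩
  -- Working with `max C₀ 1` makes `R = N` admissible even when `C₀ < 1`.
  · obtain ⟨c, hc0, hc⟩ := exists_le_slabCap_slabBall (le_max_right C₀ 1)
    obtain ⟨C, hC0, hC⟩ := exists_slabCap_slabDisk_le (le_max_right C₀ 1)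
    have hK := besselKZero_pos one_pos
    refine ⟨min c (c * min 1 (1 / besselKZero 1)), max C (C / besselKZero 1),
      by positivity, by positivity, fun h hh N hN => ?_⟩
    have : NeZero (slabHeight h N) := ⟨(slabHeight_pos hh hN).ne'⟩
    have hmN := slabHeight_le hh hN
    have hmono : ∀ R, slabCap N (slabBall (slabHeight h N) R) ≤
        slabCap N (slabDisk (slabHeight h N) R) := fun R =>
      slabCap_mono hN (finite_slabDisk R) (slabBall_subset_slabDisk R)
    generalize slabHeight h N = m at *
    refine ⟨fun R hR hRN => ⟨?_, hmono R, ?_⟩, ?_, hmono N, ?_⟩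
    · refine le_trans ?_ (hc N hN m hmN R hR (hRN.trans (by gcongr; exact le_max_left _ _)))
      exact mul_le_mul_of_nonneg_right (min_le_left _ _) (slabF_nonneg hN (by linarith) m)
    · refine (hC N hN m hmN R hR (hRN.trans (by gcongr; exact le_max_left _ _))).trans ?_
      exact mul_le_mul_of_nonneg_right (le_max_left _ _) (slabF_nonneg hN (by linarith) m)
    all_goals
      have hNC : N ≤ max C₀ 1 * N := le_mul_of_one_le_left (by linarith) (le_max_right _ _)
      have hm0 : (0 : ℝ) ≤ m := Nat.cast_nonneg m
      -- At `R = N` the argument of `K₀` is exactly 1, and `m ≤ N` makes the minimum comparable to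
      -- `m`.
      have hF : slabF N m N = min N (m / besselKZero 1) := by
        rw [slabF, max_eq_left hmN, div_self (by linarith)]
    · refine le_trans ?_ (hc N hN m hmN N hN hNC)
      rw [hF]
      calc _ ≤ c * min 1 (1 / besselKZero 1) * m :=
            mul_le_mul_of_nonneg_right (min_le_right _ _) hm0
        _ = c * (min 1 (1 / besselKZero 1) * m) := by ring
        _ ≤ _ := by
          refine mul_le_mul_of_nonneg_left (le_min ?_ ?_) hc0.le
          · exact (mul_le_of_le_one_left hm0 (min_le_left _ _)).trans hmN
          · rw [div_eq_mul_one_div (m : ℝ), mul_comm (m : ℝ)]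
            exact mul_le_mul_of_nonneg_right (min_le_right _ _) hm0
    · refine (hC N hN m hmN N hN hNC).trans ?_
      rw [hF]
      calc _ ≤ C * (m / besselKZero 1) := mul_le_mul_of_nonneg_left (min_le_right _ _) hC0.le
        _ = C / besselKZero 1 * m := by ring
        _ ≤ _ := mul_le_mul_of_nonneg_right (le_max_right _ _) hm0
  · obtain ⟨C₁, C₂, C₃, h1, h2, h3, H⟩ := exists_sharp hε0 hε1
    refine ⟨C₁, C₂, C₃, h1, h2, h3, fun h hh N R hN hR hRN hmN => ?_⟩
    have : NeZero (slabHeight h N) := ⟨(slabHeight_pos hh hN).ne'⟩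
    exact H N R hN (slabHeight h N) hR hRN hmN
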